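/- All manifolds, metrics, functions and maps are smooth, manifolds are without boundary, Hausdorff and second countable. For $i=1,2$ let $(X_i,g_i)$ be a complete Riemannian manifold of dimension $n_i+1$ ($n_i\ge 0$) and let $f_i:X_i\to\mathbb{R}$ be a smooth function such that 1) the sectional curvature of $X_i$ is bounded: $|K|\le\Lambda_i$ for some constant $\Lambda_i$; 2) $\|\operatorname{grad} f_i\|\equiv 1$; 3) $f_i$ has pinched convex levels: there are constants $0<c_1\le c_2$ (depending on $i$) such that $c_1\le (f_i\circ c)''(0)\le c_2$ for every unit speed geodesic $c:(-\eta,\eta)\to X_i$, $\eta>0$, with $\dot c(0)\perp \operatorname{grad} f_i(c(0))$; 4) there is $\delta_i>0$ such that $K(\sigma)<-\delta_i$ for every $p\in X_i$ and every tangent plane $\sigma\subset T_pX_i$ that contains $\operatorname{grad} f_i(p)$. Then for $i=1,2$ there are an $n_i$-dimensional manifold $N_i$ and a diffeomorphism $\Phi_i:\mathbb{R}\times N_i\to X_i$ with $f_i(\Phi_i(t,y))=t$ and $\frac{\partial}{\partial t}\Phi_i(t,y)=\operatorname{grad} f_i(\Phi_i(t,y))$ for all $(t,y)\in\mathbb{R}\times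 N_i$ (so that $X_i=\mathbb{R}\times N_i$, with metric of the form $dt^2+g_i(t)$, where $g_i(t)$ is a metric on $N_i$). For any such $N_i,\Phi_i$, let $Y=\mathbb{R}\times N_1\times N_2$ and $$ j:Y\to X_1\times X_2,\qquad j(t,y,\tilde y)=(\Phi_1(t,y),\Phi_2(t,\tilde y)), $$ that is, $(t,y,\tilde y)\mapsto(t,y,t,\tilde y)$ under these identifications. Then $j$ is a smooth embedding, and the induced Riemannian metric $g_Y=j^*(g_1\oplus g_2)$ is Lipschitz equivalent to a metric of pinched negative sectional curvature: there are a Riemannian metric $h$ on $Y$ and constants $L>0$ and $0<a\le b$ such that $d_h\le L\,d_{g_Y}$ and $d_{g_Y}\le L\,d_h$ on $Y\times Y$ for the Riemannian distances, and $-b^2\le K\le -a^2$ for the sectional curvature $K$ of every tangent plane of $(Y,h)$. -/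

import Mathlib

open scoped Manifold ContDiff ENNReal NNReal Topology

universe u₁ u₂ v₁ v₂

noncomputable section

namespace RiemGeom

section General

variable {E : Type*} [NormedAddCommGroup E] [NormedSpace ℝ E]
  {H : Type*} [TopologicalSpace H]

/-- A smooth Riemannian metric on the manifold `M`. The definitions below are meant for
finite-dimensional manifolds without boundary. -/
abbrev SmoothMetric (I : ModelWithCorners ℝ E H) (M : Type*) [TopologicalSpace M]
    [ChartedSpace H M] [IsManifold I ∞ M] :=
  Bundle.ContMDiffRiemannianMetric I ∞ E (fun x : M => TangentSpace I x)

variable {I : ModelWithCorners ℝ E H} {M : Type*} [TopologicalSpace M] [ChartedSpace H M]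
  [IsManifold I ∞ M]

open scoped Bundle in
/-- The Riemannian distance of `g`: the infimum of the `g`-lengths of `C¹` paths from `x` to `y`
(it is `∞` if and only if there is no such path). -/
def rdist (g : SmoothMetric I M) (x y : M) : ℝ≥0∞ :=
  letI : Bundle.RiemannianBundle (fun x : M => TangentSpace I x) := ⟨g.toRiemannianMetric⟩
  Manifold.riemannianEDist I x y

/-- `(M, g)` is complete: every sequence that is Cauchy for the Riemannian distance converges
for the Riemannian distance. -/
def IsCompleteMetric (g : SmoothMetric I M) : Prop :=
  ∀ s : ℕ → M,
    (∀ ε : ℝ≥0∞, 0 < ε → ∃ k : ℕ, ∀ m ≥ k, ∀ n ≥ k, rdist g (s m) (s n) < ε) →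
    ∃ x : M, Filter.Tendsto (fun n => rdist g (s n) x) Filter.atTop (𝓝 0)

/-- The metric tensor in the preferred chart at `x`, as a function `z ↦ (gᵢⱼ(z))` of the
coordinates `z ∈ E`. -/
def coordMetric (g : SmoothMetric I M) (x : M) (z : E) : E →L[ℝ] E →L[ℝ] ℝ :=
  let φ : E → M := (extChartAt I x).symm
  let d : E →L[ℝ] E := mfderiv 𝓘(ℝ, E) I φ z
  let B : E →L[ℝ] E →L[ℝ] ℝ := g.inner (φ z)
  B.bilinearComp d d

/-- The Christoffel symbols of `g` in the preferred chart at `x`, at the coordinate point `z`: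
`christoffel g x z u v = Γᵏᵢⱼ(z) uⁱ vʲ eₖ` with
`g(Γ(u, v), w) = ½ (D_u g (v, w) + D_v g (u, w) - D_w g (u, v))`. -/
def christoffel (g : SmoothMetric I M) (x : M) (z u v : E) : E :=
  let G : E → E →L[ℝ] E →L[ℝ] ℝ := coordMetric g x
  let D : E →L[ℝ] E →L[ℝ] E →L[ℝ] ℝ := fderiv ℝ G z
  (G z).inverse ((1 / 2 : ℝ) • (D u v + D v u - (D.flip u).flip v))

/-- The Riemann curvature tensor `R(u, v) w` at `x`, computed in the preferred chart at `x` (whose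
differential at `x` identifies `TangentSpace I x` with `E` by the identity):
`R(u, v) w = D_u Γ (v, w) - D_v Γ (u, w) + Γ(u, Γ(v, w)) - Γ(v, Γ(u, w))`. -/
def riemannTensor (g : SmoothMetric I M) (x : M) (u v w : TangentSpace I x) :
    TangentSpace I x :=
  let z₀ : E := extChartAt I x x
  let Γ : E → E → E → E := christoffel g x
  let u' : E := u
  let v' : E := v
  let w' : E := w
  (fderiv ℝ (fun z => Γ z v' w') z₀ u' - fderiv ℝ (fun z => Γ z u' w') z₀ v'
    + Γ z₀ u' (Γ z₀ v' w') - Γ z₀ v' (Γ z₀ u' w') : E)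

/-- The sectional curvature of the plane spanned by the linearly independent tangent vectors
`u`, `v` at `x`. -/
def sectionalCurvature (g : SmoothMetric I M) (x : M) (u v : TangentSpace I x) : ℝ :=
  g.inner x (riemannTensor g x u v v) u /
    (g.inner x u u * g.inner x v v - g.inner x u v ^ 2)

/-- The sectional curvature of `g` is pinched between two negative constants. -/
def HasPinchedNegativeCurvature (g : SmoothMetric I M) : Prop :=
  ∃ a b : ℝ, 0 < a ∧ a ≤ b ∧ ∀ (x : M) (u v : TangentSpace I x), LinearIndependent ℝ ![u, v] →
    -b ^ 2 ≤ sectionalCurvature g x u v ∧ sectionalCurvature g x u v ≤ -a ^ 2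

/-- Lipschitz equivalence of two Riemannian metrics on `M`: the identity map is bilipschitz for the
two Riemannian distances. -/
def LipschitzEquivalent (g h : SmoothMetric I M) : Prop :=
  ∃ L : ℝ≥0, 0 < L ∧ ∀ x y : M, rdist h x y ≤ L * rdist g x y ∧ rdist g x y ≤ L * rdist h x y

/-- The gradient of `f`: `g (grad f, w) = df (w)` for all `w`. -/
def grad (g : SmoothMetric I M) (f : M → ℝ) (x : M) : TangentSpace I x :=
  (g.inner x).inverse (mfderiv I 𝓘(ℝ, ℝ) f x)

/-- The velocity vector of a curve. -/
def velocity (I : ModelWithCorners ℝ E H) (c : ℝ → M) (t : ℝ) : TangentSpace I (c t) :=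
  mfderiv 𝓘(ℝ, ℝ) I c t (1 : ℝ)

/-- `c` restricted to the interval `(-η, η)` is a geodesic: it is `C²` and satisfies the geodesic
equation `γ'' + Γ(γ', γ') = 0` at every time `t` in the preferred chart at `c t`. -/
def IsGeodesicOn (g : SmoothMetric I M) (c : ℝ → M) (η : ℝ) : Prop :=
  ContMDiffOn 𝓘(ℝ, ℝ) I 2 c (Set.Ioo (-η) η) ∧
  ∀ t ∈ Set.Ioo (-η) η,
    let γ : ℝ → E := fun s => extChartAt I (c t) (c s)
    deriv (deriv γ) t + christoffel g (c t) (γ t) (deriv γ t) (deriv γ t) = 0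

/-- `f` has pinched convex levels. -/
def HasPinchedConvexLevels (g : SmoothMetric I M) (f : M → ℝ) : Prop :=
  ∃ c₁ c₂ : ℝ, 0 < c₁ ∧ c₁ ≤ c₂ ∧ ∀ (η : ℝ) (c : ℝ → M), 0 < η → IsGeodesicOn g c η →
    (∀ t ∈ Set.Ioo (-η) η, g.inner (c t) (velocity I c t) (velocity I c t) = 1) →
    g.inner (c 0) (velocity I c 0) (grad g f (c 0)) = 0 →
    c₁ ≤ deriv (deriv (fun t => f (c t))) 0 ∧ deriv (deriv (fun t => f (c t))) 0 ≤ c₂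

/-- `(M, g)` is a complete Riemannian manifold of bounded sectional curvature, and the smooth
function `f` on it has a gradient of norm one and pinched convex levels, such that the planes that
contain the gradient have sectional curvature bounded above by a negative constant. -/
structure AdmissiblePair (g : SmoothMetric I M) (f : M → ℝ) : Prop where
  complete : IsCompleteMetric g
  smooth : ContMDiff I 𝓘(ℝ, ℝ) ∞ f
  bounded_curvature : ∃ Λ : ℝ, ∀ (x : M) (u v : TangentSpace I x),
    LinearIndependent ℝ ![u, v] → |sectionalCurvature g x u v| ≤ Λ
  norm_grad : ∀ x : M, g.inner x (grad g f x) (grad g f x) = 1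
  pinched_convex_levels : HasPinchedConvexLevels g f
  radial_curvature : ∃ δ : ℝ, 0 < δ ∧ ∀ (x : M) (v : TangentSpace I x),
    LinearIndependent ℝ ![grad g f x, v] → sectionalCurvature g x (grad g f x) v < -δ

end General

section Splitting

variable {n : ℕ} {X : Type*} [TopologicalSpace X]
  [ChartedSpace (EuclideanSpace ℝ (Fin (n + 1))) X] [IsManifold (𝓡 (n + 1)) ∞ X]

/-- The diffeomorphism `Φ : ℝ × N → X` is the splitting of `X` defined by `f`: the slices
`{t} × N` are the level sets `f = t`, and the lines `ℝ × {p}` are the integral curves of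
`grad f`. -/
structure IsGradientSplitting (g : SmoothMetric (𝓡 (n + 1)) X) (f : X → ℝ)
    {N : Type*} [TopologicalSpace N] [ChartedSpace (EuclideanSpace ℝ (Fin n)) N]
    (Φ : (ℝ × N) ≃ₘ^∞⟮𝓘(ℝ, ℝ).prod (𝓡 n), 𝓡 (n + 1)⟯ X) : Prop where
  level : ∀ (t : ℝ) (p : N), f (Φ (t, p)) = t
  flow : ∀ (t : ℝ) (p : N),
    velocity (𝓡 (n + 1)) (fun s => Φ (s, p)) t = grad g f (Φ (t, p))

/-- There is a manifold `N` with a diffeomorphism `ℝ × N → X` that is the splitting of `X`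
defined by `f`. -/
def HasGradientSplitting {X : Type u₁} [TopologicalSpace X]
    [ChartedSpace (EuclideanSpace ℝ (Fin (n + 1))) X] [IsManifold (𝓡 (n + 1)) ∞ X]
    (g : SmoothMetric (𝓡 (n + 1)) X) (f : X → ℝ) : Prop :=
  ∃ (N : Type u₁) (_ : TopologicalSpace N) (_ : T2Space N) (_ : SecondCountableTopology N)
    (_ : ChartedSpace (EuclideanSpace ℝ (Fin n)) N) (_ : IsManifold (𝓡 n) ∞ N)
    (Φ : (ℝ × N) ≃ₘ^∞⟮𝓘(ℝ, ℝ).prod (𝓡 n), 𝓡 (n + 1)⟯ X), IsGradientSplitting g f Φ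

end Splitting

section Diagonal

/-- The embedding `(t, y, y') ↦ (t, y, t, y')`, where `X₁` and `X₂` are written as products
through `Φ₁ : ℝ × N₁ → X₁` and `Φ₂ : ℝ × N₂ → X₂`. -/
def diagonalMap {N₁ N₂ X₁ X₂ : Type*} (Φ₁ : ℝ × N₁ → X₁) (Φ₂ : ℝ × N₂ → X₂) :
    ℝ × N₁ × N₂ → X₁ × X₂ :=
  fun q => (Φ₁ (q.1, q.2.1), Φ₂ (q.1, q.2.2))

variable {E₁ E₂ F H₁ H₂ K : Type*}
  [NormedAddCommGroup E₁] [NormedSpace ℝ E₁] [TopologicalSpace H₁]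
  [NormedAddCommGroup E₂] [NormedSpace ℝ E₂] [TopologicalSpace H₂]
  [NormedAddCommGroup F] [NormedSpace ℝ F] [TopologicalSpace K]
  {I₁ : ModelWithCorners ℝ E₁ H₁} {I₂ : ModelWithCorners ℝ E₂ H₂} {J : ModelWithCorners ℝ F K}
  {X₁ : Type*} [TopologicalSpace X₁] [ChartedSpace H₁ X₁] [IsManifold I₁ ∞ X₁]
  {X₂ : Type*} [TopologicalSpace X₂] [ChartedSpace H₂ X₂] [IsManifold I₂ ∞ X₂]
  {Y : Type*} [TopologicalSpace Y] [ChartedSpace K Y] [IsManifold J ∞ Y]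

/-- The Riemannian product metric `g₁ ⊕ g₂` on `X₁ × X₂`. -/
def prodInner (g₁ : SmoothMetric I₁ X₁) (g₂ : SmoothMetric I₂ X₂) (p : X₁ × X₂)
    (u v : TangentSpace (I₁.prod I₂) p) : ℝ :=
  let u' : TangentSpace I₁ p.1 × TangentSpace I₂ p.2 := u
  let v' : TangentSpace I₁ p.1 × TangentSpace I₂ p.2 := v
  g₁.inner p.1 u'.1 v'.1 + g₂.inner p.2 u'.2 v'.2

/-- `i : (Y, gY) → (X₁, g₁) × (X₂, g₂)` is a Riemannian embedding: a smooth map that is a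
homeomorphism onto its image, with `gY = i^* (g₁ ⊕ g₂)` (so that it is an immersion). -/
structure IsRiemannianEmbedding (g₁ : SmoothMetric I₁ X₁) (g₂ : SmoothMetric I₂ X₂)
    (gY : SmoothMetric J Y) (i : Y → X₁ × X₂) : Prop where
  smooth : ContMDiff J (I₁.prod I₂) ∞ i
  embedding : Topology.IsEmbedding i
  isometric : ∀ (y : Y) (u v : TangentSpace J y),
    gY.inner y u v =
      prodInner g₁ g₂ (i y) (mfderiv J (I₁.prod I₂) i y u) (mfderiv J (I₁.prod I₂) i y v)

end Diagonal

end RiemGeom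

end

/-! In the coordinates given by the gradient flow the two metrics are `dt² + γ₁(t)` and `dt² +
γ₂(t)`, so the induced metric on `Y` is `2 dt² + γ₁(t) + γ₂(t)`. The metric `h` is `ρ dt² + γ₁(t) +
γ₂(t)` with a small constant `ρ`. Both lie in the family `fibreMetric ρ`, which is comparable to
`fibreMetric 2` with factor `2 / ρ`; this is the Lipschitz equivalence.

For the curvature, let `Sᵢ` be the second fundamental form of the slices, that is, the Hessian of
`fᵢ` along the level sets. The slices of `h` are products of slices, and the unit normal of `h` is
`ρ^(-1/2) ∂_t`, so the second fundamental form becomes `ρ^(-1/2) (S₁ + S₂)`. Comparing Gauss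
equations suggests the identity proved in `curvature_fibreMetric` for all `u`, `v`: `R_h(u,v,v,u) =
R₁ + R₂ + det S₁ + det S₂ - ρ⁻¹ det (S₁ + S₂)`, where the determinants are those of the restrictions
to the pair `u, v`.

Every plane has an `h`-orthogonal basis `a ∂_t + w`, `v` with `w`, `v` tangent to the slice. By
convexity `det (S₁ + S₂) ≥ c₁² |w|² |v|²`, so for small `ρ` the last term beats every other term of
size `|w|² |v|²`. The part of size `a² |v|²` is negative by the radial curvature bound, and the
mixed part, linear in `a`, is absorbed using `|K| ≤ Λ` (`curvatureForm_le`).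
`curvature_bounds_fibreMetric` assembles these estimates.

The splitting exists because a unit gradient field on a complete manifold has a global flow
(`exists_isMIntegralCurve_of_complete`), which is smooth (`IsSmoothField.exists_flow`) and raises
`f` at unit speed. One takes `N = f⁻¹(0)`.

Curvature and Hessian are defined pointwise in one preferred chart, whereas the computation needs
the coordinates of the splitting. The naturality lemmas `IsCoordIsometry.fderiv_curvature` and
`IsCoordIsometry.coordHessian_comp` provide the passage. -/

noncomputable section

namespace RiemGeom

set_option maxSynthPendingDepth 3
set_option linter.unusedSectionVars false

/-! ### Levi-Civita calculus of a metric tensor on an open subset of a vector space. -/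

section CoordinateGeometry

variable {E : Type*} [NormedAddCommGroup E] [NormedSpace ℝ E]
  {E' : Type*} [NormedAddCommGroup E'] [NormedSpace ℝ E']

/-- The right-hand side of the Koszul formula in coordinates. -/
def koszul (D : E →L[ℝ] E →L[ℝ] E →L[ℝ] ℝ) : E →L[ℝ] E →L[ℝ] E →L[ℝ] ℝ :=
  (1 / 2 : ℝ) • (D + D.flip -
    ((ContinuousLinearMap.flipₗᵢ ℝ E E ℝ).toContinuousLinearEquiv :
      (E →L[ℝ] E →L[ℝ] ℝ) →L[ℝ] (E →L[ℝ] E →L[ℝ] ℝ)) ∘L D.flip)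

lemma koszul_apply (D : E →L[ℝ] E →L[ℝ] E →L[ℝ] ℝ) (u v w : E) :
    koszul D u v w = (1 / 2 : ℝ) * (D u v w + D v u w - D w u v) := by
  simp [koszul]

lemma contDiff_koszul {n : WithTop ℕ∞} :
    ContDiff ℝ n (koszul : (E →L[ℝ] E →L[ℝ] E →L[ℝ] ℝ) → _) := by
  have h : ContDiff ℝ n (fun D : E →L[ℝ] E →L[ℝ] E →L[ℝ] ℝ => D.flip) :=
    (ContinuousLinearMap.flipₗᵢ ℝ E E (E →L[ℝ] ℝ)).contDiff
  unfold koszul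
  exact ((contDiff_id.add h).sub (contDiff_const.clm_comp h)).const_smul (1 / 2 : ℝ)

/-- The Christoffel symbols of a metric tensor on a vector space, as a bilinear map. -/
def coordChristoffel (G : E → E →L[ℝ] E →L[ℝ] ℝ) (z : E) : E →L[ℝ] E →L[ℝ] E :=
  (ContinuousLinearMap.compL ℝ E (E →L[ℝ] ℝ) E (G z).inverse) ∘L koszul (fderiv ℝ G z)

/-- The curvature tensor of a metric tensor on a vector space. -/
def coordCurvature (G : E → E →L[ℝ] E →L[ℝ] ℝ) (z u v w : E) : E :=
  fderiv ℝ (coordChristoffel G) z u v w - fderiv ℝ (coordChristoffel G) z v u w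
    + coordChristoffel G z u (coordChristoffel G z v w)
    - coordChristoffel G z v (coordChristoffel G z u w)

/-- `G` is a smooth Riemannian metric tensor on the open set `s`. -/
structure IsMetricOn (G : E → E →L[ℝ] E →L[ℝ] ℝ) (s : Set E) : Prop where
  isOpen : IsOpen s
  smooth : ContDiffOn ℝ ∞ G s
  symm : ∀ z ∈ s, ∀ u v, G z u v = G z v u
  pos : ∀ z ∈ s, ∀ u, u ≠ 0 → 0 < G z u u

lemma fderiv_clm_apply_const₂ {F₁ F₂ F₃ : Type*} [NormedAddCommGroup F₁] [NormedSpace ℝ F₁]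
    [NormedAddCommGroup F₂] [NormedSpace ℝ F₂] [NormedAddCommGroup F₃] [NormedSpace ℝ F₃]
    {B : E → F₁ →L[ℝ] F₂ →L[ℝ] F₃} {z : E}
    (hB : DifferentiableAt ℝ B z) (v : F₁) (w : F₂) (u : E) :
    fderiv ℝ (fun y => B y v w) z u = fderiv ℝ B z u v w := by
  have := ((hB.hasFDerivAt.clm_apply (hasFDerivAt_const v z)).clm_apply
    (hasFDerivAt_const w z)).fderiv
  rw [this]; simp

lemma contDiff_flip {F₁ F₂ : Type*} [NormedAddCommGroup F₁] [NormedSpace ℝ F₁]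
    [NormedAddCommGroup F₂] [NormedSpace ℝ F₂] {n : WithTop ℕ∞} :
    ContDiff ℝ n (fun B : F₁ →L[ℝ] F₂ →L[ℝ] ℝ => B.flip) :=
  (ContinuousLinearMap.flipₗᵢ ℝ F₁ F₂ ℝ).contDiff

lemma contDiffOn_bilinearComp {F : Type*} [NormedAddCommGroup F] [NormedSpace ℝ F]
    {n : WithTop ℕ∞} {s : Set E} {B : E → E' →L[ℝ] E' →L[ℝ] ℝ} {L : E → F →L[ℝ] E'}
    (hB : ContDiffOn ℝ n B s) (hL : ContDiffOn ℝ n L s) :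
    ContDiffOn ℝ n (fun z => (B z).bilinearComp (L z) (L z)) s :=
  contDiff_flip.comp_contDiffOn
    ((contDiff_flip.comp_contDiffOn (hB.clm_comp hL)).clm_comp hL)

namespace IsMetricOn

variable {G : E → E →L[ℝ] E →L[ℝ] ℝ} {s : Set E}

lemma eq_of_forall (h : IsMetricOn G s) {z : E} (hz : z ∈ s) {a b : E}
    (hab : ∀ w, G z a w = G z b w) : a = b := by
  by_contra hne
  have := h.pos z hz (a - b) (sub_ne_zero.2 hne)
  simp [hab] at this

lemma contDiffAt (h : IsMetricOn G s) {z : E} (hz : z ∈ s) : ContDiffAt ℝ ∞ G z :=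
  h.smooth.contDiffAt (h.isOpen.mem_nhds hz)

lemma differentiableAt (h : IsMetricOn G s) {z : E} (hz : z ∈ s) : DifferentiableAt ℝ G z :=
  (h.contDiffAt hz).differentiableAt (by simp)

lemma fderiv_symm (h : IsMetricOn G s) {z : E} (hz : z ∈ s) (u v w : E) :
    fderiv ℝ G z u v w = fderiv ℝ G z u w v := by
  rw [← fderiv_clm_apply_const₂ (h.differentiableAt hz),
    ← fderiv_clm_apply_const₂ (h.differentiableAt hz)]
  congr 1
  apply Filter.EventuallyEq.fderiv_eq
  filter_upwards [h.isOpen.mem_nhds hz] with y hy using h.symm y hy v w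

section FiniteDimensional

variable [FiniteDimensional ℝ E]

lemma exists_equiv (h : IsMetricOn G s) {z : E} (hz : z ∈ s) :
    ∃ e : E ≃L[ℝ] (E →L[ℝ] ℝ), (e : E →L[ℝ] (E →L[ℝ] ℝ)) = G z := by
  have inj : Function.Injective (G z : E →ₗ[ℝ] (E →L[ℝ] ℝ)) := fun a b hab =>
    h.eq_of_forall hz fun w => by
      have : G z a = G z b := hab
      rw [this]
  have hfin : Module.finrank ℝ E = Module.finrank ℝ (E →L[ℝ] ℝ) := by
    rw [← (LinearMap.toContinuousLinearMap : (E →ₗ[ℝ] ℝ) ≃ₗ[ℝ] _).finrank_eq]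
    exact (Subspace.dual_finrank_eq (K := ℝ) (V := E)).symm
  have hs := (LinearMap.injective_iff_surjective_of_finrank_eq_finrank hfin).1 inj
  exact ⟨(LinearEquiv.ofBijective _ ⟨inj, hs⟩).toContinuousLinearEquiv, by ext; rfl⟩

lemma apply_inverse (h : IsMetricOn G s) {z : E} (hz : z ∈ s) (l : E →L[ℝ] ℝ) :
    G z ((G z).inverse l) = l := by
  obtain ⟨e, he⟩ := h.exists_equiv hz
  rw [← he, ContinuousLinearMap.inverse_equiv]
  simp

lemma apply_christoffel (h : IsMetricOn G s) {z : E} (hz : z ∈ s) (u v w : E) :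
    G z (coordChristoffel G z u v) w =
      (1 / 2 : ℝ) * (fderiv ℝ G z u v w + fderiv ℝ G z v u w - fderiv ℝ G z w u v) := by
  simp only [coordChristoffel, ContinuousLinearMap.comp_apply, ContinuousLinearMap.compL_apply,
    h.apply_inverse hz, koszul_apply]

lemma christoffel_symm (h : IsMetricOn G s) {z : E} (hz : z ∈ s) (u v : E) :
    coordChristoffel G z u v = coordChristoffel G z v u := by
  refine h.eq_of_forall hz fun w => ?_
  rw [h.apply_christoffel hz, h.apply_christoffel hz, h.fderiv_symm hz w u v]
  ring

lemma fderiv_eq (h : IsMetricOn G s) {z : E} (hz : z ∈ s) (u v w : E) :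
    fderiv ℝ G z u v w =
      G z (coordChristoffel G z u v) w + G z v (coordChristoffel G z u w) := by
  rw [h.symm z hz v, h.apply_christoffel hz, h.apply_christoffel hz, h.fderiv_symm hz u w v,
    h.fderiv_symm hz v u w, h.fderiv_symm hz w u v]
  ring

lemma contDiffAt_christoffel (h : IsMetricOn G s) {z : E} (hz : z ∈ s) :
    ContDiffAt ℝ ∞ (coordChristoffel G) z := by
  obtain ⟨e, he⟩ := h.exists_equiv hz
  have h1 : ContDiffAt ℝ ∞ (fun y => (G y).inverse) z := by
    refine ContDiffAt.comp z (g := ContinuousLinearMap.inverse) ?_ (h.contDiffAt hz)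
    rw [← he]
    exact contDiffAt_map_inverse e
  have h2 : ContDiffAt ℝ ∞ (fderiv ℝ G) z := (h.contDiffAt hz).fderiv_right (by simp)
  exact ContDiffAt.clm_comp
    ((ContinuousLinearMap.compL ℝ E (E →L[ℝ] ℝ) E).contDiff.contDiffAt.comp z h1)
    (contDiff_koszul.contDiffAt.comp z h2)

lemma hasFDerivAt_christoffel (h : IsMetricOn G s) {z : E} (hz : z ∈ s) :
    HasFDerivAt (coordChristoffel G) (fderiv ℝ (coordChristoffel G) z) z :=
  ((h.contDiffAt_christoffel hz).differentiableAt (by simp)).hasFDerivAt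

lemma eq_christoffel_of_forall (h : IsMetricOn G s) {z : E} (hz : z ∈ s) {u v c : E}
    (hc : ∀ w, G z c w =
      (1 / 2 : ℝ) * (fderiv ℝ G z u v w + fderiv ℝ G z v u w - fderiv ℝ G z w u v)) :
    coordChristoffel G z u v = c :=
  h.eq_of_forall hz fun w => by rw [h.apply_christoffel hz, hc]

/-- The second derivative of `G(w, w)` is symmetric. Computed twice by metric compatibility, its
antisymmetric part in `u`, `v` is `2 G(R(u, v) w, w)`. This skewness is the only curvature symmetry
needed besides the evident one in `u`, `v`. -/
lemma apply_curvature_self (h : IsMetricOn G s) {z : E} (hz : z ∈ s) (u v w : E) :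
    G z (coordCurvature G z u v w) w = 0 := by
  set Γ := coordChristoffel G with hΓ
  have key : ∀ u v : E, fderiv ℝ (fderiv ℝ G) z u v w w =
      2 * (G z (Γ z u (Γ z v w)) w + G z (Γ z v w) (Γ z u w)
        + G z (fderiv ℝ Γ z u v w) w) := by
    intro u v
    have h2 : DifferentiableAt ℝ (fderiv ℝ G) z :=
      ((h.contDiffAt hz).fderiv_right (m := ∞) (by simp)).differentiableAt (by simp)
    have e1 := ((h2.hasFDerivAt.clm_apply (hasFDerivAt_const v z)).clm_apply
      (hasFDerivAt_const w z)).clm_apply (hasFDerivAt_const w z)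
    have e2 : HasFDerivAt (fun y => 2 * G y (Γ y v w) w) _ z :=
      ((((h.differentiableAt hz).hasFDerivAt.clm_apply
      (((h.hasFDerivAt_christoffel hz).clm_apply (hasFDerivAt_const v z)).clm_apply
      (hasFDerivAt_const w z))).clm_apply (hasFDerivAt_const w z)).const_mul 2)
    have e3 : (fun y => fderiv ℝ G y v w w) =ᶠ[𝓝 z] (fun y => 2 * G y (Γ y v w) w) := by
      filter_upwards [h.isOpen.mem_nhds hz] with y hy
      rw [h.fderiv_eq hy, h.symm y hy w, two_mul]
    have e4 := e1.unique (e2.congr_of_eventuallyEq e3)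
    have e5 := congrArg (fun L : E →L[ℝ] ℝ => L u) e4
    simp only [add_apply, ContinuousLinearMap.comp_apply,
      ContinuousLinearMap.flip_apply, zero_apply,
      smul_apply, smul_eq_mul, map_zero, zero_add] at e5
    have e6 := h.fderiv_eq hz u (Γ z v w) w
    rw [← hΓ] at e6 e5
    simp only [e6] at e5
    linarith
  have hsymm : IsSymmSndFDerivAt ℝ G z :=
    (h.contDiffAt hz).isSymmSndFDerivAt (by simp; exact ENat.LEInfty.out)
  have k1 := key u v
  have k2 := key v u
  rw [hsymm.eq v u] at k2
  rw [k2] at k1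
  have k3 := h.symm z hz (Γ z v w) (Γ z u w)
  simp only [coordCurvature, map_add, map_sub, add_apply,
    sub_apply]
  rw [← hΓ]
  linarith

end FiniteDimensional

end IsMetricOn

end CoordinateGeometry

/-! ### Naturality of Christoffel symbols and curvature under local isometries. -/

section Naturality

variable {E : Type*} [NormedAddCommGroup E] [NormedSpace ℝ E]
  {E' : Type*} [NormedAddCommGroup E'] [NormedSpace ℝ E']

/-- `G'` is the pullback of the metric tensor `G` by the local diffeomorphism `ψ`. -/
structure IsCoordIsometry (G' : E' → E' →L[ℝ] E' →L[ℝ] ℝ) (s' : Set E')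
    (G : E → E →L[ℝ] E →L[ℝ] ℝ) (s : Set E) (ψ : E' → E) : Prop where
  smooth : ContDiffOn ℝ ∞ ψ s'
  mapsTo : Set.MapsTo ψ s' s
  surjective : ∀ z ∈ s', Function.Surjective (fderiv ℝ ψ z)
  metric : ∀ z ∈ s', ∀ u v, G' z u v = G (ψ z) (fderiv ℝ ψ z u) (fderiv ℝ ψ z v)

namespace IsCoordIsometry

variable {G' : E' → E' →L[ℝ] E' →L[ℝ] ℝ} {s' : Set E'} {G : E → E →L[ℝ] E →L[ℝ] ℝ}
  {s : Set E} {ψ : E' → E}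

lemma hasFDerivAt (h : IsCoordIsometry G' s' G s ψ) (hs' : IsOpen s') {z : E'} (hz : z ∈ s') :
    HasFDerivAt ψ (fderiv ℝ ψ z) z :=
  ((h.smooth.contDiffAt (hs'.mem_nhds hz)).differentiableAt (by simp)).hasFDerivAt

lemma contDiffAt_fderiv (h : IsCoordIsometry G' s' G s ψ) (hs' : IsOpen s') {z : E'}
    (hz : z ∈ s') : ContDiffAt ℝ ∞ (fderiv ℝ ψ) z :=
  (h.smooth.contDiffAt (hs'.mem_nhds hz)).fderiv_right (by simp)

lemma hasFDerivAt_fderiv (h : IsCoordIsometry G' s' G s ψ) (hs' : IsOpen s') {z : E'}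
    (hz : z ∈ s') : HasFDerivAt (fderiv ℝ ψ) (fderiv ℝ (fderiv ℝ ψ) z) z :=
  ((h.contDiffAt_fderiv hs' hz).differentiableAt (by simp)).hasFDerivAt

lemma fderiv_fderiv_symm (h : IsCoordIsometry G' s' G s ψ) (hs' : IsOpen s') {z : E'}
    (hz : z ∈ s') (u v : E') :
    fderiv ℝ (fderiv ℝ ψ) z u v = fderiv ℝ (fderiv ℝ ψ) z v u :=
  ((h.smooth.contDiffAt (hs'.mem_nhds hz)).isSymmSndFDerivAt
    (by simp; exact ENat.LEInfty.out)).eq u v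

variable [FiniteDimensional ℝ E] [FiniteDimensional ℝ E']

lemma fderiv_metric (h : IsCoordIsometry G' s' G s ψ) (hG : IsMetricOn G s)
    (hG' : IsMetricOn G' s') {z : E'} (hz : z ∈ s') (u v w : E') :
    fderiv ℝ G' z u v w =
      fderiv ℝ G (ψ z) (fderiv ℝ ψ z u) (fderiv ℝ ψ z v) (fderiv ℝ ψ z w)
      + G (ψ z) (fderiv ℝ (fderiv ℝ ψ) z u v) (fderiv ℝ ψ z w)
      + G (ψ z) (fderiv ℝ ψ z v) (fderiv ℝ (fderiv ℝ ψ) z u w) := by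
  rw [← fderiv_clm_apply_const₂ (hG'.differentiableAt hz)]
  have e1 := h.hasFDerivAt hG'.isOpen hz
  have e2 := h.hasFDerivAt_fderiv hG'.isOpen hz
  have e3 := ((((hG.differentiableAt (h.mapsTo hz)).hasFDerivAt.comp z e1).clm_apply
    (e2.clm_apply (hasFDerivAt_const v z))).clm_apply (e2.clm_apply (hasFDerivAt_const w z)))
  have e4 := e3.congr_of_eventuallyEq (f₁ := fun y => G' y v w) (by
    filter_upwards [hG'.isOpen.mem_nhds hz] with y hy using h.metric y hy v w)
  rw [e4.fderiv]
  simp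
  ring

/-- The transformation law of the Christoffel symbols. -/
lemma fderiv_christoffel (h : IsCoordIsometry G' s' G s ψ) (hG : IsMetricOn G s)
    (hG' : IsMetricOn G' s') {z : E'} (hz : z ∈ s') (u v : E') :
    fderiv ℝ ψ z (coordChristoffel G' z u v) = fderiv ℝ (fderiv ℝ ψ) z u v
      + coordChristoffel G (ψ z) (fderiv ℝ ψ z u) (fderiv ℝ ψ z v) := by
  -- Since the differential is surjective, it suffices to test against vectors in its image, where
  -- both Koszul formulas apply; the symmetry of the second derivative of `ψ` collapses the extra
  -- terms.
  refine hG.eq_of_forall (h.mapsTo hz) fun w' => ?_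
  obtain ⟨w, rfl⟩ := h.surjective z hz w'
  rw [← h.metric z hz, hG'.apply_christoffel hz, map_add, add_apply,
    hG.apply_christoffel (h.mapsTo hz), h.fderiv_metric hG hG' hz, h.fderiv_metric hG hG' hz,
    h.fderiv_metric hG hG' hz]
  have s1 := h.fderiv_fderiv_symm hG'.isOpen hz
  have s2 := hG.symm (ψ z) (h.mapsTo hz)
  rw [s1 w u, s1 w v, s1 v u, s2 (fderiv ℝ ψ z v) (fderiv ℝ (fderiv ℝ ψ) z u w)]
  ring

/-- The curvature tensor is natural under local isometries. -/
lemma fderiv_curvature (h : IsCoordIsometry G' s' G s ψ) (hG : IsMetricOn G s)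
    (hG' : IsMetricOn G' s') {z : E'} (hz : z ∈ s') (u v w : E') :
    fderiv ℝ ψ z (coordCurvature G' z u v w) =
      coordCurvature G (ψ z) (fderiv ℝ ψ z u) (fderiv ℝ ψ z v) (fderiv ℝ ψ z w) := by
  set Γ := coordChristoffel G with hΓ
  set Γ' := coordChristoffel G' with hΓ'
  set D := fderiv ℝ ψ with hD
  have e1 := h.hasFDerivAt hG'.isOpen hz
  have e2 := h.hasFDerivAt_fderiv hG'.isOpen hz
  have e3 : HasFDerivAt (fderiv ℝ D) (fderiv ℝ (fderiv ℝ D) z) z :=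
    (((h.contDiffAt_fderiv hG'.isOpen hz).fderiv_right (m := ∞)
      (by simp)).differentiableAt (by simp)).hasFDerivAt
  have trans : ∀ y ∈ s', ∀ u v, D y (Γ' y u v) = fderiv ℝ D y u v + Γ (ψ y) (D y u) (D y v) :=
    fun y hy u v => h.fderiv_christoffel hG hG' hy u v
  -- Differentiated transformation law. The third derivative of `ψ` and the last two lines are
  -- symmetric in `u`, `v`, so they cancel on antisymmetrization and only the curvature survives.
  have key : ∀ u v : E', D z (fderiv ℝ Γ' z u v w + Γ' z u (Γ' z v w)) =
      fderiv ℝ (fderiv ℝ D) z u v w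
      + fderiv ℝ Γ (ψ z) (D z u) (D z v) (D z w) + Γ (ψ z) (D z u) (Γ (ψ z) (D z v) (D z w))
      + Γ (ψ z) (fderiv ℝ D z u v) (D z w)
      + (Γ (ψ z) (D z v) (fderiv ℝ D z u w) + Γ (ψ z) (D z u) (fderiv ℝ D z v w)) := by
    intro u v
    have l := e2.clm_apply (((hG'.hasFDerivAt_christoffel hz).clm_apply
      (hasFDerivAt_const v z)).clm_apply (hasFDerivAt_const w z))
    have r := ((e3.clm_apply (hasFDerivAt_const v z)).clm_apply (hasFDerivAt_const w z)).add
      ((((hG.hasFDerivAt_christoffel (h.mapsTo hz)).comp z e1).clm_apply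
        (e2.clm_apply (hasFDerivAt_const v z))).clm_apply
        (e2.clm_apply (hasFDerivAt_const w z)))
    have e4 := l.unique (r.congr_of_eventuallyEq (by
      filter_upwards [hG'.isOpen.mem_nhds hz] with y hy using trans y hy v w))
    have e5 := congrArg (fun L : E' →L[ℝ] E => L u) e4
    simp only [add_apply, ContinuousLinearMap.comp_apply, Function.comp_apply,
      ContinuousLinearMap.flip_apply, zero_apply, map_zero, zero_add] at e5
    rw [← hΓ, ← hΓ', ← hD] at e5
    have e6 := trans z hz u (Γ' z v w)
    rw [trans z hz v w, map_add] at e6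
    rw [map_add, e6, eq_sub_of_add_eq e5]
    abel
  have hsymm : IsSymmSndFDerivAt ℝ D z :=
    (h.contDiffAt_fderiv hG'.isOpen hz).isSymmSndFDerivAt (by simp; exact ENat.LEInfty.out)
  have k1 := key u v
  have k2 := key v u
  rw [hsymm.eq v u, h.fderiv_fderiv_symm hG'.isOpen hz v u] at k2
  have : D z (coordCurvature G' z u v w) =
      D z (fderiv ℝ Γ' z u v w + Γ' z u (Γ' z v w))
        - D z (fderiv ℝ Γ' z v u w + Γ' z v (Γ' z u w)) := by
    rw [← map_sub, coordCurvature]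
    congr 1
    rw [← hΓ']
    abel
  rw [this, k1, k2, coordCurvature, ← hΓ, ← hD]
  abel

end IsCoordIsometry

end Naturality

/-! ### Metrics of the form `dt² + γ(t)` and their slices. -/

section UnitLapse

variable {E : Type*} [NormedAddCommGroup E] [NormedSpace ℝ E]

/-- `G` is a metric tensor of the form `dt² + γ(t)` on the open set `s`. -/
structure IsUnitLapse (G : ℝ × E → (ℝ × E) →L[ℝ] (ℝ × E) →L[ℝ] ℝ) (s : Set (ℝ × E)) : Prop
    extends IsMetricOn G s where
  lapse : ∀ z ∈ s, ∀ v : ℝ × E, G z (1, 0) v = v.1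

/-- The second fundamental form of the slices. -/
def sliceForm (G : ℝ × E → (ℝ × E) →L[ℝ] (ℝ × E) →L[ℝ] ℝ) (z u v : ℝ × E) : ℝ :=
  -(coordChristoffel G z u v).1

namespace IsUnitLapse

variable {G : ℝ × E → (ℝ × E) →L[ℝ] (ℝ × E) →L[ℝ] ℝ} {s : Set (ℝ × E)}

lemma lapse' (h : IsUnitLapse G s) {z : ℝ × E} (hz : z ∈ s) (v : ℝ × E) :
    G z v (1, 0) = v.1 := by rw [h.symm z hz, h.lapse z hz]

/-- Positivity of `G` on the component of `v` orthogonal to `∂_t`. It keeps `ρ dt² + γ₁ + γ₂`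
positive for every `ρ > 0` and gives the comparison between different values of `ρ`. -/
lemma sq_fst_le (h : IsUnitLapse G s) {z : ℝ × E} (hz : z ∈ s) (v : ℝ × E) :
    v.1 ^ 2 ≤ G z v v := by
  have h1 : 0 ≤ G z (v - v.1 • (1, 0)) (v - v.1 • (1, 0)) := by
    by_cases h0 : v - v.1 • ((1, 0) : ℝ × E) = 0
    · rw [h0]; simp
    · exact (h.pos z hz _ h0).le
  simp only [map_sub, sub_apply, map_smul, smul_apply, smul_eq_mul, h.lapse z hz,
    h.lapse' hz] at h1
  nlinarith

variable [FiniteDimensional ℝ E]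

/-- The pairing `G(∂_t, x)` has constant coefficients, so metric compatibility moves the connection
from `∂_t` to `x`: the shape operator of the slices is dual to their second fundamental form. -/
lemma apply_christoffel_vertical (h : IsUnitLapse G s) {z : ℝ × E} (hz : z ∈ s)
    (u x : ℝ × E) : G z (coordChristoffel G z u (1, 0)) x = sliceForm G z u x := by
  have h0 : fderiv ℝ G z u (1, 0) x = 0 := by
    rw [← fderiv_clm_apply_const₂ (h.differentiableAt hz)]
    have : (fun y => G y (1, 0) x) =ᶠ[𝓝 z] fun _ => x.1 := by
      filter_upwards [h.isOpen.mem_nhds hz] with y hy using h.lapse y hy x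
    rw [this.fderiv_eq]
    simp
  rw [h.fderiv_eq hz, h.lapse z hz] at h0
  rw [sliceForm]
  linarith

end IsUnitLapse

lemma sliceForm_symm [FiniteDimensional ℝ E]
    {G : ℝ × E → (ℝ × E) →L[ℝ] (ℝ × E) →L[ℝ] ℝ} {s : Set (ℝ × E)} (h : IsUnitLapse G s)
    {z : ℝ × E} (hz : z ∈ s) (u v : ℝ × E) : sliceForm G z u v = sliceForm G z v u := by
  rw [sliceForm, sliceForm, h.christoffel_symm hz]

end UnitLapse

/-! ### Curvature of `ρ dt² + γ₁(t) + γ₂(t)`. -/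

section FibreProduct

variable {E₁ : Type*} [NormedAddCommGroup E₁] [NormedSpace ℝ E₁]
  {E₂ : Type*} [NormedAddCommGroup E₂] [NormedSpace ℝ E₂]

variable (E₁ E₂) in
/-- The projection `(t, y, y') ↦ (t, y)`. -/
def fibreFst : (ℝ × E₁ × E₂) →L[ℝ] ℝ × E₁ :=
  (ContinuousLinearMap.fst ℝ ℝ (E₁ × E₂)).prod
    (ContinuousLinearMap.fst ℝ E₁ E₂ ∘L ContinuousLinearMap.snd ℝ ℝ (E₁ × E₂))

variable (E₁ E₂) in
/-- The projection `(t, y, y') ↦ (t, y')`. -/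
def fibreSnd : (ℝ × E₁ × E₂) →L[ℝ] ℝ × E₂ :=
  (ContinuousLinearMap.fst ℝ ℝ (E₁ × E₂)).prod
    (ContinuousLinearMap.snd ℝ E₁ E₂ ∘L ContinuousLinearMap.snd ℝ ℝ (E₁ × E₂))

@[simp] lemma fibreFst_apply (u : ℝ × E₁ × E₂) : fibreFst E₁ E₂ u = (u.1, u.2.1) := rfl

@[simp] lemma fibreSnd_apply (u : ℝ × E₁ × E₂) : fibreSnd E₁ E₂ u = (u.1, u.2.2) := rfl

/-- The metric `ρ dt² + γ₁(t) + γ₂(t)` built from `dt² + γ₁(t)` and `dt² + γ₂(t)`. -/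
def fibreMetric (ρ : ℝ) (G₁ : ℝ × E₁ → (ℝ × E₁) →L[ℝ] (ℝ × E₁) →L[ℝ] ℝ)
    (G₂ : ℝ × E₂ → (ℝ × E₂) →L[ℝ] (ℝ × E₂) →L[ℝ] ℝ) (z : ℝ × E₁ × E₂) :
    (ℝ × E₁ × E₂) →L[ℝ] (ℝ × E₁ × E₂) →L[ℝ] ℝ :=
  (G₁ (fibreFst E₁ E₂ z)).bilinearComp (fibreFst E₁ E₂) (fibreFst E₁ E₂)
    + (G₂ (fibreSnd E₁ E₂ z)).bilinearComp (fibreSnd E₁ E₂) (fibreSnd E₁ E₂)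
    + (ρ - 2) • (ContinuousLinearMap.fst ℝ ℝ (E₁ × E₂)).smulRight
        (ContinuousLinearMap.fst ℝ ℝ (E₁ × E₂))

variable (E₁ E₂) in
/-- The map dual to the pair of projections. -/
def fibreGlue (ρ : ℝ) : ((ℝ × E₁) × (ℝ × E₂)) →L[ℝ] ℝ × E₁ × E₂ :=
  (ρ⁻¹ • (ContinuousLinearMap.fst ℝ ℝ E₁ ∘L ContinuousLinearMap.fst ℝ (ℝ × E₁) (ℝ × E₂)
    + ContinuousLinearMap.fst ℝ ℝ E₂ ∘L ContinuousLinearMap.snd ℝ (ℝ × E₁) (ℝ × E₂))).prod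
  ((ContinuousLinearMap.snd ℝ ℝ E₁ ∘L ContinuousLinearMap.fst ℝ (ℝ × E₁) (ℝ × E₂)).prod
    (ContinuousLinearMap.snd ℝ ℝ E₂ ∘L ContinuousLinearMap.snd ℝ (ℝ × E₁) (ℝ × E₂)))

@[simp] lemma fibreGlue_apply (ρ : ℝ) (x : (ℝ × E₁) × (ℝ × E₂)) :
    fibreGlue E₁ E₂ ρ x = (ρ⁻¹ * (x.1.1 + x.2.1), x.1.2, x.2.2) := rfl

variable {ρ : ℝ} {G₁ : ℝ × E₁ → (ℝ × E₁) →L[ℝ] (ℝ × E₁) →L[ℝ] ℝ}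
  {G₂ : ℝ × E₂ → (ℝ × E₂) →L[ℝ] (ℝ × E₂) →L[ℝ] ℝ} {s₁ : Set (ℝ × E₁)} {s₂ : Set (ℝ × E₂)}

lemma fibreMetric_apply (z u v : ℝ × E₁ × E₂) : fibreMetric ρ G₁ G₂ z u v =
    G₁ (fibreFst E₁ E₂ z) (fibreFst E₁ E₂ u) (fibreFst E₁ E₂ v)
    + G₂ (fibreSnd E₁ E₂ z) (fibreSnd E₁ E₂ u) (fibreSnd E₁ E₂ v)
    + (ρ - 2) * (u.1 * v.1) := by
  simp [fibreMetric]

lemma isMetricOn_fibreMetric (hρ : 0 < ρ) (h₁ : IsUnitLapse G₁ s₁) (h₂ : IsUnitLapse G₂ s₂) :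
    IsMetricOn (fibreMetric ρ G₁ G₂) (fibreFst E₁ E₂ ⁻¹' s₁ ∩ fibreSnd E₁ E₂ ⁻¹' s₂) where
  isOpen := (h₁.isOpen.preimage (fibreFst E₁ E₂).continuous).inter
    (h₂.isOpen.preimage (fibreSnd E₁ E₂).continuous)
  smooth := by
    have e₁ : ContDiffOn ℝ ∞ (fun z => G₁ (fibreFst E₁ E₂ z))
        (fibreFst E₁ E₂ ⁻¹' s₁ ∩ fibreSnd E₁ E₂ ⁻¹' s₂) :=
      h₁.smooth.comp (fibreFst E₁ E₂).contDiff.contDiffOn fun z hz => hz.1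
    have e₂ : ContDiffOn ℝ ∞ (fun z => G₂ (fibreSnd E₁ E₂ z))
        (fibreFst E₁ E₂ ⁻¹' s₁ ∩ fibreSnd E₁ E₂ ⁻¹' s₂) :=
      h₂.smooth.comp (fibreSnd E₁ E₂).contDiff.contDiffOn fun z hz => hz.2
    exact ((contDiffOn_bilinearComp e₁ contDiffOn_const).add
      (contDiffOn_bilinearComp e₂ contDiffOn_const)).add contDiffOn_const
  symm z hz u v := by
    rw [fibreMetric_apply, fibreMetric_apply, h₁.symm _ hz.1, h₂.symm _ hz.2, mul_comm u.1]
  pos z hz u hu := by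
    rw [fibreMetric_apply]
    have i₁ := h₁.sq_fst_le hz.1 (fibreFst E₁ E₂ u)
    have i₂ := h₂.sq_fst_le hz.2 (fibreSnd E₁ E₂ u)
    by_cases h0 : u.1 = 0
    · by_cases h1 : u.2.1 = 0
      · have h2 : fibreSnd E₁ E₂ u ≠ 0 := by
          intro h; apply hu
          simp only [fibreSnd_apply, Prod.mk_eq_zero] at h
          exact Prod.ext h0 (Prod.ext h1 h.2)
        have := h₂.pos _ hz.2 _ h2
        simp only [fibreFst_apply, fibreSnd_apply, h0] at *
        nlinarith
      · have h2 : fibreFst E₁ E₂ u ≠ 0 := by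
          intro h; apply h1
          simp only [fibreFst_apply, Prod.mk_eq_zero] at h
          exact h.2
        have := h₁.pos _ hz.1 _ h2
        simp only [fibreFst_apply, fibreSnd_apply, h0] at *
        nlinarith
    · have : 0 < u.1 ^ 2 := by positivity
      simp only [fibreFst_apply, fibreSnd_apply] at *
      nlinarith

lemma fibreFst_fibreGlue (x : (ℝ × E₁) × (ℝ × E₂)) :
    fibreFst E₁ E₂ (fibreGlue E₁ E₂ ρ x) =
      x.1 + (ρ⁻¹ * (x.1.1 + x.2.1) - x.1.1) • ((1, 0) : ℝ × E₁) := by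
  ext <;> simp

lemma fibreSnd_fibreGlue (x : (ℝ × E₁) × (ℝ × E₂)) :
    fibreSnd E₁ E₂ (fibreGlue E₁ E₂ ρ x) =
      x.2 + (ρ⁻¹ * (x.1.1 + x.2.1) - x.2.1) • ((1, 0) : ℝ × E₂) := by
  ext <;> simp

/-- `fibreGlue` is the adjoint of the pair of projections for these metrics. The corrections by
multiples of `∂_t` pair only with `dt`, and the factor `ρ⁻¹` is the one for which they cancel
against `(ρ - 2) dt²`. -/
lemma fibreMetric_glue (hρ : 0 < ρ) (h₁ : IsUnitLapse G₁ s₁) (h₂ : IsUnitLapse G₂ s₂)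
    {z : ℝ × E₁ × E₂} (hz : z ∈ fibreFst E₁ E₂ ⁻¹' s₁ ∩ fibreSnd E₁ E₂ ⁻¹' s₂)
    (x : (ℝ × E₁) × (ℝ × E₂)) (u : ℝ × E₁ × E₂) :
    fibreMetric ρ G₁ G₂ z (fibreGlue E₁ E₂ ρ x) u =
      G₁ (fibreFst E₁ E₂ z) x.1 (fibreFst E₁ E₂ u)
      + G₂ (fibreSnd E₁ E₂ z) x.2 (fibreSnd E₁ E₂ u) := by
  rw [fibreMetric_apply, fibreFst_fibreGlue, fibreSnd_fibreGlue]
  simp only [map_add, add_apply, map_smul, smul_apply, smul_eq_mul, h₁.lapse _ hz.1,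
    h₂.lapse _ hz.2]
  simp only [fibreFst_apply, fibreSnd_apply, fibreGlue_apply]
  field_simp
  ring

lemma fderiv_fibreMetric (h₁ : IsUnitLapse G₁ s₁) (h₂ : IsUnitLapse G₂ s₂)
    {z : ℝ × E₁ × E₂} (hz : z ∈ fibreFst E₁ E₂ ⁻¹' s₁ ∩ fibreSnd E₁ E₂ ⁻¹' s₂) (hρ : 0 < ρ)
    (u v w : ℝ × E₁ × E₂) :
    fderiv ℝ (fibreMetric ρ G₁ G₂) z u v w =
      fderiv ℝ G₁ (fibreFst E₁ E₂ z) (fibreFst E₁ E₂ u) (fibreFst E₁ E₂ v) (fibreFst E₁ E₂ w)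
      + fderiv ℝ G₂ (fibreSnd E₁ E₂ z) (fibreSnd E₁ E₂ u) (fibreSnd E₁ E₂ v)
        (fibreSnd E₁ E₂ w) := by
  rw [← fderiv_clm_apply_const₂ ((isMetricOn_fibreMetric hρ h₁ h₂).differentiableAt hz)]
  have e₁ := (((h₁.differentiableAt hz.1).hasFDerivAt.comp z
    (fibreFst E₁ E₂).hasFDerivAt).clm_apply (hasFDerivAt_const (fibreFst E₁ E₂ v) z)).clm_apply
    (hasFDerivAt_const (fibreFst E₁ E₂ w) z)
  have e₂ := (((h₂.differentiableAt hz.2).hasFDerivAt.comp z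
    (fibreSnd E₁ E₂).hasFDerivAt).clm_apply (hasFDerivAt_const (fibreSnd E₁ E₂ v) z)).clm_apply
    (hasFDerivAt_const (fibreSnd E₁ E₂ w) z)
  have e₃ := (e₁.add e₂).add (hasFDerivAt_const ((ρ - 2) * (v.1 * w.1)) z)
  have e₄ := e₃.congr_of_eventuallyEq (f₁ := fun y => fibreMetric ρ G₁ G₂ y v w)
    (Filter.Eventually.of_forall fun y => fibreMetric_apply y v w)
  rw [e₄.fderiv]
  simp

variable [FiniteDimensional ℝ E₁] [FiniteDimensional ℝ E₂]

/-- The term `(ρ - 2) dt²` is constant, so the Koszul expression is the sum of those of the two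
factors, and the adjoint identity `fibreMetric_glue` represents it. -/
lemma christoffel_fibreMetric (hρ : 0 < ρ) (h₁ : IsUnitLapse G₁ s₁) (h₂ : IsUnitLapse G₂ s₂)
    {z : ℝ × E₁ × E₂} (hz : z ∈ fibreFst E₁ E₂ ⁻¹' s₁ ∩ fibreSnd E₁ E₂ ⁻¹' s₂)
    (u v : ℝ × E₁ × E₂) :
    coordChristoffel (fibreMetric ρ G₁ G₂) z u v = fibreGlue E₁ E₂ ρ
      (coordChristoffel G₁ (fibreFst E₁ E₂ z) (fibreFst E₁ E₂ u) (fibreFst E₁ E₂ v),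
      coordChristoffel G₂ (fibreSnd E₁ E₂ z) (fibreSnd E₁ E₂ u) (fibreSnd E₁ E₂ v)) := by
  refine (isMetricOn_fibreMetric hρ h₁ h₂).eq_christoffel_of_forall hz fun w => ?_
  rw [fibreMetric_glue hρ h₁ h₂ hz, h₁.apply_christoffel hz.1, h₂.apply_christoffel hz.2,
    fderiv_fibreMetric h₁ h₂ hz hρ, fderiv_fibreMetric h₁ h₂ hz hρ,
    fderiv_fibreMetric h₁ h₂ hz hρ]
  ring

lemma fderiv_christoffel_fibreMetric (hρ : 0 < ρ) (h₁ : IsUnitLapse G₁ s₁)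
    (h₂ : IsUnitLapse G₂ s₂) {z : ℝ × E₁ × E₂}
    (hz : z ∈ fibreFst E₁ E₂ ⁻¹' s₁ ∩ fibreSnd E₁ E₂ ⁻¹' s₂) (u v w : ℝ × E₁ × E₂) :
    fderiv ℝ (coordChristoffel (fibreMetric ρ G₁ G₂)) z u v w = fibreGlue E₁ E₂ ρ
      (fderiv ℝ (coordChristoffel G₁) (fibreFst E₁ E₂ z) (fibreFst E₁ E₂ u)
        (fibreFst E₁ E₂ v) (fibreFst E₁ E₂ w),
      fderiv ℝ (coordChristoffel G₂) (fibreSnd E₁ E₂ z) (fibreSnd E₁ E₂ u)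
        (fibreSnd E₁ E₂ v) (fibreSnd E₁ E₂ w)) := by
  have hG := isMetricOn_fibreMetric hρ h₁ h₂
  rw [← fderiv_clm_apply_const₂ (hG.hasFDerivAt_christoffel hz).differentiableAt]
  have e₁ := (((h₁.hasFDerivAt_christoffel hz.1).comp z
    (fibreFst E₁ E₂).hasFDerivAt).clm_apply (hasFDerivAt_const (fibreFst E₁ E₂ v) z)).clm_apply
    (hasFDerivAt_const (fibreFst E₁ E₂ w) z)
  have e₂ := (((h₂.hasFDerivAt_christoffel hz.2).comp z
    (fibreSnd E₁ E₂).hasFDerivAt).clm_apply (hasFDerivAt_const (fibreSnd E₁ E₂ v) z)).clm_apply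
    (hasFDerivAt_const (fibreSnd E₁ E₂ w) z)
  have e₃ := (fibreGlue E₁ E₂ ρ).hasFDerivAt.comp z (e₁.prodMk e₂)
  have e₄ := e₃.congr_of_eventuallyEq
    (f₁ := fun y => coordChristoffel (fibreMetric ρ G₁ G₂) y v w)
    (by filter_upwards [hG.isOpen.mem_nhds hz] with y hy using
      christoffel_fibreMetric hρ h₁ h₂ hy v w)
  rw [e₄.fderiv]
  simp

/-- The curvature of `ρ dt² + γ₁(t) + γ₂(t)`. -/
lemma curvature_fibreMetric (hρ : 0 < ρ) (h₁ : IsUnitLapse G₁ s₁) (h₂ : IsUnitLapse G₂ s₂)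
    {z : ℝ × E₁ × E₂} (hz : z ∈ fibreFst E₁ E₂ ⁻¹' s₁ ∩ fibreSnd E₁ E₂ ⁻¹' s₂)
    (u v : ℝ × E₁ × E₂) {z₁ u₁ v₁ : ℝ × E₁} {z₂ u₂ v₂ : ℝ × E₂}
    (hz₁ : fibreFst E₁ E₂ z = z₁) (hu₁ : fibreFst E₁ E₂ u = u₁) (hv₁ : fibreFst E₁ E₂ v = v₁)
    (hz₂ : fibreSnd E₁ E₂ z = z₂) (hu₂ : fibreSnd E₁ E₂ u = u₂) (hv₂ : fibreSnd E₁ E₂ v = v₂) :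
    fibreMetric ρ G₁ G₂ z (coordCurvature (fibreMetric ρ G₁ G₂) z u v v) u =
      G₁ z₁ (coordCurvature G₁ z₁ u₁ v₁ v₁) u₁ + G₂ z₂ (coordCurvature G₂ z₂ u₂ v₂ v₂) u₂
      + (sliceForm G₁ z₁ u₁ u₁ * sliceForm G₁ z₁ v₁ v₁ - sliceForm G₁ z₁ u₁ v₁ ^ 2)
      + (sliceForm G₂ z₂ u₂ u₂ * sliceForm G₂ z₂ v₂ v₂ - sliceForm G₂ z₂ u₂ v₂ ^ 2)
      - ρ⁻¹ * ((sliceForm G₁ z₁ u₁ u₁ + sliceForm G₂ z₂ u₂ u₂)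
          * (sliceForm G₁ z₁ v₁ v₁ + sliceForm G₂ z₂ v₂ v₂)
        - (sliceForm G₁ z₁ u₁ v₁ + sliceForm G₂ z₂ u₂ v₂) ^ 2) := by
  set c₁ := coordChristoffel G₁ z₁ with hc₁
  set c₂ := coordChristoffel G₂ z₂ with hc₂
  have hz1 : z₁ ∈ s₁ := hz₁ ▸ hz.1
  have hz2 : z₂ ∈ s₂ := hz₂ ▸ hz.2
  -- Projecting a glued vector back to a factor changes it by a multiple of `∂_t`. In the quadratic
  -- terms of the curvature these multiples produce `Γ(u, ∂_t)` and `Γ(v, ∂_t)`, which pair to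
  -- second fundamental forms below.
  have key : coordCurvature (fibreMetric ρ G₁ G₂) z u v v = fibreGlue E₁ E₂ ρ
      (coordCurvature G₁ z₁ u₁ v₁ v₁
        + (ρ⁻¹ * ((c₁ v₁ v₁).1 + (c₂ v₂ v₂).1) - (c₁ v₁ v₁).1) • c₁ u₁ (1, 0)
        - (ρ⁻¹ * ((c₁ u₁ v₁).1 + (c₂ u₂ v₂).1) - (c₁ u₁ v₁).1) • c₁ v₁ (1, 0),
      coordCurvature G₂ z₂ u₂ v₂ v₂
        + (ρ⁻¹ * ((c₁ v₁ v₁).1 + (c₂ v₂ v₂).1) - (c₂ v₂ v₂).1) • c₂ u₂ (1, 0)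
        - (ρ⁻¹ * ((c₁ u₁ v₁).1 + (c₂ u₂ v₂).1) - (c₂ u₂ v₂).1) • c₂ v₂ (1, 0)) := by
    rw [coordCurvature, fderiv_christoffel_fibreMetric hρ h₁ h₂ hz,
      fderiv_christoffel_fibreMetric hρ h₁ h₂ hz]
    simp only [christoffel_fibreMetric hρ h₁ h₂ hz, fibreFst_fibreGlue, fibreSnd_fibreGlue,
      hz₁, hu₁, hv₁, hz₂, hu₂, hv₂, ← map_sub, ← map_add]
    congr 1
    simp only [coordCurvature, map_add, map_smul, ← hc₁, ← hc₂, Prod.mk_sub_mk, Prod.mk_add_mk]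
    congr 1 <;> abel
  rw [key, fibreMetric_glue hρ h₁ h₂ hz]
  simp only [hz₁, hu₁, hz₂, hu₂, map_add, add_apply, map_sub, sub_apply, map_smul, smul_apply,
    smul_eq_mul]
  rw [h₁.apply_christoffel_vertical hz1, h₁.apply_christoffel_vertical hz1,
    h₂.apply_christoffel_vertical hz2, h₂.apply_christoffel_vertical hz2,
    sliceForm_symm h₁ hz1 v₁ u₁, sliceForm_symm h₂ hz2 v₂ u₂]
  simp only [sliceForm, ← hc₁, ← hc₂]
  ring

end FibreProduct

/-! ### Metrics and curvature of a manifold read in its preferred charts. -/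

section CoordinateExpressions

variable {E : Type*} [NormedAddCommGroup E] [NormedSpace ℝ E]
  {H : Type*} [TopologicalSpace H] {I : ModelWithCorners ℝ E H}
  {M : Type*} [TopologicalSpace M] [ChartedSpace H M]
  {E' : Type*} [NormedAddCommGroup E'] [NormedSpace ℝ E']

section Charts

/-- The derivative of a map from a vector space to a manifold, where the tangent spaces are
identified with the model space. -/
def paramDeriv (I : ModelWithCorners ℝ E H) (φ : E' → M) (z : E') : E' →L[ℝ] E :=
  mfderiv 𝓘(ℝ, E') I φ z

/-- A bilinear form on a tangent space as a bilinear form on the model space. -/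
def formAt (B : ∀ x : M, TangentSpace I x →L[ℝ] TangentSpace I x →L[ℝ] ℝ) (x : M) :
    E →L[ℝ] E →L[ℝ] ℝ := B x

lemma mfderivWithin_range_eq [I.Boundaryless] (φ : E → M) (z : E) :
    mfderivWithin 𝓘(ℝ, E) I φ (Set.range I) z = paramDeriv I φ z := by
  rw [I.range_eq_univ, mfderivWithin_univ, paramDeriv]

variable [IsManifold I ∞ M]

variable [I.Boundaryless]

/-- Links the trivialization of the tangent bundle, in which smoothness of a metric is phrased, with
the differential of the inverse chart, in which `coordMetric` is phrased. -/
lemma symmL_apply_eq (x : M) {z : E} (hz : z ∈ (extChartAt I x).target) (v : E) :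
    (trivializationAt E (TangentSpace I) x).symmL ℝ ((extChartAt I x).symm z) v =
      paramDeriv I (extChartAt I x).symm z v := by
  have h1 : (extChartAt I x).symm z ∈ (chartAt H x).source := by
    rw [← extChartAt_source I]; exact (extChartAt I x).map_target hz
  have h2 := TangentBundle.symmL_trivializationAt (I := I) (𝕜 := ℝ) h1
  rw [(extChartAt I x).right_inv hz] at h2
  rw [← mfderivWithin_range_eq]
  exact congrArg (fun L => L v) h2

lemma contMDiffAt_extChartAt_symm (x : M) {z : E} (hz : z ∈ (extChartAt I x).target) :
    ContMDiffAt 𝓘(ℝ, E) I ∞ (extChartAt I x).symm z :=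
  (contMDiffOn_extChartAt_symm x).contMDiffAt ((isOpen_extChartAt_target x).mem_nhds hz)

lemma paramDeriv_extChartAt_symm_self (x : M) :
    paramDeriv I (extChartAt I x).symm (extChartAt I x x) = ContinuousLinearMap.id ℝ E := by
  rw [← mfderivWithin_range_eq, mfderivWithin_range_extChartAt_symm]
  rfl

lemma paramDeriv_extChartAt_symm_bijective (x : M) {z : E} (hz : z ∈ (extChartAt I x).target) :
    Function.Bijective (paramDeriv I (extChartAt I x).symm z) := by
  have := isInvertible_mfderivWithin_extChartAt_symm (I := I) hz
  rw [mfderivWithin_range_eq] at this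
  exact this.bijective

end Charts

/-- The pullback of a field of bilinear forms by a parametrization. -/
def pullbackForm (B : ∀ x : M, TangentSpace I x →L[ℝ] TangentSpace I x →L[ℝ] ℝ) (φ : E' → M)
    (z : E') : E' →L[ℝ] E' →L[ℝ] ℝ :=
  (formAt B (φ z)).bilinearComp (paramDeriv I φ z) (paramDeriv I φ z)

lemma pullbackForm_apply (B : ∀ x : M, TangentSpace I x →L[ℝ] TangentSpace I x →L[ℝ] ℝ)
    (φ : E' → M) (z u v : E') : pullbackForm B φ z u v =
      formAt B (φ z) (paramDeriv I φ z u) (paramDeriv I φ z v) := rfl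

variable [IsManifold I ∞ M]

lemma coordMetric_apply (g : SmoothMetric I M) (x : M) (z u v : E) :
    coordMetric g x z u v = formAt g.inner ((extChartAt I x).symm z)
      (paramDeriv I (extChartAt I x).symm z u) (paramDeriv I (extChartAt I x).symm z v) := rfl

lemma formAt_pos (g : SmoothMetric I M) (x : M) {u : E} (hu : u ≠ 0) :
    0 < formAt g.inner x u u := g.pos x u hu

lemma formAt_symm (g : SmoothMetric I M) (x : M) (u v : E) :
    formAt g.inner x u v = formAt g.inner x v u := g.symm x u v

lemma christoffel_eq (g : SmoothMetric I M) (x : M) (z u v : E) :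
    christoffel g x z u v = coordChristoffel (coordMetric g x) z u v := by
  simp only [christoffel, coordChristoffel, ContinuousLinearMap.comp_apply,
    ContinuousLinearMap.compL_apply]
  congr 1

variable [FiniteDimensional ℝ E] [I.Boundaryless]

/-- A field of bilinear forms is smooth if its coordinate expressions are. -/
lemma contMDiff_of_pullbackForm
    (B : ∀ x : M, TangentSpace I x →L[ℝ] TangentSpace I x →L[ℝ] ℝ)
    (hB : ∀ x : M, ContDiffAt ℝ ∞ (pullbackForm B (extChartAt I x).symm) (extChartAt I x x)) :
    ContMDiff I (I.prod 𝓘(ℝ, E →L[ℝ] E →L[ℝ] ℝ)) ∞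
      (fun b ↦ Bundle.TotalSpace.mk' (E →L[ℝ] E →L[ℝ] ℝ)
        (E := fun b : M => TangentSpace I b →L[ℝ] TangentSpace I b →L[ℝ] ℝ) b (B b)) := by
  intro x
  rw [contMDiffAt_hom_bundle]
  refine ⟨contMDiffAt_id, ?_⟩
  have h1 : ContMDiffAt I 𝓘(ℝ, E →L[ℝ] E →L[ℝ] ℝ) ∞
      (fun y => pullbackForm B (extChartAt I x).symm (extChartAt I x y)) x :=
    (hB x).contMDiffAt.comp x contMDiffAt_extChartAt
  refine h1.congr_of_eventuallyEq ?_
  filter_upwards [(isOpen_extChartAt_source (I := I) x).mem_nhds (mem_extChartAt_source x)]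
    with y hy
  have hz := (extChartAt I x).map_source hy
  ext v w
  have hy' : y ∈ (chartAt H x).source := by rwa [extChartAt_source] at hy
  refine (inCoordinates_apply_eq₂ (F₁ := E) (F₂ := E) (F₃ := ℝ)
    (E₁ := fun b : M => TangentSpace I b) (E₂ := fun b : M => TangentSpace I b)
    (E₃ := fun b : M => ℝ) (by simpa using hy') (by simpa using hy')
    (by simp)).trans ?_
  have e1 := fun v => symmL_apply_eq x hz v
  rw [(extChartAt I x).left_inv hy] at e1
  have hb : y ∈ (trivializationAt E (TangentSpace I : M → Type _) x).baseSet := by simpa using hy'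
  have e2 : ∀ v : E, (trivializationAt E (TangentSpace I) x).symm y v =
      paramDeriv I (extChartAt I x).symm (extChartAt I x y) v := fun v =>
    ((trivializationAt E (TangentSpace I : M → Type _) x).symmL_apply hb v).symm.trans (e1 v)
  rw [e2, e2, pullbackForm_apply, (extChartAt I x).left_inv hy]
  simp [formAt]
  rfl

lemma contDiffOn_coordMetric (g : SmoothMetric I M) (x : M) :
    ContDiffOn ℝ ∞ (coordMetric g x) (extChartAt I x).target := by
  rw [contDiffOn_clm_apply]
  intro v
  rw [contDiffOn_clm_apply]
  intro w
  have hs : ∀ v : E, ContMDiffOn I (I.prod 𝓘(ℝ, E)) ∞ (fun m => Bundle.TotalSpace.mk' E m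
      ((trivializationAt E (TangentSpace I) x).symmL ℝ m v)) (chartAt H x).source := by
    intro v
    have h1 := (trivializationAt E (TangentSpace I : M → Type _) x).contMDiffOn_symmL
      (IB := I) (n := ∞) (𝕜 := ℝ)
    refine (h1.clm_bundle_apply (F₁ := E) (E₁ := fun _ : M => E) (v := fun _ => v) ?_).mono ?_
    · intro m hm
      exact (Bundle.contMDiffAt_section (n := ∞) (s := fun _ : M => v) (E := Bundle.Trivial M E)
        (F := E) (IB := I) m).2 contMDiffAt_const |>.contMDiffWithinAt
    · intro m hm; simpa using hm
  have h2 : ContMDiffOn I (I.prod 𝓘(ℝ, ℝ)) ∞ (fun m => Bundle.TotalSpace.mk' ℝ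
      (E := Bundle.Trivial M ℝ) m (g.inner m ((trivializationAt E (TangentSpace I) x).symmL ℝ m v)
        ((trivializationAt E (TangentSpace I) x).symmL ℝ m w))) (chartAt H x).source :=
    g.contMDiff.contMDiffOn.clm_bundle_apply₂ (hs v) (hs w)
  have h3 : ContMDiffOn I 𝓘(ℝ, ℝ) ∞ (fun m =>
      g.inner m ((trivializationAt E (TangentSpace I) x).symmL ℝ m v)
        ((trivializationAt E (TangentSpace I) x).symmL ℝ m w)) (chartAt H x).source := by
    intro m hm
    have := h2 m hm
    rw [Bundle.contMDiffWithinAt_totalSpace] at this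
    exact this.2
  have h4 := h3.comp (contMDiffOn_extChartAt_symm (I := I) (n := ∞) x)
    (fun z hz => by
      have := (extChartAt I x).map_target hz
      rwa [extChartAt_source] at this)
  refine h4.contDiffOn.congr fun z hz => ?_
  rw [coordMetric_apply, Function.comp_apply, symmL_apply_eq x hz v,
    symmL_apply_eq x hz w]
  rfl

lemma coordMetric_pos (g : SmoothMetric I M) (x : M) {z : E} (hz : z ∈ (extChartAt I x).target)
    {u : E} (hu : u ≠ 0) : 0 < coordMetric g x z u u := by
  have h : paramDeriv I (extChartAt I x).symm z u ≠ 0 := fun h => hu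
    ((paramDeriv_extChartAt_symm_bijective x hz).1 (h.trans (map_zero _).symm))
  rw [coordMetric_apply]
  exact formAt_pos g _ h

lemma coordMetric_symm (g : SmoothMetric I M) (x : M) (z u v : E) :
    coordMetric g x z u v = coordMetric g x z v u := by
  rw [coordMetric_apply, coordMetric_apply, formAt_symm]

lemma isMetricOn_coordMetric (g : SmoothMetric I M) (x : M) :
    IsMetricOn (coordMetric g x) (extChartAt I x).target :=
  ⟨isOpen_extChartAt_target x, contDiffOn_coordMetric g x,
    fun z _ u v => coordMetric_symm g x z u v, fun _ hz _ hu => coordMetric_pos g x hz hu⟩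

lemma coordMetric_self (g : SmoothMetric I M) (x : M) :
    coordMetric g x (extChartAt I x x) = formAt g.inner x := by
  ext u v
  rw [coordMetric_apply, paramDeriv_extChartAt_symm_self, extChartAt_to_inv]
  rfl

lemma riemannTensor_eq (g : SmoothMetric I M) (x : M) (u v w : E) :
    (riemannTensor g x u v w : E) =
      coordCurvature (coordMetric g x) (extChartAt I x x) u v w := by
  have hG := isMetricOn_coordMetric g x
  have hd := (hG.hasFDerivAt_christoffel (mem_extChartAt_target x)).differentiableAt
  simp only [riemannTensor, coordCurvature, christoffel_eq]
  rw [fderiv_clm_apply_const₂ hd, fderiv_clm_apply_const₂ hd]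

end CoordinateExpressions

/-! ### Metric and curvature in an arbitrary parametrization. -/

section Parametrizations

variable {E : Type*} [NormedAddCommGroup E] [NormedSpace ℝ E]
  {H : Type*} [TopologicalSpace H] {I : ModelWithCorners ℝ E H}
  {M : Type*} [TopologicalSpace M] [ChartedSpace H M] [IsManifold I ∞ M]
  {E' : Type*} [NormedAddCommGroup E'] [NormedSpace ℝ E']
  {φ : E' → M} {U : Set E'}

lemma contDiffOn_chart_comp (hφ : ContMDiffOn 𝓘(ℝ, E') I ∞ φ U) {x : M}
    (hx : Set.MapsTo φ U (extChartAt I x).source) :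
    ContDiffOn ℝ ∞ (extChartAt I x ∘ φ) U := by
  rw [← contMDiffOn_iff_contDiffOn]
  refine (contMDiffOn_extChartAt (I := I) (n := ∞) (x := x)).comp hφ fun z hz => ?_
  have := hx hz
  rwa [extChartAt_source] at this

variable [I.Boundaryless]

lemma paramDeriv_eq_comp (hU : IsOpen U) (hφ : ContMDiffOn 𝓘(ℝ, E') I ∞ φ U) {x : M}
    (hx : Set.MapsTo φ U (extChartAt I x).source) {z : E'} (hz : z ∈ U) :
    paramDeriv I φ z = paramDeriv I (extChartAt I x).symm (extChartAt I x (φ z)) ∘L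
      fderiv ℝ (extChartAt I x ∘ φ) z := by
  have hψ : MDifferentiableAt 𝓘(ℝ, E') 𝓘(ℝ, E) (extChartAt I x ∘ φ) z :=
    (((contDiffOn_chart_comp hφ hx).contDiffAt (hU.mem_nhds hz)).differentiableAt
      (by simp)).mdifferentiableAt
  have hs : MDifferentiableAt 𝓘(ℝ, E) I (extChartAt I x).symm ((extChartAt I x ∘ φ) z) :=
    (contMDiffAt_extChartAt_symm x ((extChartAt I x).map_source (hx hz))).mdifferentiableAt
      (by simp)
  have e1 : φ =ᶠ[𝓝 z] (extChartAt I x).symm ∘ (extChartAt I x ∘ φ) := by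
    filter_upwards [hU.mem_nhds hz] with y hy
    exact ((extChartAt I x).left_inv (hx hy)).symm
  have e2 := e1.mfderiv_eq (I := 𝓘(ℝ, E')) (I' := I)
  rw [mfderiv_comp z hs hψ, mfderiv_eq_fderiv] at e2
  exact e2

lemma pullbackForm_eq_comp (B : ∀ x : M, TangentSpace I x →L[ℝ] TangentSpace I x →L[ℝ] ℝ)
    (hU : IsOpen U) (hφ : ContMDiffOn 𝓘(ℝ, E') I ∞ φ U) {x : M}
    (hx : Set.MapsTo φ U (extChartAt I x).source) {z : E'} (hz : z ∈ U) :
    pullbackForm B φ z = (pullbackForm B (extChartAt I x).symm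
      (extChartAt I x (φ z))).bilinearComp (fderiv ℝ (extChartAt I x ∘ φ) z)
        (fderiv ℝ (extChartAt I x ∘ φ) z) := by
  ext u v
  simp only [ContinuousLinearMap.bilinearComp_apply, pullbackForm_apply,
    paramDeriv_eq_comp hU hφ hx hz, ContinuousLinearMap.comp_apply,
    (extChartAt I x).left_inv (hx hz)]

lemma isCoordIsometry_chart_comp (g : SmoothMetric I M) (hU : IsOpen U)
    (hφ : ContMDiffOn 𝓘(ℝ, E') I ∞ φ U) {x : M}
    (hx : Set.MapsTo φ U (extChartAt I x).source)
    (hsurj : ∀ z ∈ U, Function.Surjective (paramDeriv I φ z)) :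
    IsCoordIsometry (pullbackForm g.inner φ) U (coordMetric g x) (extChartAt I x).target
      (extChartAt I x ∘ φ) where
  smooth := contDiffOn_chart_comp hφ hx
  mapsTo z hz := (extChartAt I x).map_source (hx hz)
  surjective z hz w := by
    obtain ⟨u, hu⟩ := hsurj z hz (paramDeriv I (extChartAt I x).symm (extChartAt I x (φ z)) w)
    refine ⟨u, (paramDeriv_extChartAt_symm_bijective x
      ((extChartAt I x).map_source (hx hz))).1 ?_⟩
    rw [← hu, paramDeriv_eq_comp hU hφ hx hz]
    rfl
  metric z hz u v := by
    rw [pullbackForm_eq_comp g.inner hU hφ hx hz]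
    rfl

lemma isOpen_inter_preimage_chart (hU : IsOpen U) (hφ : ContMDiffOn 𝓘(ℝ, E') I ∞ φ U) (x : M) :
    IsOpen (U ∩ φ ⁻¹' (extChartAt I x).source) :=
  hφ.continuousOn.isOpen_inter_preimage hU (isOpen_extChartAt_source x)

variable [FiniteDimensional ℝ E]

lemma contDiffOn_pullbackMetric (g : SmoothMetric I M) (hU : IsOpen U)
    (hφ : ContMDiffOn 𝓘(ℝ, E') I ∞ φ U) : ContDiffOn ℝ ∞ (pullbackForm g.inner φ) U := by
  intro z hz
  set V := U ∩ φ ⁻¹' (extChartAt I (φ z)).source with hV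
  have hVo : IsOpen V := isOpen_inter_preimage_chart hU hφ (φ z)
  have hzV : z ∈ V := ⟨hz, mem_extChartAt_source (φ z)⟩
  have hφV := hφ.mono (Set.inter_subset_left : V ⊆ U)
  have hx : Set.MapsTo φ V (extChartAt I (φ z)).source := fun y hy => hy.2
  have hψ := contDiffOn_chart_comp hφV hx
  have h1 : ContDiffOn ℝ ∞ (fun y => (coordMetric g (φ z) (extChartAt I (φ z) (φ y))).bilinearComp
      (fderiv ℝ (extChartAt I (φ z) ∘ φ) y) (fderiv ℝ (extChartAt I (φ z) ∘ φ) y)) V :=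
    contDiffOn_bilinearComp ((contDiffOn_coordMetric g (φ z)).comp hψ
      fun y hy => (extChartAt I (φ z)).map_source (hx hy)) (hψ.fderiv_of_isOpen hVo (by simp))
  have h2 : ContDiffOn ℝ ∞ (pullbackForm g.inner φ) V :=
    h1.congr fun y hy => pullbackForm_eq_comp g.inner hVo hφV hx hy
  exact (h2.contDiffAt (hVo.mem_nhds hzV)).contDiffWithinAt

lemma isMetricOn_pullbackMetric (g : SmoothMetric I M) (hU : IsOpen U)
    (hφ : ContMDiffOn 𝓘(ℝ, E') I ∞ φ U)
    (hinj : ∀ z ∈ U, Function.Injective (paramDeriv I φ z)) :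
    IsMetricOn (pullbackForm g.inner φ) U where
  isOpen := hU
  smooth := contDiffOn_pullbackMetric g hU hφ
  symm z _ u v := by rw [pullbackForm_apply, pullbackForm_apply, formAt_symm]
  pos z hz u hu := by
    rw [pullbackForm_apply]
    exact formAt_pos g _ fun h => hu (hinj z hz (h.trans (map_zero _).symm))

variable [FiniteDimensional ℝ E']

/-- The curvature of a Riemannian manifold read in an arbitrary parametrization. -/
lemma paramDeriv_coordCurvature (g : SmoothMetric I M) (hU : IsOpen U)
    (hφ : ContMDiffOn 𝓘(ℝ, E') I ∞ φ U)
    (hbij : ∀ z ∈ U, Function.Bijective (paramDeriv I φ z)) {z : E'} (hz : z ∈ U)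
    (u v w : E') :
    paramDeriv I φ z (coordCurvature (pullbackForm g.inner φ) z u v w) =
      (riemannTensor g (φ z) (paramDeriv I φ z u) (paramDeriv I φ z v) (paramDeriv I φ z w)
        : E) := by
  set V := U ∩ φ ⁻¹' (extChartAt I (φ z)).source with hV
  have hVo : IsOpen V := isOpen_inter_preimage_chart hU hφ (φ z)
  have hzV : z ∈ V := ⟨hz, mem_extChartAt_source (φ z)⟩
  have hφV := hφ.mono (Set.inter_subset_left : V ⊆ U)
  have hx : Set.MapsTo φ V (extChartAt I (φ z)).source := fun y hy => hy.2
  have hiso := isCoordIsometry_chart_comp g hVo hφV hx fun y hy => (hbij y hy.1).2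
  have hG' := isMetricOn_pullbackMetric g hVo hφV fun y hy => (hbij y hy.1).1
  have h1 := hiso.fderiv_curvature (isMetricOn_coordMetric g (φ z)) hG' hzV u v w
  -- The chart is centred at `φ z` itself, so its differential there is the identity and no change
  -- of frame remains.
  have h2 : fderiv ℝ (extChartAt I (φ z) ∘ φ) z = paramDeriv I φ z := by
    rw [paramDeriv_eq_comp hVo hφV hx hzV, paramDeriv_extChartAt_symm_self]
    rfl
  rw [h2] at h1
  rw [riemannTensor_eq, h1]
  rfl

end Parametrizations

/-! ### The Hessian and its naturality. -/

section Hessian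

variable {E : Type*} [NormedAddCommGroup E] [NormedSpace ℝ E]
  {E' : Type*} [NormedAddCommGroup E'] [NormedSpace ℝ E']

/-- The Hessian of a function with respect to a metric tensor on a vector space. -/
def coordHessian (G : E → E →L[ℝ] E →L[ℝ] ℝ) (f : E → ℝ) (z u v : E) : ℝ :=
  fderiv ℝ (fderiv ℝ f) z u v - fderiv ℝ f z (coordChristoffel G z u v)

/-- The second derivative of `ψ` in the chain rule cancels the inhomogeneous term in the
transformation law of the Christoffel symbols. -/
lemma IsCoordIsometry.coordHessian_comp [FiniteDimensional ℝ E] [FiniteDimensional ℝ E']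
    {G' : E' → E' →L[ℝ] E' →L[ℝ] ℝ} {s' : Set E'} {G : E → E →L[ℝ] E →L[ℝ] ℝ} {s : Set E}
    {ψ : E' → E} (h : IsCoordIsometry G' s' G s ψ) (hG : IsMetricOn G s)
    (hG' : IsMetricOn G' s') {f : E → ℝ} (hf : ContDiffOn ℝ ∞ f s) {z : E'} (hz : z ∈ s')
    (u v : E') :
    coordHessian G' (f ∘ ψ) z u v =
      coordHessian G f (ψ z) (fderiv ℝ ψ z u) (fderiv ℝ ψ z v) := by
  have hfd : ∀ y ∈ s', HasFDerivAt f (fderiv ℝ f (ψ y)) (ψ y) := fun y hy =>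
    ((hf.contDiffAt (hG.isOpen.mem_nhds (h.mapsTo hy))).differentiableAt (by simp)).hasFDerivAt
  have hfd2 : HasFDerivAt (fderiv ℝ f) (fderiv ℝ (fderiv ℝ f) (ψ z)) (ψ z) :=
    (((hf.contDiffAt (hG.isOpen.mem_nhds (h.mapsTo hz))).fderiv_right (m := ∞)
      (by simp)).differentiableAt (by simp)).hasFDerivAt
  have e1 : ∀ y ∈ s', fderiv ℝ (f ∘ ψ) y = fderiv ℝ f (ψ y) ∘L fderiv ℝ ψ y := fun y hy =>
    ((hfd y hy).comp y (h.hasFDerivAt hG'.isOpen hy)).fderiv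
  have e2 : fderiv ℝ (f ∘ ψ) =ᶠ[𝓝 z] fun y => fderiv ℝ f (ψ y) ∘L fderiv ℝ ψ y := by
    filter_upwards [hG'.isOpen.mem_nhds hz] with y hy using e1 y hy
  have e3 := (hfd2.comp z (h.hasFDerivAt hG'.isOpen hz)).clm_comp
    (h.hasFDerivAt_fderiv hG'.isOpen hz)
  have e4 : fderiv ℝ (fderiv ℝ (f ∘ ψ)) z u v =
      fderiv ℝ (fderiv ℝ f) (ψ z) (fderiv ℝ ψ z u) (fderiv ℝ ψ z v)
        + fderiv ℝ f (ψ z) (fderiv ℝ (fderiv ℝ ψ) z u v) := by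
    rw [e2.fderiv_eq]
    erw [e3.fderiv]
    simp [add_comm]
  rw [coordHessian, coordHessian, e4, e1 z hz, ContinuousLinearMap.comp_apply,
    h.fderiv_christoffel hG hG' hz, map_add]
  ring

end Hessian

/-! ### Geodesics in coordinates: existence, regularity and constant speed. -/

section GeodesicEquation

variable {E : Type*} [NormedAddCommGroup E] [NormedSpace ℝ E]
  {E' : Type*} [NormedAddCommGroup E'] [NormedSpace ℝ E']

/-- Second derivative of a composition with a curve. -/
lemma hasDerivAt_fderiv_comp_curve {F : Type*} [NormedAddCommGroup F] [NormedSpace ℝ F]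
    {ψ : E → F} {γ w : ℝ → E} {a : E} {t : ℝ} (hψ : ContDiffAt ℝ ∞ ψ (γ t))
    (h1 : HasDerivAt γ (w t) t) (h2 : HasDerivAt w a t) :
    HasDerivAt (fun s => fderiv ℝ ψ (γ s) (w s))
      (fderiv ℝ (fderiv ℝ ψ) (γ t) (w t) (w t) + fderiv ℝ ψ (γ t) a) t := by
  have e := ((hψ.fderiv_right (m := ∞) (by simp)).differentiableAt (by simp)).hasFDerivAt
  exact (e.comp_hasDerivAt t h1).clm_apply h2

lemma deriv_deriv_comp_curve {F : Type*} [NormedAddCommGroup F] [NormedSpace ℝ F]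
    {ψ : E → F} {s : Set E} (hs : IsOpen s) (hψ : ContDiffOn ℝ ∞ ψ s) {γ w : ℝ → E} {a : E} {t : ℝ}
    (ht : γ t ∈ s) (h1 : ∀ᶠ r in 𝓝 t, HasDerivAt γ (w r) r) (h2 : HasDerivAt w a t) :
    deriv (fun r => ψ (γ r)) t = fderiv ℝ ψ (γ t) (w t) ∧
    deriv (deriv (fun r => ψ (γ r))) t =
      fderiv ℝ (fderiv ℝ ψ) (γ t) (w t) (w t) + fderiv ℝ ψ (γ t) a := by
  have hγ : ContinuousAt γ t := h1.self_of_nhds.continuousAt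
  have e1 : deriv (fun r => ψ (γ r)) =ᶠ[𝓝 t] fun r => fderiv ℝ ψ (γ r) (w r) := by
    filter_upwards [h1, hγ (hs.mem_nhds ht)] with r hr hr'
    exact (((hψ.contDiffAt (hs.mem_nhds hr')).differentiableAt
      (by simp)).hasFDerivAt.comp_hasDerivAt r hr).deriv
  refine ⟨e1.self_of_nhds, ?_⟩
  rw [e1.deriv_eq]
  exact (hasDerivAt_fderiv_comp_curve (hψ.contDiffAt (hs.mem_nhds ht)) h1.self_of_nhds h2).deriv

/-- Local existence of solutions of the geodesic equation. -/
lemma IsMetricOn.exists_geodesic [FiniteDimensional ℝ E] {G : E → E →L[ℝ] E →L[ℝ] ℝ} {s : Set E}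
    (hG : IsMetricOn G s) {z : E} (hz : z ∈ s) (v : E) :
    ∃ (η : ℝ) (γ w : ℝ → E), 0 < η ∧ γ 0 = z ∧ w 0 = v ∧ ∀ t ∈ Set.Ioo (-η) η,
      γ t ∈ s ∧ HasDerivAt γ (w t) t ∧
        HasDerivAt w (-coordChristoffel G (γ t) (w t) (w t)) t := by
  have hF : ContDiffAt ℝ 1 (fun p : E × E => (p.2, -coordChristoffel G p.1 p.2 p.2)) (z, v) := by
    have h1 : ContDiffAt ℝ 1 (fun p : E × E => coordChristoffel G p.1) (z, v) :=
      ((hG.contDiffAt_christoffel hz).of_le (by simp)).fst'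
    exact contDiffAt_snd.prodMk ((h1.clm_apply contDiffAt_snd).clm_apply contDiffAt_snd).neg
  obtain ⟨α, hα0, ε, hε, hα⟩ :=
    hF.exists_forall_mem_closedBall_exists_eq_forall_mem_Ioo_hasDerivAt₀ 0
  simp only [zero_sub, zero_add] at hα
  have hc : ContinuousAt (fun t => (α t).1) 0 :=
    ((hα 0 ⟨by linarith, hε⟩).continuousAt).fst
  have hs : ∀ᶠ t in 𝓝 (0 : ℝ), (α t).1 ∈ s :=
    hc (hG.isOpen.mem_nhds (by simpa [hα0] using hz))
  obtain ⟨δ, hδ, hδs⟩ := Metric.eventually_nhds_iff.1 hs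
  refine ⟨min ε δ, fun t => (α t).1, fun t => (α t).2, lt_min hε hδ, by simp [hα0],
    by simp [hα0], fun t ht => ⟨hδs ?_, ?_, ?_⟩⟩
  · rw [Real.dist_eq, sub_zero, abs_lt]
    exact ⟨by linarith [ht.1, min_le_right ε δ], by linarith [ht.2, min_le_right ε δ]⟩
  all_goals
    have h := hα t ⟨by linarith [ht.1, min_le_left ε δ], by linarith [ht.2, min_le_left ε δ]⟩
  · exact h.fst
  · exact h.snd

lemma contDiffOn_two_of_geodesic [FiniteDimensional ℝ E] {G : E → E →L[ℝ] E →L[ℝ] ℝ} {s : Set E}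
    (hG : IsMetricOn G s) {J : Set ℝ} (hJ : IsOpen J) {γ w : ℝ → E}
    (h : ∀ t ∈ J, γ t ∈ s ∧ HasDerivAt γ (w t) t ∧
        HasDerivAt w (-coordChristoffel G (γ t) (w t) (w t)) t) :
    ContDiffOn ℝ 2 γ J := by
  have hw : ContDiffOn ℝ 1 w J := by
    rw [show (1 : WithTop ℕ∞) = 0 + 1 by simp, contDiffOn_succ_iff_deriv_of_isOpen hJ]
    refine ⟨fun t ht => (h t ht).2.2.differentiableAt.differentiableWithinAt, by simp, ?_⟩
    rw [contDiffOn_zero]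
    have hw : ContinuousOn w J := fun t ht => (h t ht).2.2.continuousAt.continuousWithinAt
    have hΓ : ContinuousOn (fun t => coordChristoffel G (γ t)) J := fun t ht =>
      ((hG.contDiffAt_christoffel (h t ht).1).continuousAt.comp
        (h t ht).2.1.continuousAt).continuousWithinAt
    exact (((hΓ.clm_apply hw).clm_apply hw).neg).congr fun t ht => (h t ht).2.2.deriv
  rw [show (2 : WithTop ℕ∞) = 1 + 1 by norm_num, contDiffOn_succ_iff_deriv_of_isOpen hJ]
  exact ⟨fun t ht => (h t ht).2.1.differentiableAt.differentiableWithinAt, by simp,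
    hw.congr fun t ht => (h t ht).2.1.deriv⟩

/-- Metric compatibility and the geodesic equation make the derivative of the squared speed vanish.
The convexity hypothesis speaks of geodesics that have unit speed on the whole interval, whereas
only the initial velocity can be prescribed. -/
lemma geodesic_speed [FiniteDimensional ℝ E] {G : E → E →L[ℝ] E →L[ℝ] ℝ} {s : Set E}
    (hG : IsMetricOn G s) {η : ℝ} {γ w : ℝ → E}
    (h : ∀ t ∈ Set.Ioo (-η) η, γ t ∈ s ∧ HasDerivAt γ (w t) t ∧
        HasDerivAt w (-coordChristoffel G (γ t) (w t) (w t)) t) {t : ℝ}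
    (ht : t ∈ Set.Ioo (-η) η) : G (γ t) (w t) (w t) = G (γ 0) (w 0) (w 0) := by
  have hd : ∀ r ∈ Set.Ioo (-η) η, HasDerivAt (fun r => G (γ r) (w r) (w r)) 0 r := by
    intro r hr
    obtain ⟨hs, h1, h2⟩ := h r hr
    have e := (((hG.differentiableAt hs).hasFDerivAt.comp_hasDerivAt r h1).clm_apply h2).clm_apply h2
    convert! e using 1
    simp only [add_apply, map_neg, neg_apply, hG.fderiv_eq hs, Function.comp_apply]
    ring
  have h0 : (0 : ℝ) ∈ Set.Ioo (-η) η := by constructor <;> linarith [ht.1, ht.2]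
  exact isOpen_Ioo.is_const_of_deriv_eq_zero isPreconnected_Ioo
    (fun r hr => (hd r hr).differentiableAt.differentiableWithinAt)
    (fun r hr => (hd r hr).deriv) ht h0

end GeodesicEquation

/-! ### From convexity along geodesics to bounds on the Hessian. -/

section Geodesics

variable {E : Type*} [NormedAddCommGroup E] [NormedSpace ℝ E] [FiniteDimensional ℝ E]
  {H : Type*} [TopologicalSpace H] {I : ModelWithCorners ℝ E H} [I.Boundaryless]
  {M : Type*} [TopologicalSpace M] [ChartedSpace H M] [IsManifold I ∞ M]

lemma isCoordIsometry_transition (g : SmoothMetric I M) (x x' : M) :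
    IsCoordIsometry (coordMetric g x)
      ((extChartAt I x).target ∩ (extChartAt I x).symm ⁻¹' (extChartAt I x').source)
      (coordMetric g x') (extChartAt I x').target (extChartAt I x' ∘ (extChartAt I x).symm) := by
  have h1 : ContMDiffOn 𝓘(ℝ, E) I ∞ (extChartAt I x).symm (extChartAt I x).target :=
    contMDiffOn_extChartAt_symm x
  exact isCoordIsometry_chart_comp g
    (isOpen_inter_preimage_chart (isOpen_extChartAt_target x) h1 x')
    (h1.mono Set.inter_subset_left) (fun z hz => hz.2)
    (fun z hz => (paramDeriv_extChartAt_symm_bijective x hz.1).2)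

lemma IsMetricOn.mono {G : E → E →L[ℝ] E →L[ℝ] ℝ} {s t : Set E} (h : IsMetricOn G s)
    (ht : IsOpen t) (hts : t ⊆ s) : IsMetricOn G t :=
  ⟨ht, h.smooth.mono hts, fun z hz => h.symm z (hts hz), fun z hz => h.pos z (hts hz)⟩

/-- A solution of the geodesic equation in one chart is a geodesic. -/
lemma isGeodesicOn_of_chart (g : SmoothMetric I M) (x : M) {η : ℝ} {γ w : ℝ → E}
    (h : ∀ t ∈ Set.Ioo (-η) η, γ t ∈ (extChartAt I x).target ∧ HasDerivAt γ (w t) t ∧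
        HasDerivAt w (-coordChristoffel (coordMetric g x) (γ t) (w t) (w t)) t) :
    IsGeodesicOn g (fun t => (extChartAt I x).symm (γ t)) η := by
  have hG := isMetricOn_coordMetric g x
  refine ⟨?_, fun t ht => ?_⟩
  · exact ((contMDiffOn_extChartAt_symm (n := ∞) x).of_le (ENat.LEInfty.out)).comp
      (contDiffOn_two_of_geodesic hG isOpen_Ioo h).contMDiffOn fun t ht => (h t ht).1
  · intro β
    set x' := (extChartAt I x).symm (γ t) with hx'
    obtain ⟨hs, h1, h2⟩ := h t ht
    have hiso := isCoordIsometry_transition g x x'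
    have h1' : ContMDiffOn 𝓘(ℝ, E) I ∞ (extChartAt I x).symm (extChartAt I x).target :=
      contMDiffOn_extChartAt_symm x
    have hV := isOpen_inter_preimage_chart (isOpen_extChartAt_target x) h1' x'
    have hz : γ t ∈ (extChartAt I x).target ∩ (extChartAt I x).symm ⁻¹' (extChartAt I x').source :=
      ⟨hs, mem_extChartAt_source x'⟩
    obtain ⟨d1, d2⟩ := deriv_deriv_comp_curve hV hiso.smooth hz (by
      filter_upwards [isOpen_Ioo.mem_nhds ht] with r hr using (h r hr).2.1) h2
    have e := hiso.fderiv_christoffel (isMetricOn_coordMetric g x')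
      (hG.mono hV Set.inter_subset_left) hz (w t) (w t)
    have hβ : β = fun r => (extChartAt I x' ∘ (extChartAt I x).symm) (γ r) := rfl
    rw [christoffel_eq, hβ, d1, d2, map_neg, e]
    simp only [Function.comp_apply]
    abel

lemma velocity_chart (x : M) {γ : ℝ → E} {w : E} {t : ℝ} (hs : γ t ∈ (extChartAt I x).target)
    (h1 : HasDerivAt γ w t) :
    (velocity I (fun t => (extChartAt I x).symm (γ t)) t : E) =
      paramDeriv I (extChartAt I x).symm (γ t) w := by
  have hs' := (contMDiffAt_extChartAt_symm x hs).mdifferentiableAt (by simp)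
  have h2 := mfderiv_comp t hs' h1.differentiableAt.mdifferentiableAt
  rw [mfderiv_eq_fderiv] at h2
  have h3 : fderiv ℝ γ t (1 : ℝ) = w := by rw [← h1.deriv]; rfl
  have h4 := congrArg (fun L : ℝ →L[ℝ] E => L 1) h2
  refine h4.trans ?_
  change paramDeriv I (extChartAt I x).symm (γ t) (fderiv ℝ γ t (1 : ℝ)) = _
  rw [h3]

/-- The differential of a function read in a parametrization. -/
lemma fderiv_comp_param {E' : Type*} [NormedAddCommGroup E'] [NormedSpace ℝ E']
    {φ : E' → M} {z : E'} (hφ : ContMDiffAt 𝓘(ℝ, E') I ∞ φ z) {f : M → ℝ}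
    (hf : ContMDiff I 𝓘(ℝ, ℝ) ∞ f) (v : E') :
    fderiv ℝ (f ∘ φ) z v = mfderiv I 𝓘(ℝ, ℝ) f (φ z) (paramDeriv I φ z v) := by
  have h2 := mfderiv_comp z ((hf (φ z)).mdifferentiableAt (by simp))
    (hφ.mdifferentiableAt (by simp))
  rw [mfderiv_eq_fderiv] at h2
  exact congrArg (fun L : E' →L[ℝ] ℝ => L v) h2

lemma exists_formAt_equiv (g : SmoothMetric I M) (x : M) :
    ∃ e : E ≃L[ℝ] (E →L[ℝ] ℝ), (e : E →L[ℝ] (E →L[ℝ] ℝ)) = formAt g.inner x := by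
  have := (isMetricOn_coordMetric g x).exists_equiv (mem_extChartAt_target x)
  rwa [coordMetric_self] at this

lemma formAt_grad (g : SmoothMetric I M) (f : M → ℝ) (x : M) (v : E) :
    formAt g.inner x (grad g f x) v = mfderiv I 𝓘(ℝ, ℝ) f x v := by
  obtain ⟨e, he⟩ := exists_formAt_equiv g x
  have h : formAt g.inner x ((formAt g.inner x).inverse (mfderiv I 𝓘(ℝ, ℝ) f x)) =
      (mfderiv I 𝓘(ℝ, ℝ) f x : E →L[ℝ] ℝ) := by
    rw [← he, ContinuousLinearMap.inverse_equiv]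
    exact e.apply_symm_apply _
  exact congrArg (fun L : E →L[ℝ] ℝ => L v) h

/-- The pinching of the Hessian on the level sets, deduced from geodesics. -/
lemma HasPinchedConvexLevels.hessian {g : SmoothMetric I M} {f : M → ℝ}
    (hf : ContMDiff I 𝓘(ℝ, ℝ) ∞ f) (h : HasPinchedConvexLevels g f) :
    ∃ c₁ c₂ : ℝ, 0 < c₁ ∧ c₁ ≤ c₂ ∧ ∀ (x : M) (v : E), formAt g.inner x v v = 1 →
      fderiv ℝ (f ∘ (extChartAt I x).symm) (extChartAt I x x) v = 0 →
      c₁ ≤ coordHessian (coordMetric g x) (f ∘ (extChartAt I x).symm) (extChartAt I x x) v v ∧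
      coordHessian (coordMetric g x) (f ∘ (extChartAt I x).symm) (extChartAt I x x) v v ≤ c₂ := by
  obtain ⟨c₁, c₂, h0, h12, hc⟩ := h
  refine ⟨c₁, c₂, h0, h12, fun x v hv hfv => ?_⟩
  have hG := isMetricOn_coordMetric g x
  -- Along the geodesic with initial velocity `v` the acceleration is `-Γ(v, v)`, so the second
  -- derivative of `f` at time `0` is exactly the Hessian on `v`.
  obtain ⟨η, γ, w, hη, hγ0, hw0, hγ⟩ := hG.exists_geodesic (mem_extChartAt_target x) v
  have hgeo := isGeodesicOn_of_chart g x hγ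
  have h00 : (0 : ℝ) ∈ Set.Ioo (-η) η := ⟨by linarith, hη⟩
  have hφ0 : (extChartAt I x).symm (γ 0) = x := by rw [hγ0, extChartAt_to_inv]
  have hft : ContDiffOn ℝ ∞ (f ∘ (extChartAt I x).symm) (extChartAt I x).target :=
    (hf.comp_contMDiffOn (contMDiffOn_extChartAt_symm x)).contDiffOn
  have key := hc η _ hη hgeo (fun t ht => ?_) ?_
  · obtain ⟨-, d2⟩ := deriv_deriv_comp_curve (isOpen_extChartAt_target x) hft
      (hγ 0 h00).1 (by
      filter_upwards [isOpen_Ioo.mem_nhds h00] with r hr using (hγ r hr).2.1) (hγ 0 h00).2.2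
    have e : coordHessian (coordMetric g x) (f ∘ (extChartAt I x).symm) (extChartAt I x x) v v =
        deriv (deriv (fun t => f ((extChartAt I x).symm (γ t)))) 0 := by
      refine Eq.trans ?_ d2.symm
      rw [hγ0, hw0, map_neg, coordHessian, sub_eq_add_neg]
    rw [e]
    exact key
  · have e1 := velocity_chart x (hγ t ht).1 (hγ t ht).2.1
    have e2 := geodesic_speed hG hγ ht
    rw [hγ0, hw0, coordMetric_self, hv, coordMetric_apply, ← e1] at e2
    exact e2
  · have e1 := velocity_chart x (hγ 0 h00).1 (hγ 0 h00).2.1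
    have e3 := fderiv_comp_param (contMDiffAt_extChartAt_symm x (hγ 0 h00).1) hf (w 0)
    rw [← e1] at e3
    have e4 : fderiv ℝ (f ∘ (extChartAt I x).symm) (γ 0) (w 0) = 0 := by rw [hγ0, hw0, hfv]
    rw [e4] at e3
    rw [g.symm]
    exact (formAt_grad g f _ _).trans e3.symm

end Geodesics

/-! ### Smooth dependence of ODE solutions through the implicit function theorem on a space of
curves. -/

section SmoothDependence

universe u

variable {E F : Type u} [NormedAddCommGroup E] [NormedSpace ℝ E]
  [NormedAddCommGroup F] [NormedSpace ℝ F] {J : Type*} [TopologicalSpace J] [CompactSpace J]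

variable (E F J) in
/-- Pointwise application of a curve of linear maps to a curve. -/
def pointwiseApply : C(J, E →L[ℝ] F) →L[ℝ] C(J, E) →L[ℝ] C(J, F) :=
  LinearMap.mkContinuous₂
    (LinearMap.mk₂ ℝ (fun (A : C(J, E →L[ℝ] F)) (h : C(J, E)) =>
        (⟨fun t => A t (h t), A.continuous.clm_apply h.continuous⟩ : C(J, F)))
      (fun A B h => by ext t; simp) (fun c A h => by ext t; simp)
      (fun A h k => by ext t; simp) (fun c A h => by ext t; simp)) 1 (by
    intro A h
    rw [ContinuousMap.norm_le _ (by positivity)]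
    intro t
    simp only [LinearMap.mk₂_apply, ContinuousMap.coe_mk, one_mul]
    exact (A t).le_of_opNorm_le_of_le (A.norm_coe_le_norm t) (h.norm_coe_le_norm t))

lemma pointwiseApply_apply (A : C(J, E →L[ℝ] F)) (h : C(J, E)) (t : J) :
    pointwiseApply E F J A h t = A t (h t) := rfl

/-- The mean value inequality is applied at each time separately. It is uniform in time because all
the points involved lie in the ball of radius `‖γ‖ + 1`, which is compact, so `v'` is uniformly
continuous there. -/
lemma hasFDerivAt_continuousMap_comp [FiniteDimensional ℝ E] (v : C(E, F))
    (v' : C(E, E →L[ℝ] F)) (hv : ∀ x, HasFDerivAt v (v' x) x) (γ : C(J, E)) :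
    HasFDerivAt (fun γ : C(J, E) => v.comp γ) (pointwiseApply E F J (v'.comp γ)) γ := by
  rw [hasFDerivAt_iff_isLittleO_nhds_zero, Asymptotics.isLittleO_iff]
  intro ε hε
  have hu : UniformContinuousOn v' (Metric.closedBall 0 (‖γ‖ + 1)) :=
    (isCompact_closedBall 0 (‖γ‖ + 1)).uniformContinuousOn_of_continuous v'.continuous.continuousOn
  rw [Metric.uniformContinuousOn_iff] at hu
  obtain ⟨δ, hδ, hδ'⟩ := hu ε hε
  filter_upwards [Metric.ball_mem_nhds (0 : C(J, E)) (lt_min hδ one_pos)] with h hh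
  rw [mem_ball_zero_iff, lt_min_iff] at hh
  rw [ContinuousMap.norm_le _ (by positivity)]
  intro t
  have ht : ‖h t‖ ≤ ‖h‖ := h.norm_coe_le_norm t
  have hγt : ‖γ t‖ ≤ ‖γ‖ := γ.norm_coe_le_norm t
  have key := (convex_ball (γ t) (min δ 1)).norm_image_sub_le_of_norm_hasFDerivWithin_le'
    (f := v) (f' := v') (C := ε) (φ := v' (γ t)) (x := γ t) (y := γ t + h t)
    (fun x _ => (hv x).hasFDerivWithinAt) (fun x hx => by
      rw [Metric.mem_ball, lt_min_iff] at hx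
      rw [← dist_eq_norm]
      refine (hδ' x ?_ (γ t) ?_ hx.1).le
      · rw [mem_closedBall_zero_iff]
        calc ‖x‖ = ‖γ t + (x - γ t)‖ := by abel_nf
          _ ≤ ‖γ t‖ + ‖x - γ t‖ := norm_add_le _ _
          _ ≤ ‖γ‖ + 1 := add_le_add hγt (by rw [← dist_eq_norm]; exact hx.2.le)
      · rw [mem_closedBall_zero_iff]; linarith)
    (Metric.mem_ball_self (lt_min hδ one_pos))
    (by
      rw [Metric.mem_ball, dist_eq_norm, add_sub_cancel_left]
      exact lt_min (ht.trans_lt hh.1) (ht.trans_lt hh.2))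
  rw [add_sub_cancel_left] at key
  refine le_trans (le_of_eq ?_) (key.trans (mul_le_mul_of_nonneg_left ht hε.le))
  simp [pointwiseApply_apply]

/-- Induction on the order: the derivative is postcomposition with `v'` followed by the bounded
bilinear map `pointwiseApply`. The target changes from `F` to `E →L[ℝ] F`, hence the generalization
over `F` and the common universe. -/
lemma contDiff_continuousMap_comp [FiniteDimensional ℝ E] (n : ℕ) (v : C(E, F))
    (hv : ContDiff ℝ n v) : ContDiff ℝ n (fun γ : C(J, E) => v.comp γ) := by
  induction n generalizing F with
  | zero =>
    simp only [Nat.cast_zero, contDiff_zero]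
    exact ContinuousMap.continuous_postcomp v
  | succ n ih =>
    push_cast at hv ⊢
    obtain ⟨v', hv', hd⟩ := contDiff_succ_iff_hasFDerivAt.1 hv
    refine contDiff_succ_iff_hasFDerivAt.2
      ⟨fun γ => pointwiseApply E F J ((⟨v', hv'.continuous⟩ : C(E, E →L[ℝ] F)).comp γ), ?_,
        fun γ => hasFDerivAt_continuousMap_comp v ⟨v', hv'.continuous⟩ hd γ⟩
    exact (pointwiseApply E F J).contDiff.comp (ih ⟨v', hv'.continuous⟩ hv')

/-- The time interval on which the local flow is constructed. -/
abbrev FlowTime : Type := Set.Icc (-2 : ℝ) 2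

/-- The extension of a curve by constants. -/
def extendCurve (γ : C(FlowTime, E)) (r : ℝ) : E :=
  γ (Set.projIcc (-2) 2 (by norm_num) r)

lemma continuous_extendCurve (γ : C(FlowTime, E)) : Continuous (extendCurve γ) :=
  γ.continuous.comp continuous_projIcc

lemma hasDerivAt_integral_extendCurve [CompleteSpace E] (γ : C(FlowTime, E)) (τ : ℝ) :
    HasDerivAt (fun τ => ∫ r in (0 : ℝ)..τ, extendCurve γ r) (extendCurve γ τ) τ :=
  intervalIntegral.integral_hasDerivAt_right
    ((continuous_extendCurve γ).intervalIntegrable _ _)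
    ((continuous_extendCurve γ).stronglyMeasurableAtFilter _ _)
    (continuous_extendCurve γ).continuousAt

variable (E) in
/-- The primitive of a curve that vanishes at `0`. -/
def curvePrimitive [CompleteSpace E] : C(FlowTime, E) →L[ℝ] C(FlowTime, E) :=
  LinearMap.mkContinuous
    { toFun := fun γ => ⟨fun τ => ∫ r in (0 : ℝ)..τ, extendCurve γ r,
        (continuous_iff_continuousAt.2 fun τ =>
          (hasDerivAt_integral_extendCurve γ τ).continuousAt).comp continuous_subtype_val⟩
      map_add' := fun γ β => by
        ext τ
        simp only [ContinuousMap.coe_mk, ContinuousMap.add_apply]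
        rw [← intervalIntegral.integral_add ((continuous_extendCurve γ).intervalIntegrable _ _)
          ((continuous_extendCurve β).intervalIntegrable _ _)]
        rfl
      map_smul' := fun c γ => by
        ext τ
        simp only [ContinuousMap.coe_mk, ContinuousMap.smul_apply, RingHom.id_apply]
        rw [← intervalIntegral.integral_smul]
        rfl } 2 (by
    intro γ
    rw [ContinuousMap.norm_le _ (by positivity)]
    intro τ
    have h := intervalIntegral.norm_integral_le_of_norm_le_const (a := 0) (b := (τ : ℝ))
      (C := ‖γ‖) (f := extendCurve γ) (fun r _ => γ.norm_coe_le_norm _)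
    refine h.trans ?_
    rw [mul_comm]
    have : |(τ : ℝ) - 0| ≤ 2 := by rw [sub_zero, abs_le]; exact τ.2
    gcongr)

lemma curvePrimitive_apply [CompleteSpace E] (γ : C(FlowTime, E)) (τ : FlowTime) :
    curvePrimitive E γ τ = ∫ r in (0 : ℝ)..τ, extendCurve γ r := rfl

variable (E) in
/-- Constant curves. -/
def constCurve : E →L[ℝ] C(FlowTime, E) :=
  LinearMap.mkContinuous
    { toFun := fun x => ContinuousMap.const _ x
      map_add' := fun x y => rfl
      map_smul' := fun c x => rfl } 1 (by
    intro x
    rw [one_mul, ContinuousMap.norm_le _ (norm_nonneg x)]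
    intro t
    exact le_rfl)

lemma constCurve_apply (x : E) (t : FlowTime) : constCurve E x t = x := rfl

/-- Smooth dependence of the solutions of an autonomous ordinary differential equation on the time
scale and on the initial condition. -/
lemma exists_smooth_local_flow [FiniteDimensional ℝ E] {v : E → E} (hv : ContDiff ℝ ∞ v) (z : E)
    (n : ℕ) :
    ∃ Γ : ℝ × E → ℝ → E, ContDiffAt ℝ n (fun p => Γ p 1) (0, z) ∧
      (∀ᶠ p in 𝓝 ((0, z) : ℝ × E), Γ p 0 = p.2 ∧
        ∀ τ ∈ Set.Ioo (-2 : ℝ) 2, HasDerivAt (Γ p) (p.1 • v (Γ p τ)) τ) ∧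
      ∀ W ∈ 𝓝 z, ∀ᶠ p in 𝓝 ((0, z) : ℝ × E), ∀ τ, Γ p τ ∈ W := by
  have := FiniteDimensional.complete ℝ E
  set vc : C(E, E) := ⟨v, hv.continuous⟩ with hvc
  -- Zeros of `Fm` solve the integral equation `γ = x + c ∫ v ∘ γ`. The scale `c` replaces the time
  -- variable: near `c = 0` one fixed time interval serves all solutions.
  set Fm : (ℝ × E) × C(FlowTime, E) → C(FlowTime, E) := fun q =>
    q.2 - constCurve E q.1.2 - q.1.1 • curvePrimitive E (vc.comp q.2) with hFm
  set a : (ℝ × E) × C(FlowTime, E) := ((0, z), constCurve E z) with ha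
  have hN : ContDiff ℝ (n + 1 : ℕ) (fun γ : C(FlowTime, E) => vc.comp γ) :=
    contDiff_continuousMap_comp (n + 1) vc (hv.of_le (by exact_mod_cast le_top))
  have hF : ContDiff ℝ (n + 1 : ℕ) Fm :=
    (contDiff_snd.sub ((constCurve E).contDiff.comp (contDiff_snd.comp contDiff_fst))).sub
      ((contDiff_fst.comp contDiff_fst).smul
        ((curvePrimitive E).contDiff.comp (hN.comp contDiff_snd)))
  have hn : ((n + 1 : ℕ) : WithTop ℕ∞) ≠ 0 := by simp
  -- At `c = 0` the integral term disappears, so the partial derivative in the curve is the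
  -- identity.
  have hinr : fderiv ℝ Fm a ∘L ContinuousLinearMap.inr ℝ (ℝ × E) C(FlowTime, E) =
      ContinuousLinearMap.id ℝ _ := by
    have h1 : HasFDerivAt (fun γ : C(FlowTime, E) => (((0, z) : ℝ × E), γ))
        (ContinuousLinearMap.inr ℝ (ℝ × E) C(FlowTime, E)) (constCurve E z) :=
      hasFDerivAt_prodMk_right _ _
    have h2 := ((hF.differentiable hn).differentiableAt (x := a)).hasFDerivAt.comp
      (constCurve E z) h1
    have h3 : HasFDerivAt (fun γ : C(FlowTime, E) => γ - constCurve E z)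
        (ContinuousLinearMap.id ℝ _) (constCurve E z) :=
      (hasFDerivAt_id _).sub_const _
    refine h2.unique (h3.congr_of_eventuallyEq (Filter.Eventually.of_forall fun γ => ?_))
    simp [hFm]
  have hinv : (fderiv ℝ Fm a ∘L ContinuousLinearMap.inr ℝ (ℝ × E) C(FlowTime, E)).IsInvertible := by
    rw [hinr]
    exact ⟨ContinuousLinearEquiv.refl ℝ _, rfl⟩
  have hFa : Fm a = 0 := by simp [hFm, ha]
  set ψ := hF.contDiffAt.implicitFunction hn hinv with hψ
  have hψa : ψ (0, z) = constCurve E z := hF.contDiffAt.implicitFunction_apply_self hn hinv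
  have hψc : ContDiffAt ℝ (n + 1 : ℕ) ψ (0, z) :=
    hF.contDiffAt.contDiffAt_implicitFunction hn hinv
  have hev := hF.contDiffAt.eventually_apply_implicitFunction hn hinv
  rw [← hψ, hFa] at hev
  -- The value at `τ = 1` is the flow at time `c`. The point `1` lies in the interior of `[-2, 2]`,
  -- where the differential equation holds and uniqueness can later be invoked.
  refine ⟨fun p => extendCurve (ψ p), ?_, ?_, ?_⟩
  · exact (ContinuousMap.evalCLM ℝ
      (Set.projIcc (-2 : ℝ) 2 (by norm_num) 1)).contDiff.contDiffAt.comp (0, z)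
      (hψc.of_le (show (n : WithTop ℕ∞) ≤ (n + 1 : ℕ) by exact_mod_cast Nat.le_succ n))
  · filter_upwards [hev] with p hp
    have hval : ∀ τ ∈ Set.Icc (-2 : ℝ) 2, extendCurve (ψ p) τ =
        p.2 + p.1 • ∫ r in (0 : ℝ)..τ, v (extendCurve (ψ p) r) := by
      intro τ hτ
      have h := congrArg (fun γ : C(FlowTime, E) => γ ⟨τ, hτ⟩) hp
      simp only [hFm, ContinuousMap.sub_apply, ContinuousMap.smul_apply, constCurve_apply,
        curvePrimitive_apply, ContinuousMap.zero_apply] at h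
      rw [extendCurve, Set.projIcc_of_mem _ hτ]
      rw [sub_sub, sub_eq_zero] at h
      exact h
    refine ⟨?_, fun τ hτ => ?_⟩
    · rw [hval 0 (by constructor <;> norm_num)]
      simp
    · have h1 := ((hasDerivAt_integral_extendCurve (vc.comp (ψ p)) τ).const_smul p.1).const_add p.2
      refine h1.congr_of_eventuallyEq ?_
      filter_upwards [isOpen_Ioo.mem_nhds hτ] with r hr
      exact hval r (Set.Ioo_subset_Icc_self hr)
  · intro W hW
    obtain ⟨ε, hε, hεW⟩ := Metric.mem_nhds_iff.1 hW
    have h1 := hψc.continuousAt (Metric.ball_mem_nhds (ψ (0, z)) hε)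
    filter_upwards [h1] with p hp τ
    refine hεW ?_
    rw [Set.mem_preimage, hψa] at hp
    exact (ContinuousMap.dist_apply_le_dist (f := ψ p) (g := constCurve E z) _).trans_lt hp

/-- A function that is smooth near a point coincides near that point with a smooth function. -/
lemma exists_contDiff_eqOn_nhds [FiniteDimensional ℝ E] {v : E → F} {s : Set E} (hs : IsOpen s)
    (hv : ContDiffOn ℝ ∞ v s) {z : E} (hz : z ∈ s) :
    ∃ v' : E → F, ContDiff ℝ ∞ v' ∧ ∃ W ∈ 𝓝 z, W ⊆ s ∧ Set.EqOn v' v W := by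
  obtain ⟨ε, hε, hεs⟩ := Metric.isOpen_iff.1 hs z hz
  let b : ContDiffBump z := ⟨ε / 4, ε / 2, by positivity, by linarith⟩
  refine ⟨fun x => b x • v x, ?_, Metric.closedBall z (ε / 4),
    Metric.closedBall_mem_nhds z (by positivity),
    (Metric.closedBall_subset_ball (by linarith)).trans hεs, fun x hx => ?_⟩
  · rw [contDiff_iff_contDiffAt]
    intro x
    by_cases hx : x ∈ s
    · exact b.contDiff.contDiffAt.smul (hv.contDiffAt (hs.mem_nhds hx))
    · have h1 : (Metric.closedBall z (ε / 2))ᶜ ∈ 𝓝 x :=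
        Metric.isClosed_closedBall.isOpen_compl.mem_nhds fun h =>
          hx (hεs (Metric.closedBall_subset_ball (by linarith) h))
      refine (contDiffAt_const (c := (0 : F))).congr_of_eventuallyEq ?_
      filter_upwards [h1] with y hy
      rw [Set.mem_compl_iff, Metric.mem_closedBall, not_le] at hy
      rw [b.zero_of_le_dist hy.le, zero_smul]
  · change b x • v x = v x
    rw [b.one_of_mem_closedBall hx, one_smul]

end SmoothDependence

/-! ### Local flows of smooth vector fields. -/

section LocalFlow

variable {E : Type*} [NormedAddCommGroup E] [NormedSpace ℝ E] [FiniteDimensional ℝ E]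
  {H : Type*} [TopologicalSpace H] {I : ModelWithCorners ℝ E H} [I.Boundaryless]
  {M : Type*} [TopologicalSpace M] [ChartedSpace H M] [IsManifold I ∞ M]

/-- A vector field that is smooth in the preferred charts. -/
def IsSmoothField (V : ∀ x : M, TangentSpace I x) : Prop :=
  ∀ x : M, ∃ v : E → E, ContDiffOn ℝ ∞ v (extChartAt I x).target ∧
    ∀ z ∈ (extChartAt I x).target,
      paramDeriv I (extChartAt I x).symm z (v z) = V ((extChartAt I x).symm z)

lemma isSmoothField_grad (g : SmoothMetric I M) {f : M → ℝ} (hf : ContMDiff I 𝓘(ℝ, ℝ) ∞ f) :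
    IsSmoothField (I := I) (grad g f) := by
  intro x
  have hG := isMetricOn_coordMetric g x
  have hft : ContDiffOn ℝ ∞ (f ∘ (extChartAt I x).symm) (extChartAt I x).target :=
    (hf.comp_contMDiffOn (contMDiffOn_extChartAt_symm x)).contDiffOn
  refine ⟨fun z => (coordMetric g x z).inverse (fderiv ℝ (f ∘ (extChartAt I x).symm) z), ?_, ?_⟩
  · intro z hz
    obtain ⟨e, he⟩ := hG.exists_equiv hz
    have h1 : ContDiffAt ℝ ∞ (fun y => (coordMetric g x y).inverse) z := by
      refine ContDiffAt.comp z (g := ContinuousLinearMap.inverse) ?_ (hG.contDiffAt hz)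
      rw [← he]
      exact contDiffAt_map_inverse e
    have h2 : ContDiffAt ℝ ∞ (fderiv ℝ (f ∘ (extChartAt I x).symm)) z :=
      (hft.contDiffAt ((isOpen_extChartAt_target x).mem_nhds hz)).fderiv_right (by simp)
    exact (h1.clm_apply h2).contDiffWithinAt
  · intro z hz
    set φ := (extChartAt I x).symm with hφ
    set w := (coordMetric g x z).inverse (fderiv ℝ (f ∘ φ) z) with hw
    obtain ⟨e, he⟩ := exists_formAt_equiv g (φ z)
    refine e.injective ?_
    ext u
    obtain ⟨u, rfl⟩ := (paramDeriv_extChartAt_symm_bijective x hz).2 u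
    have h1 : formAt g.inner (φ z) (paramDeriv I φ z w) (paramDeriv I φ z u) =
        fderiv ℝ (f ∘ φ) z u := by
      rw [← coordMetric_apply, hw, hG.apply_inverse hz]
    have h2 : formAt g.inner (φ z) (grad g f (φ z)) (paramDeriv I φ z u) =
        fderiv ℝ (f ∘ φ) z u := by
      rw [fderiv_comp_param (contMDiffAt_extChartAt_symm x hz) hf]
      exact formAt_grad g f (φ z) _
    rw [← he] at h1 h2
    exact h1.trans h2.symm

lemma IsSmoothField.contMDiff {V : ∀ x : M, TangentSpace I x} (hV : IsSmoothField V) :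
    ContMDiff I I.tangent ∞ (fun x => (⟨x, V x⟩ : TangentBundle I M)) := by
  intro x
  obtain ⟨v, hv, hvV⟩ := hV x
  have hx : x ∈ (chartAt H x).source := mem_chart_source H x
  have hmem : (chartAt H x).source ∈ 𝓝 x := chart_source_mem_nhds H x
  have h1 := (trivializationAt E (TangentSpace I : M → Type _) x).contMDiffOn_symmL
    (IB := I) (n := ∞) (𝕜 := ℝ)
  have h2 : ContMDiffOn I (I.prod 𝓘(ℝ, E)) ∞ (fun m => Bundle.TotalSpace.mk' E m
      ((trivializationAt E (TangentSpace I) x).symmL ℝ m (v (extChartAt I x m))))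
      (chartAt H x).source := by
    refine (h1.clm_bundle_apply (F₁ := E) (E₁ := fun _ : M => E)
      (v := fun m => v (extChartAt I x m)) ?_).mono ?_
    · intro m hm
      have hm' : m ∈ (extChartAt I x).source := by
        rw [extChartAt_source]; simpa using hm
      refine ((Bundle.contMDiffAt_section (n := ∞) (s := fun m : M => v (extChartAt I x m))
        (E := Bundle.Trivial M E) (F := E) (IB := I) m).2 ?_).contMDiffWithinAt
      exact (hv.contDiffAt ((isOpen_extChartAt_target x).mem_nhds
        ((extChartAt I x).map_source hm'))).contMDiffAt.comp m
        (contMDiffAt_extChartAt' (by simpa using hm))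
    · intro m hm; simpa using hm
  refine (h2.contMDiffAt hmem).congr_of_eventuallyEq ?_
  filter_upwards [hmem] with m hm
  have hm' : m ∈ (extChartAt I x).source := by rwa [extChartAt_source]
  have hz := (extChartAt I x).map_source hm'
  have e := symmL_apply_eq (I := I) x hz (v (extChartAt I x m))
  have e2 := hvV _ hz
  rw [(extChartAt I x).left_inv hm'] at e e2
  exact congrArg (Bundle.TotalSpace.mk' E m) (e.trans e2).symm

lemma hasMFDerivAt_extChartAt_symm_comp {x : M} {γ : ℝ → E} {w X : E} {t : ℝ}
    (hz : γ t ∈ (extChartAt I x).target) (hγ : HasDerivAt γ w t)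
    (hX : paramDeriv I (extChartAt I x).symm (γ t) w = X) :
    HasMFDerivAt 𝓘(ℝ, ℝ) I (fun s => (extChartAt I x).symm (γ s)) t
      ((1 : ℝ →L[ℝ] ℝ).smulRight X) := by
  have h1 := (contMDiffAt_extChartAt_symm (I := I) x hz).mdifferentiableAt (by simp)
  have h2 := h1.hasMFDerivAt.comp t hγ.hasFDerivAt.hasMFDerivAt
  have e : (paramDeriv I (extChartAt I x).symm (γ t)).comp
      (ContinuousLinearMap.toSpanSingleton ℝ w) = (1 : ℝ →L[ℝ] ℝ).smulRight X := by
    refine ContinuousLinearMap.ext_ring ?_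
    rw [ContinuousLinearMap.comp_apply, ContinuousLinearMap.toSpanSingleton_apply, one_smul,
      ContinuousLinearMap.smulRight_apply, one_apply_eq_self, one_smul, hX]
  exact h2.congr_mfderiv e

/-- The coordinate field is replaced by a globally smooth one that agrees with it near the centre.
For small scales and nearby initial points the whole solution stays in the region of agreement. -/
lemma IsSmoothField.exists_local_flow {V : ∀ x : M, TangentSpace I x} (hV : IsSmoothField V)
    (x : M) (n : ℕ) :
    ∃ Γ : ℝ × M → ℝ → M, ContMDiffAt (𝓘(ℝ, ℝ).prod I) I n (fun p => Γ p 1) (0, x) ∧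
      ∀ᶠ p in 𝓝 ((0, x) : ℝ × M), Γ p 0 = p.2 ∧
        IsMIntegralCurveOn (Γ p) (p.1 • V) (Set.Ioo (-2) 2) := by
  obtain ⟨v, hv, hvV⟩ := hV x
  obtain ⟨v', hv', W, hW, hWs, hWv⟩ := exists_contDiff_eqOn_nhds (isOpen_extChartAt_target x) hv
    (mem_extChartAt_target x)
  obtain ⟨Γ, hΓ, hΓ1, hΓ2⟩ := exists_smooth_local_flow hv' (extChartAt I x x) n
  have hc : ContMDiffAt (𝓘(ℝ, ℝ).prod I) (𝓘(ℝ, ℝ × E)) n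
      (fun p : ℝ × M => (p.1, extChartAt I x p.2)) (0, x) := by
    exact contMDiffAt_fst.prodMk_space ((contMDiffAt_extChartAt (I := I) (n := n)).comp (0, x) contMDiffAt_snd)
  have hcc : Filter.Tendsto (fun p : ℝ × M => (p.1, extChartAt I x p.2)) (𝓝 (0, x))
      (𝓝 (0, extChartAt I x x)) := hc.continuousAt
  have hΓx : Γ (0, extChartAt I x x) 1 ∈ (extChartAt I x).target :=
    hWs ((hΓ2 W hW).self_of_nhds 1)
  refine ⟨fun p τ => (extChartAt I x).symm (Γ (p.1, extChartAt I x p.2) τ), ?_, ?_⟩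
  · have h1 : ContMDiffAt 𝓘(ℝ, E) I n (extChartAt I x).symm (Γ (0, extChartAt I x x) 1) :=
      (contMDiffAt_extChartAt_symm x hΓx).of_le (by exact_mod_cast le_top)
    exact h1.comp (0, x) (hΓ.contMDiffAt.comp (0, x) hc)
  · filter_upwards [hcc.eventually hΓ1, hcc.eventually (hΓ2 W hW),
      continuousAt_snd.preimage_mem_nhds (extChartAt_source_mem_nhds (I := I) x)]
      with p hp1 hp2 hp3
    refine ⟨?_, fun τ hτ => ?_⟩
    · rw [hp1.1]
      exact (extChartAt I x).left_inv hp3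
    · have hz := hWs (hp2 τ)
      refine (hasMFDerivAt_extChartAt_symm_comp hz (hp1.2 τ hτ) ?_).hasMFDerivWithinAt
      rw [map_smul, hWv (hp2 τ), hvV _ hz]
      rfl

/-- A solution for the field `(δ / 2) • V` on `(-2, 2)` becomes, after rescaling time, a solution
for `V` on `(-δ, δ)`, with `δ` independent of the initial point. -/
lemma IsSmoothField.exists_uniform_time {V : ∀ x : M, TangentSpace I x} (hV : IsSmoothField V)
    (x : M) : ∃ W ∈ 𝓝 x, ∃ ε > 0, ∀ y ∈ W, ∃ γ : ℝ → M, γ 0 = y ∧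
      IsMIntegralCurveOn γ V (Set.Ioo (-ε) ε) := by
  obtain ⟨Γ, -, h⟩ := hV.exists_local_flow x 0
  rw [nhds_prod_eq, Filter.eventually_prod_iff] at h
  obtain ⟨p, hp, q, hq, h⟩ := h
  obtain ⟨δ, hδ, hδp⟩ := Metric.eventually_nhds_iff.1 hp
  have hδ2 : p (δ / 2) := hδp (by rw [dist_zero_right, Real.norm_eq_abs, abs_of_pos (by positivity)]; linarith)
  refine ⟨{y | q y}, hq, δ / 2, by positivity, fun y hy => ?_⟩
  obtain ⟨h0, h1⟩ := h hδ2 hy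
  have h2 := h1.comp_mul (δ / 2)⁻¹
  have hne : δ / 2 ≠ 0 := by positivity
  rw [smul_smul, inv_mul_cancel₀ hne, one_smul] at h2
  refine ⟨_, ?_, h2.mono fun t ht => ?_⟩
  · simpa using h0
  · rw [Set.mem_ofPred_eq, ← div_eq_mul_inv, Set.mem_Ioo, lt_div_iff₀ (by positivity),
      div_lt_iff₀ (by positivity)]
    constructor <;> linarith [ht.1, ht.2]

end LocalFlow

/-! ### The Riemannian distance: topology and lengths of unit speed curves. -/

section Distance

variable {E : Type*} [NormedAddCommGroup E] [NormedSpace ℝ E]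
  {H : Type*} [TopologicalSpace H] {I : ModelWithCorners ℝ E H}
  {M : Type*} [TopologicalSpace M] [ChartedSpace H M] [IsManifold I ∞ M]

open scoped Bundle in
lemma rdist_comm (g : SmoothMetric I M) (x y : M) : rdist g x y = rdist g y x := by
  let : Bundle.RiemannianBundle (fun x : M => TangentSpace I x) := ⟨g.toRiemannianMetric⟩
  exact Manifold.riemannianEDist_comm

open scoped Bundle in
lemma exists_rdist_lt_subset [RegularSpace M] (g : SmoothMetric I M) {x : M} {s : Set M}
    (hs : s ∈ 𝓝 x) : ∃ c > 0, {y | rdist g x y < c} ⊆ s := by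
  let : Bundle.RiemannianBundle (fun x : M => TangentSpace I x) := ⟨g.toRiemannianMetric⟩
  have : IsManifold I 1 M := .of_le (n := ∞) (by simp)
  have : IsContinuousRiemannianBundle E (fun x : M => TangentSpace I x) :=
    ⟨⟨g.inner, g.contMDiff.continuous, fun b v w => rfl⟩⟩
  exact setOfPred_riemannianEDist_lt_subset_nhds' I hs

open scoped Bundle in
lemma rdist_le_of_velocity (g : SmoothMetric I M) {γ : ℝ → M} {a b : ℝ} (hab : a ≤ b)
    (hγ : ContMDiffOn 𝓘(ℝ, ℝ) I 1 γ (Set.Icc a b))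
    (h : ∀ t ∈ Set.Ioo a b, g.inner (γ t) (velocity I γ t) (velocity I γ t) = 1) :
    rdist g (γ a) (γ b) ≤ ENNReal.ofReal (b - a) := by
  let : Bundle.RiemannianBundle (fun x : M => TangentSpace I x) := ⟨g.toRiemannianMetric⟩
  refine (Manifold.riemannianEDist_le_pathELength hγ rfl rfl hab).trans ?_
  rw [Manifold.pathELength_eq_lintegral_mfderiv_Ioo]
  have key : ∀ t ∈ Set.Ioo a b, ‖velocity I γ t‖ₑ = 1 := by
    intro t ht
    have h1 : ‖velocity I γ t‖ ^ 2 = 1 := by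
      rw [← real_inner_self_eq_norm_sq]
      exact h t ht
    have h2 : ‖velocity I γ t‖ = 1 := by
      have := norm_nonneg (velocity I γ t)
      nlinarith
    rw [← ofReal_norm, h2, ENNReal.ofReal_one]
  refine (MeasureTheory.setLIntegral_congr_fun (g := fun _ => 1) measurableSet_Ioo key).trans_le ?_
  simp

end Distance

/-! ### Unit fields on complete manifolds have global integral curves. -/

section Completeness

variable {E : Type*} [NormedAddCommGroup E] [NormedSpace ℝ E] [FiniteDimensional ℝ E]
  {H : Type*} [TopologicalSpace H] {I : ModelWithCorners ℝ E H} [I.Boundaryless]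
  {M : Type*} [TopologicalSpace M] [ChartedSpace H M] [IsManifold I ∞ M]

lemma mfderiv_extChartAt_paramDeriv (x : M) {z : E} (hz : z ∈ (extChartAt I x).target) (w : E) :
    (mfderiv I 𝓘(ℝ, E) (extChartAt I x) ((extChartAt I x).symm z) :
      E →L[ℝ] E) (paramDeriv I (extChartAt I x).symm z w) = w := by
  have h1 := (contMDiffAt_extChartAt_symm (I := I) x hz).mdifferentiableAt (by simp)
  have h2 : MDifferentiableAt I 𝓘(ℝ, E) (extChartAt I x) ((extChartAt I x).symm z) :=
    mdifferentiableAt_extChartAt (by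
      rw [← extChartAt_source I]; exact (extChartAt I x).map_target hz)
  have h3 := mfderiv_comp z h2 h1
  have h4 : (extChartAt I x) ∘ (extChartAt I x).symm =ᶠ[𝓝 z] id := by
    filter_upwards [(isOpen_extChartAt_target x).mem_nhds hz] with y hy
    exact (extChartAt I x).right_inv hy
  rw [h4.mfderiv_eq, mfderiv_id] at h3
  exact (congrArg (fun L : E →L[ℝ] E => L w) h3).symm

/-- In a chart the derivative of the curve is `v` along the curve, hence continuous. Continuous
differentiability is needed because the distance is an infimum over `C¹` paths. -/
lemma contMDiffAt_of_isMIntegralCurveAt {V : ∀ x : M, TangentSpace I x} (hV : IsSmoothField V)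
    {γ : ℝ → M} {t : ℝ} (hγ : IsMIntegralCurveAt γ V t) : ContMDiffAt 𝓘(ℝ, ℝ) I 1 γ t := by
  obtain ⟨v, hv, hvV⟩ := hV (γ t)
  set c : ℝ → E := fun s => extChartAt I (γ t) (γ s) with hc
  have h1 : ∀ᶠ s in 𝓝 t, γ s ∈ (extChartAt I (γ t)).source :=
    hγ.continuousAt.preimage_mem_nhds (extChartAt_source_mem_nhds (γ t))
  have h2 : ∀ᶠ s in 𝓝 t, γ s ∈ (extChartAt I (γ t)).source ∧ HasDerivAt c (v (c s)) s := by
    filter_upwards [h1, hγ] with s hs hd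
    refine ⟨hs, ?_⟩
    have h3 : MDifferentiableAt I 𝓘(ℝ, E) (extChartAt I (γ t)) (γ s) :=
      mdifferentiableAt_extChartAt (by rwa [← extChartAt_source I])
    have h4 : HasFDerivAt c
        ((mfderiv I 𝓘(ℝ, E) (extChartAt I (γ t)) (γ s) : E →L[ℝ] E).comp
          ((1 : ℝ →L[ℝ] ℝ).smulRight (V (γ s) : E) : ℝ →L[ℝ] E)) s :=
      (h3.hasMFDerivAt.comp s hd).hasFDerivAt
    have hz := (extChartAt I (γ t)).map_source hs
    have e1 := mfderiv_extChartAt_paramDeriv (γ t) hz (v (c s))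
    rw [hvV _ hz, (extChartAt I (γ t)).left_inv hs] at e1
    rw [hasDerivAt_iff_hasFDerivAt]
    refine h4.congr_fderiv (ContinuousLinearMap.ext_ring (Eq.trans ?_
      (e1.trans (one_smul ℝ (v (c s))).symm)))
    refine congrArg (mfderiv I 𝓘(ℝ, E) (extChartAt I (γ t)) (γ s)) ?_
    exact one_smul ℝ (V (γ s))
  obtain ⟨s, hs, hso, hst⟩ := eventually_nhds_iff.1 h2
  have h6 : ContDiffOn ℝ 1 c s := by
    have hd : DifferentiableOn ℝ c s := fun r hr =>
      (hs r hr).2.differentiableAt.differentiableWithinAt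
    rw [show (1 : WithTop ℕ∞) = 0 + 1 by simp, contDiffOn_succ_iff_deriv_of_isOpen hso]
    refine ⟨hd, by simp, ?_⟩
    rw [contDiffOn_zero]
    have h7 : ContinuousOn (fun r => v (c r)) s :=
      hv.continuousOn.comp hd.continuousOn fun r hr => (extChartAt I (γ t)).map_source (hs r hr).1
    exact h7.congr fun r hr => (hs r hr).2.deriv
  have h8 : ContMDiffAt 𝓘(ℝ, ℝ) I 1 (fun r => (extChartAt I (γ t)).symm (c r)) t :=
    ((contMDiffAt_extChartAt_symm (γ t) ((extChartAt I (γ t)).map_source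
      (hs t hst).1)).of_le (by exact ENat.LEInfty.out)).comp t (h6.contDiffAt (hso.mem_nhds hst)).contMDiffAt
  refine h8.congr_of_eventuallyEq ?_
  filter_upwards [h1] with r hr
  exact ((extChartAt I (γ t)).left_inv hr).symm

lemma velocity_of_isMIntegralCurveAt {V : ∀ x : M, TangentSpace I x}
    {γ : ℝ → M} {t : ℝ} (hγ : IsMIntegralCurveAt γ V t) : velocity I γ t = V (γ t) := by
  rw [velocity, hγ.hasMFDerivAt.mfderiv]
  exact one_smul ℝ (V (γ t))

lemma rdist_le_of_isMIntegralCurveOn (g : SmoothMetric I M) {V : ∀ x : M, TangentSpace I x}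
    (hV : IsSmoothField V) (h1 : ∀ x, g.inner x (V x) (V x) = 1) {γ : ℝ → M} {a b s t : ℝ}
    (hγ : IsMIntegralCurveOn γ V (Set.Ioo a b)) (hs : s ∈ Set.Ioo a b) (ht : t ∈ Set.Ioo a b) :
    rdist g (γ s) (γ t) ≤ ENNReal.ofReal |s - t| := by
  have hγ' : ∀ r ∈ Set.Ioo a b, IsMIntegralCurveAt γ V r := fun r hr =>
    hγ.isMIntegralCurveAt (isOpen_Ioo.mem_nhds hr)
  have key : ∀ s t, s ∈ Set.Ioo a b → t ∈ Set.Ioo a b → s ≤ t →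
      rdist g (γ s) (γ t) ≤ ENNReal.ofReal |s - t| := by
    intro s t hs ht hst
    have hsub : Set.Icc s t ⊆ Set.Ioo a b := fun r hr =>
      ⟨hs.1.trans_le hr.1, hr.2.trans_lt ht.2⟩
    rw [abs_sub_comm, abs_of_nonneg (by linarith)]
    refine rdist_le_of_velocity g hst (fun r hr =>
      (contMDiffAt_of_isMIntegralCurveAt hV (hγ' r (hsub hr))).contMDiffWithinAt) fun r hr => ?_
    rw [velocity_of_isMIntegralCurveAt (hγ' r (hsub (Set.Ioo_subset_Icc_self hr))), h1]
  rcases le_total s t with h | h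
  · exact key s t hs ht h
  · rw [rdist_comm, abs_sub_comm]
    exact key t s ht hs h

variable [T2Space M]

/-- An integral curve is global if its maximal time of existence is bounded below along the bounded
parts of the curve. -/
lemma exists_isMIntegralCurve_of_local_uniform_time {V : ∀ x : M, TangentSpace I x}
    (hV : ContMDiff I I.tangent 1 (fun x => (⟨x, V x⟩ : TangentBundle I M))) {x : M}
    (h : ∀ R, ∃ ε > 0, ∀ (γ : ℝ → M) (a : ℝ), a ≤ R → γ 0 = x →
      IsMIntegralCurveOn γ V (Set.Ioo (-a) a) → ∀ t ∈ Set.Ioo (-a) a,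
        ∃ β : ℝ → M, β 0 = γ t ∧ IsMIntegralCurveOn β V (Set.Ioo (-ε) ε)) :
    ∃ γ : ℝ → M, γ 0 = x ∧ IsMIntegralCurve γ V := by
  have : IsManifold I 1 M := .of_le (n := ∞) (by simp)
  have := FiniteDimensional.complete ℝ E
  obtain ⟨γ₀, hγ₀, hγ₀'⟩ := exists_isMIntegralCurveAt_of_contMDiffAt_boundaryless 0 (hV x)
  obtain ⟨ε₀, hε₀, hγ₀'⟩ := isMIntegralCurveAt_iff'.1 hγ₀'
  rw [Real.ball_eq_Ioo, zero_sub, zero_add] at hγ₀'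
  let s := {a | ∃ γ, γ 0 = x ∧ IsMIntegralCurveOn γ V (Set.Ioo (-a) a)}
  have hε₀s : ε₀ ∈ s := ⟨γ₀, hγ₀, hγ₀'⟩
  by_cases hbdd : BddAbove s
  swap
  · rw [not_bddAbove_iff] at hbdd
    rw [exists_isMIntegralCurve_iff_exists_isMIntegralCurveOn_Ioo hV]
    intro a
    obtain ⟨y, ⟨γ, hγ1, hγ2⟩, hlt⟩ := hbdd a
    exact ⟨γ, hγ1, hγ2.mono <| Set.Ioo_subset_Ioo (neg_le_neg hlt.le) hlt.le⟩
  exfalso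
  set b := sSup s with hb
  have hb0 : 0 < b := hε₀.trans_le (le_csSup hbdd hε₀s)
  obtain ⟨ε', hε', h⟩ := h b
  -- Capping by `b` makes `b - ε / 2` positive, so the two gluing times `±(b - ε / 2)` lie on either
  -- side of `0`. The glued curve lives on `(-(b + ε / 2), b + ε / 2)`, contradicting the supremum.
  set ε := min ε' b with hεdef
  have hε : 0 < ε := lt_min hε' hb0
  have hεb : ε ≤ b := min_le_right _ _
  obtain ⟨a, ha, hlt⟩ := Real.add_neg_lt_sSup (⟨ε₀, hε₀s⟩ : s.Nonempty) (ε := -(ε / 2))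
    (by linarith)
  rw [← hb, ← sub_eq_add_neg] at hlt
  have hab : a ≤ b := le_csSup hbdd ha
  obtain ⟨γ, h0, hγ⟩ := ha
  have h' : ∀ t ∈ Set.Ioo (-a) a, ∃ β : ℝ → M, β t = γ t ∧
      IsMIntegralCurveOn β V (Set.Ioo (t - ε) (t + ε)) := by
    intro t ht
    obtain ⟨β, hβ, hβ'⟩ := h γ a hab h0 hγ t ht
    refine ⟨β ∘ (· - t), by simp [hβ], ?_⟩
    refine (isMIntegralCurveOn_comp_sub.2 hβ').mono fun r hr => ?_
    have := min_le_left ε' b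
    exact ⟨by linarith [hr.1], by linarith [hr.2]⟩
  obtain ⟨γ₁, heq1, hγ1⟩ := h' (-(b - ε / 2)) ⟨by linarith, by linarith⟩
  obtain ⟨γ₂, heq2, hγ2⟩ := h' (b - ε / 2) ⟨by linarith, by linarith⟩
  classical
  set γ_ext : ℝ → M := Set.piecewise (Set.Ioo (-(b + ε / 2)) a)
    (Set.piecewise (Set.Ioo (-a) a) γ γ₁) γ₂ with hext
  have hext0 : γ_ext 0 = x := by
    rw [hext, Set.piecewise, if_pos ⟨by linarith, by linarith⟩, Set.piecewise,
      if_pos ⟨by linarith, by linarith⟩, h0]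
  suffices hh : IsMIntegralCurveOn γ_ext V (Set.Ioo (-(b + ε / 2)) (b + ε / 2)) from
    (not_lt.mpr <| le_csSup hbdd ⟨γ_ext, hext0, hh⟩) (by linarith)
  apply (isMIntegralCurveOn_piecewise (t₀ := b - ε / 2) hV _ hγ2
      ⟨⟨by linarith, hlt⟩, ⟨by linarith, by linarith⟩⟩
      (by rw [Set.piecewise, if_pos ⟨by linarith, hlt⟩, ← heq2])).mono
    (Set.Ioo_subset_Ioo_union_Ioo le_rfl (by linarith) (by linarith))
  exact (isMIntegralCurveOn_piecewise (t₀ := -(b - ε / 2)) hV hγ hγ1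
      ⟨⟨by linarith, by linarith⟩, ⟨by linarith, by linarith⟩⟩ heq1.symm).mono
    (Set.union_comm _ _ ▸ Set.Ioo_subset_Ioo_union_Ioo (by linarith) (by linarith) le_rfl)

/-- A smooth unit vector field on a complete Riemannian manifold is complete. -/
lemma exists_isMIntegralCurve_of_complete (g : SmoothMetric I M) (hg : IsCompleteMetric g)
    {V : ∀ x : M, TangentSpace I x} (hV : IsSmoothField V)
    (h1 : ∀ x, g.inner x (V x) (V x) = 1) (x : M) :
    ∃ γ : ℝ → M, γ 0 = x ∧ IsMIntegralCurve γ V := by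
  have : IsManifold I 1 M := .of_le (n := ∞) (by simp)
  have hV1 : ContMDiff I I.tangent 1 (fun x => (⟨x, V x⟩ : TangentBundle I M)) :=
    hV.contMDiff.of_le ENat.LEInfty.out
  have : LocallyCompactSpace M := Manifold.locallyCompact_of_finiteDimensional I
  refine exists_isMIntegralCurve_of_local_uniform_time hV1 fun R => ?_
  -- Otherwise there are integral curves on `(-a k, a k)` with `a k ≤ R` and times `t k` at which
  -- continuation for time `1 / (k + 1)` is impossible.
  by_contra! hcon
  have hpos : ∀ k : ℕ, (0 : ℝ) < 1 / (k + 1) := fun k => by positivity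
  choose γ a ha hγ0 hγ t ht hbad using fun k : ℕ => hcon _ (hpos k)
  have htR : ∀ k, t k ∈ Set.Icc (-R) R := fun k =>
    ⟨by linarith [(ht k).1, ha k], by linarith [(ht k).2, ha k]⟩
  obtain ⟨τ, -, φ, hφ, hlim⟩ := isCompact_Icc.tendsto_subseq htR
  -- By uniqueness all these curves are restrictions of the longer ones, so unit speed bounds the
  -- distance by the time difference. Along a convergent subsequence of times the points are
  -- therefore Cauchy.
  have hdist : ∀ k l, rdist g (γ k (t k)) (γ l (t l)) ≤ ENNReal.ofReal |t k - t l| := by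
    have key : ∀ k l, a k ≤ a l →
        rdist g (γ k (t k)) (γ l (t l)) ≤ ENNReal.ofReal |t k - t l| := by
      intro k l hkl
      have hsub : Set.Ioo (-(a k)) (a k) ⊆ Set.Ioo (-(a l)) (a l) :=
        Set.Ioo_subset_Ioo (by linarith) hkl
      have h0 : (0 : ℝ) ∈ Set.Ioo (-(a k)) (a k) :=
        ⟨by linarith [(ht k).1, (ht k).2], by linarith [(ht k).1, (ht k).2]⟩
      have e := isMIntegralCurveOn_Ioo_eqOn_of_contMDiff_boundaryless h0 hV1 (hγ k)
        ((hγ l).mono hsub) ((hγ0 k).trans (hγ0 l).symm)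
      rw [e (ht k)]
      exact rdist_le_of_isMIntegralCurveOn g hV h1 (hγ l) (hsub (ht k)) (ht l)
    intro k l
    rcases le_total (a k) (a l) with h | h
    · exact key k l h
    · rw [rdist_comm, abs_sub_comm]
      exact key l k h
  obtain ⟨y, hy⟩ := hg (fun k => γ (φ k) (t (φ k))) (by
    intro ε hε
    obtain ⟨δ, hδ, hδε⟩ : ∃ δ : ℝ, 0 < δ ∧ ENNReal.ofReal δ ≤ ε := by
      rcases eq_or_ne ε ∞ with rfl | hne
      · exact ⟨1, one_pos, le_top⟩
      · exact ⟨ε.toReal, ENNReal.toReal_pos hε.ne' hne, (ENNReal.ofReal_toReal hne).le⟩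
    obtain ⟨k, hk⟩ := Metric.cauchySeq_iff.1 hlim.cauchySeq δ hδ
    refine ⟨k, fun m hm n hn => (hdist _ _).trans_lt (lt_of_lt_of_le ?_ hδε)⟩
    exact (ENNReal.ofReal_lt_ofReal_iff hδ).2 (hk m hm n hn))
  -- Near the limit point the existence time is uniformly positive, against the choice of the
  -- points.
  obtain ⟨W, hW, ε, hε, hWε⟩ := hV.exists_uniform_time y
  obtain ⟨c, hc, hcW⟩ := exists_rdist_lt_subset g hW
  have h2 : ∀ᶠ k in Filter.atTop, rdist g (γ (φ k) (t (φ k))) y < c := hy.eventually_lt_const hc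
  have h3 : ∀ᶠ k : ℕ in Filter.atTop, 1 / ((φ k : ℝ) + 1) < ε :=
    (tendsto_one_div_add_atTop_nhds_zero_nat.comp hφ.tendsto_atTop).eventually_lt_const hε
  obtain ⟨k, hk2, hk3⟩ := (h2.and h3).exists
  rw [rdist_comm] at hk2
  obtain ⟨β, hβ0, hβ⟩ := hWε _ (hcW hk2)
  exact hbad (φ k) β hβ0 (hβ.mono (Set.Ioo_subset_Ioo (by linarith) hk3.le))

end Completeness

/-! ### Smoothness of the global flow. -/

section GlobalFlow

variable {E : Type*} [NormedAddCommGroup E] [NormedSpace ℝ E] [FiniteDimensional ℝ E]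
  {H : Type*} [TopologicalSpace H] {I : ModelWithCorners ℝ E H} [I.Boundaryless]
  {M : Type*} [TopologicalSpace M] [ChartedSpace H M] [IsManifold I ∞ M]

lemma IsSmoothField.const_smul {V : ∀ x : M, TangentSpace I x} (hV : IsSmoothField V) (c : ℝ) :
    IsSmoothField (c • V) := by
  intro x
  obtain ⟨v, hv, hvV⟩ := hV x
  refine ⟨fun z => c • v z, hv.const_smul c, fun z hz => ?_⟩
  rw [map_smul, hvV z hz]
  rfl

variable [T2Space M]

/-- A smooth vector field that is complete has a smooth flow. -/
lemma IsSmoothField.exists_flow {V : ∀ x : M, TangentSpace I x} (hV : IsSmoothField V)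
    (hex : ∀ x, ∃ γ : ℝ → M, γ 0 = x ∧ IsMIntegralCurve γ V) :
    ∃ φ : ℝ × M → M, ContMDiff (𝓘(ℝ, ℝ).prod I) I ∞ φ ∧ (∀ x, φ (0, x) = x) ∧
      (∀ s t x, φ (s + t, x) = φ (s, φ (t, x))) ∧
      ∀ x, IsMIntegralCurve (fun t => φ (t, x)) V := by
  have : IsManifold I 1 M := .of_le (n := ∞) (by simp)
  have hV1 : ∀ c : ℝ, ContMDiff I I.tangent 1
      (fun x => (⟨x, (c • V) x⟩ : TangentBundle I M)) := fun c =>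
    (hV.const_smul c).contMDiff.of_le ENat.LEInfty.out
  have hV1' : ContMDiff I I.tangent 1 (fun x => (⟨x, V x⟩ : TangentBundle I M)) :=
    hV.contMDiff.of_le ENat.LEInfty.out
  choose γ hγ0 hγ using hex
  set φ : ℝ × M → M := fun p => γ p.2 p.1 with hφ
  have h0 : ∀ x, φ (0, x) = x := hγ0
  have hadd : ∀ s t x, φ (s + t, x) = φ (s, φ (t, x)) := by
    intro s t x
    have := isMIntegralCurve_Ioo_eq_of_contMDiff_boundaryless (t₀ := 0) hV1'
      ((hγ x).comp_add t) (hγ (φ (t, x))) (by simp [hγ0, hφ])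
    exact congrFun this s
  have hcurve : ∀ x, IsMIntegralCurve (fun t => φ (t, x)) V := hγ
  refine ⟨φ, ?_, h0, hadd, hcurve⟩
  rw [contMDiff_infty]
  intro n
  -- At time `0`: by uniqueness the flow at time `c` equals the value at `τ = 1` of the rescaled
  -- local solution, which is smooth in `(c, x)`.
  have hloc : ∀ x, ContMDiffAt (𝓘(ℝ, ℝ).prod I) I n φ (0, x) := by
    intro x
    obtain ⟨Γ, hΓ, h⟩ := hV.exists_local_flow x n
    refine hΓ.congr_of_eventuallyEq ?_
    filter_upwards [h] with p hp
    have h1 : IsMIntegralCurveOn ((fun t => φ (t, p.2)) ∘ (· * p.1)) (p.1 • V)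
        (Set.Ioo (-2) 2) := ((hcurve p.2).comp_mul p.1).isMIntegralCurveOn _
    have h2 := isMIntegralCurveOn_Ioo_eqOn_of_contMDiff_boundaryless (t₀ := 0)
      ⟨by norm_num, by norm_num⟩ (hV1 p.1) h1 hp.2 (by simp [hp.1, h0])
    have h3 := h2 (show (1 : ℝ) ∈ Set.Ioo (-2) 2 from ⟨by norm_num, by norm_num⟩)
    simpa using h3
  rintro ⟨t, x⟩
  set T : Set ℝ := {t | ContMDiffAt (𝓘(ℝ, ℝ).prod I) I n φ (t, x)} with hT
  -- By the group law `φ (t, y) = φ (t - s, φ (s, y))`. The first factor is smooth when `t - s` is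
  -- small and `φ (s, x)` is near `φ (t₀, x)`, so smoothness at one time in `U` spreads to all of
  -- `U`. This makes `T` both open and closed.
  have key : ∀ t₀, ∃ U ∈ 𝓝 t₀, ∀ s ∈ U, ∀ t ∈ U, s ∈ T → t ∈ T := by
    intro t₀
    have hn : IsManifold I (n : WithTop ℕ∞) M := .of_le (n := ∞) (by exact_mod_cast le_top)
    have hev := (contMDiffAt_iff_contMDiffAt_nhds (by simp)).1 (hloc (φ (t₀, x)))
    rw [nhds_prod_eq, Filter.eventually_prod_iff] at hev
    obtain ⟨P, hP, Q, hQ, hPQ⟩ := hev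
    obtain ⟨ε, hε, hεP⟩ := Metric.eventually_nhds_iff.1 hP
    have hQ' := (hcurve x).continuous.continuousAt.eventually hQ
    refine ⟨_, Filter.inter_mem (Metric.ball_mem_nhds t₀ (half_pos hε)) hQ', ?_⟩
    intro s hs t ht hsT
    have hst : P (t - s) := by
      refine hεP ?_
      rw [dist_zero_right, ← dist_eq_norm]
      have h1 := Metric.mem_ball.1 hs.1
      have h2 := Metric.mem_ball.1 ht.1
      have h3 := dist_triangle_right t s t₀
      linarith
    have h1 : ContMDiffAt (𝓘(ℝ, ℝ).prod I) I n φ (t - s, φ (s, x)) := hPQ hst hs.2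
    have h2 : ContMDiffAt I I n (fun y => φ (s, y)) x :=
      ContMDiffAt.comp (f := fun y => (s, y)) x hsT (contMDiffAt_const.prodMk contMDiffAt_id)
    have h3 : ContMDiffAt (𝓘(ℝ, ℝ).prod I) (𝓘(ℝ, ℝ).prod I) n
        (fun p : ℝ × M => (p.1 - s, φ (s, p.2))) (t, x) :=
      ContMDiffAt.prodMk
        ((contDiff_id.sub contDiff_const).contMDiff.contMDiffAt.comp (t, x) contMDiffAt_fst)
        (ContMDiffAt.comp (g := fun y => φ (s, y)) (t, x) h2 contMDiffAt_snd)
    have h4 := ContMDiffAt.comp (g := φ) (t, x) h1 h3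
    refine h4.congr_of_eventuallyEq (Filter.Eventually.of_forall fun p => ?_)
    simp only [Function.comp_apply]
    rw [← hadd, sub_add_cancel]
  have hclopen : IsClopen T := by
    constructor
    · rw [← isOpen_compl_iff, isOpen_iff_mem_nhds]
      intro t₀ ht₀
      obtain ⟨U, hU, h⟩ := key t₀
      filter_upwards [hU] with s hs hsT
      exact ht₀ (h s hs t₀ (mem_of_mem_nhds hU) hsT)
    · rw [isOpen_iff_mem_nhds]
      intro t₀ ht₀
      obtain ⟨U, hU, h⟩ := key t₀
      filter_upwards [hU] with s hs
      exact h t₀ (mem_of_mem_nhds hU) s hs ht₀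
  have huniv : T = Set.univ := hclopen.eq_univ ⟨0, hloc x⟩
  have ht : t ∈ T := by
    rw [huniv]
    exact Set.mem_univ t
  exact ht

/-- A function whose gradient is a unit vector field grows with unit speed along the integral
curves of the gradient. -/
lemma apply_integralCurve_grad (g : SmoothMetric I M) {f : M → ℝ}
    (hf : ContMDiff I 𝓘(ℝ, ℝ) ∞ f) (h1 : ∀ x, g.inner x (grad g f x) (grad g f x) = 1)
    {γ : ℝ → M} (hγ : IsMIntegralCurve γ (grad g f)) (t : ℝ) : f (γ t) = f (γ 0) + t := by
  have hd : ∀ t, HasDerivAt (fun t => f (γ t) - t) 0 t := by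
    intro t
    have h2 : HasFDerivAt (fun t => f (γ t)) ((mfderiv I 𝓘(ℝ, ℝ) f (γ t) : E →L[ℝ] ℝ).comp
        ((1 : ℝ →L[ℝ] ℝ).smulRight (grad g f (γ t) : E))) t :=
      ((((hf (γ t)).mdifferentiableAt (by simp)).hasMFDerivAt).comp t (hγ t)).hasFDerivAt
    have h3 : HasDerivAt (fun t => f (γ t)) 1 t := by
      rw [hasDerivAt_iff_hasFDerivAt]
      have h4 := (formAt_grad g f (γ t) (grad g f (γ t))).symm.trans (h1 (γ t))
      refine h2.congr_fderiv (ContinuousLinearMap.ext_ring ?_)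
      refine Eq.trans (congrArg (mfderiv I 𝓘(ℝ, ℝ) f (γ t)) (one_smul ℝ (grad g f (γ t)))) ?_
      exact h4.trans (one_smul ℝ (1 : ℝ)).symm
    exact (h3.sub (hasDerivAt_id' t)).congr_deriv (sub_self 1)
  have h5 := is_const_of_deriv_eq_zero (fun t => (hd t).differentiableAt)
    (fun t => (hd t).deriv) t 0
  simp only [sub_zero] at h5
  linarith

end GlobalFlow

/-! ### Charts in which a submersion is the first coordinate. -/

section AdaptedCharts

variable {n : ℕ}

lemma exists_equiv_fst_eq {ℓ : EuclideanSpace ℝ (Fin (n + 1)) →L[ℝ] ℝ} (hℓ : ℓ ≠ 0) :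
    ∃ A : EuclideanSpace ℝ (Fin (n + 1)) ≃L[ℝ] ℝ × EuclideanSpace ℝ (Fin n),
      ∀ v, (A v).1 = ℓ v := by
  set K := LinearMap.ker (ℓ : EuclideanSpace ℝ (Fin (n + 1)) →ₗ[ℝ] ℝ) with hK
  have hℓ' : (ℓ : EuclideanSpace ℝ (Fin (n + 1)) →ₗ[ℝ] ℝ) ≠ 0 := fun h => hℓ (by
    ext v; exact congrArg (fun L : EuclideanSpace ℝ (Fin (n + 1)) →ₗ[ℝ] ℝ => L v) h)
  have hr : Module.finrank ℝ K = n := by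
    have h : Module.finrank ℝ K + 1 = n + 1 :=
      (Module.Dual.finrank_ker_add_one_of_ne_zero hℓ').trans finrank_euclideanSpace_fin
    omega
  obtain ⟨u, hu⟩ : ∃ u, ℓ u ≠ 0 := by
    by_contra! h
    exact hℓ (by ext v; simp [h])
  let κ : K ≃L[ℝ] EuclideanSpace ℝ (Fin n) := ContinuousLinearEquiv.ofFinrankEq (by
    rw [hr, finrank_euclideanSpace_fin])
  let P : EuclideanSpace ℝ (Fin (n + 1)) →ₗ[ℝ] K :=
    LinearMap.codRestrict K (LinearMap.id -
      ((ℓ u)⁻¹ • (ℓ : EuclideanSpace ℝ (Fin (n + 1)) →ₗ[ℝ] ℝ)).smulRight u) (by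
        intro v
        rw [hK, LinearMap.mem_ker]
        simp only [LinearMap.sub_apply, LinearMap.id_apply, LinearMap.smulRight_apply,
          LinearMap.smul_apply, ContinuousLinearMap.coe_coe, map_sub, map_smul, smul_eq_mul]
        field_simp
        ring)
  let A₀ : EuclideanSpace ℝ (Fin (n + 1)) →ₗ[ℝ] ℝ × EuclideanSpace ℝ (Fin n) :=
    (ℓ : EuclideanSpace ℝ (Fin (n + 1)) →ₗ[ℝ] ℝ).prod (κ.toLinearEquiv.toLinearMap.comp P)
  have hinj : Function.Injective A₀ := by
    rw [injective_iff_map_eq_zero]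
    intro v hv
    have h1 : ℓ v = 0 := congrArg Prod.fst hv
    have h2 : κ (P v) = 0 := congrArg Prod.snd hv
    have h3 : P v = 0 := κ.injective (h2.trans (map_zero κ).symm)
    have h4 : ((P v : K) : EuclideanSpace ℝ (Fin (n + 1))) = v := by
      simp [P, h1]
    rw [← h4, h3]
    rfl
  have hfr : Module.finrank ℝ (EuclideanSpace ℝ (Fin (n + 1))) =
      Module.finrank ℝ (ℝ × EuclideanSpace ℝ (Fin n)) := by
    rw [Module.finrank_prod, finrank_euclideanSpace_fin, finrank_euclideanSpace_fin,
      Module.finrank_self, add_comm]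
  exact ⟨(LinearEquiv.ofInjectiveOfFinrankEq A₀ hinj hfr).toContinuousLinearEquiv,
    fun v => rfl⟩

variable {X : Type*} [TopologicalSpace X]
  [ChartedSpace (EuclideanSpace ℝ (Fin (n + 1))) X] [IsManifold (𝓡 (n + 1)) ∞ X]

/-- A submersion to the line is the first coordinate of a chart. -/
lemma exists_adapted_chart {f : X → ℝ} (hf : ContMDiff (𝓡 (n + 1)) 𝓘(ℝ, ℝ) ∞ f) (p : X)
    (hp : mfderiv (𝓡 (n + 1)) 𝓘(ℝ, ℝ) f p ≠ 0) :
    ∃ c : OpenPartialHomeomorph X (ℝ × EuclideanSpace ℝ (Fin n)), p ∈ c.source ∧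
      ContMDiffOn (𝓡 (n + 1)) 𝓘(ℝ, ℝ × EuclideanSpace ℝ (Fin n)) ∞ c c.source ∧
      ContMDiffOn 𝓘(ℝ, ℝ × EuclideanSpace ℝ (Fin n)) (𝓡 (n + 1)) ∞ c.symm c.target ∧
      ∀ x ∈ c.source, (c x).1 = f x := by
  set e := chartAt (EuclideanSpace ℝ (Fin (n + 1))) p with he
  set z := e p with hz
  have hpe : p ∈ e.source := mem_chart_source _ p
  have hze : z ∈ e.target := e.map_source hpe
  have hF : ContDiffOn ℝ ∞ (f ∘ e.symm) e.target :=
    (hf.comp_contMDiffOn (contMDiffOn_chart_symm (I := 𝓡 (n + 1)) (x := p))).contDiffOn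
  have hℓ : fderiv ℝ (f ∘ e.symm) z ≠ 0 := by
    intro h0
    apply hp
    have h1 : f =ᶠ[𝓝 p] (f ∘ e.symm) ∘ e := by
      filter_upwards [e.open_source.mem_nhds hpe] with y hy
      simp [e.left_inv hy]
    have h2 : MDifferentiableAt 𝓘(ℝ, EuclideanSpace ℝ (Fin (n + 1))) 𝓘(ℝ, ℝ)
        (f ∘ e.symm) (e p) :=
      ((hF.contDiffAt (e.open_target.mem_nhds hze)).differentiableAt
        (by simp)).mdifferentiableAt
    have h3 : MDifferentiableAt (𝓡 (n + 1)) 𝓘(ℝ, EuclideanSpace ℝ (Fin (n + 1))) e p :=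
      ((contMDiffOn_chart (I := 𝓡 (n + 1)) (n := ∞) (x := p)).contMDiffAt
        (e.open_source.mem_nhds hpe)).mdifferentiableAt (by simp)
    rw [h1.mfderiv_eq, mfderiv_comp p h2 h3, mfderiv_eq_fderiv, h0]
    exact ContinuousLinearMap.zero_comp _
  obtain ⟨A, hA⟩ := exists_equiv_fst_eq hℓ
  set π : EuclideanSpace ℝ (Fin (n + 1)) →L[ℝ] EuclideanSpace ℝ (Fin n) :=
    (ContinuousLinearMap.snd ℝ ℝ (EuclideanSpace ℝ (Fin n))).comp
      (A : EuclideanSpace ℝ (Fin (n + 1)) →L[ℝ] ℝ × EuclideanSpace ℝ (Fin n)) with hπ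
  set G : EuclideanSpace ℝ (Fin (n + 1)) → ℝ × EuclideanSpace ℝ (Fin n) :=
    fun y => ((f ∘ e.symm) y, π y) with hG
  have hGs : ContDiffOn ℝ ∞ G e.target := hF.prodMk π.contDiff.contDiffOn
  have hGz : ContDiffAt ℝ ∞ G z := hGs.contDiffAt (e.open_target.mem_nhds hze)
  have hGd : HasFDerivAt G
      (A : EuclideanSpace ℝ (Fin (n + 1)) →L[ℝ] ℝ × EuclideanSpace ℝ (Fin n)) z := by
    have h1 := (((hF.contDiffAt (e.open_target.mem_nhds hze)).differentiableAt
      (by simp)).hasFDerivAt).prodMk (π.hasFDerivAt (x := z))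
    refine h1.congr_fderiv ?_
    ext v
    · exact (hA v).symm
    · rfl
  set e₀ := hGz.toOpenPartialHomeomorph G hGd (by simp) with he₀
  -- The inverse function theorem gives smoothness of the inverse only at points with invertible
  -- differential. Shrinking to this open set makes the inverse smooth on the whole target.
  set U : Set (EuclideanSpace ℝ (Fin (n + 1))) := e.target ∩ fderiv ℝ G ⁻¹' Set.range
    ((↑) : (EuclideanSpace ℝ (Fin (n + 1)) ≃L[ℝ] ℝ × EuclideanSpace ℝ (Fin n)) → _) with hU
  have hUo : IsOpen U := by
    refine ContinuousOn.isOpen_inter_preimage ?_ e.open_target (ContinuousLinearEquiv.isOpen)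
    exact hGs.continuousOn_fderiv_of_isOpen e.open_target (by simp)
  set e₁ := e₀.restrOpen U hUo with he₁
  have he₁G : ∀ y, e₁ y = G y := fun y => rfl
  have hs₁ : e₁.source ⊆ U := Set.inter_subset_right
  have hsymm : ContDiffOn ℝ ∞ e₁.symm e₁.target := by
    intro w hw
    have hy := hs₁ (e₁.map_target hw)
    obtain ⟨B, hB⟩ := hy.2
    have hGy : ContDiffAt ℝ ∞ G (e₁.symm w) := hGs.contDiffAt (e.open_target.mem_nhds hy.1)
    refine (e₁.contDiffAt_symm (f₀' := B) hw ?_ hGy).contDiffWithinAt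
    rw [hB]
    exact (hGy.differentiableAt (by simp)).hasFDerivAt
  refine ⟨e.trans e₁, ?_, ?_, ?_, ?_⟩
  · rw [OpenPartialHomeomorph.trans_source]
    refine ⟨hpe, ?_⟩
    have h1 : z ∈ e₀.source := hGz.mem_toOpenPartialHomeomorph_source hGd (by simp)
    exact ⟨h1, hze, A, hGd.fderiv.symm⟩
  · rw [OpenPartialHomeomorph.trans_source]
    have h1 := contMDiffOn_chart (I := 𝓡 (n + 1)) (n := ∞) (x := p)
    have h2 : ContMDiffOn 𝓘(ℝ, EuclideanSpace ℝ (Fin (n + 1)))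
      𝓘(ℝ, ℝ × EuclideanSpace ℝ (Fin n)) ∞ e₁ e₁.source :=
      (hGs.mono fun y hy => (hs₁ hy).1).contMDiffOn
    exact h2.comp (h1.mono Set.inter_subset_left) fun x hx => hx.2
  · rw [OpenPartialHomeomorph.trans_target]
    have h1 := contMDiffOn_chart_symm (I := 𝓡 (n + 1)) (n := ∞) (x := p)
    exact h1.comp (hsymm.contMDiffOn.mono Set.inter_subset_left) fun x hx => hx.2
  · intro x hx
    rw [OpenPartialHomeomorph.trans_source] at hx
    change f (e.symm (e x)) = f x
    rw [e.left_inv hx.1]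

end AdaptedCharts

/-! ### The level set `f = 0` as a manifold. -/

section LevelSet

variable {n : ℕ} {X : Type*} [TopologicalSpace X]

/-- The chart of a level set defined by a chart of the ambient space whose first coordinate is the
defining function and a retraction to the level set. -/
def levelChart {f : X → ℝ} {r : X → {x // f x = 0}} (hr : Continuous r)
    (hr0 : ∀ x : {x // f x = 0}, r x = x)
    (c : OpenPartialHomeomorph X (ℝ × EuclideanSpace ℝ (Fin n)))
    (hc : ∀ x ∈ c.source, (c x).1 = f x) :
    OpenPartialHomeomorph {x // f x = 0} (EuclideanSpace ℝ (Fin n)) where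
  toFun y := (c y).2
  -- On the target the point `c.symm (0, w)` is already on the level set, where `r` is the identity.
  -- Using `r` gives a map into the subtype defined for all `w`, with no membership proof in the
  -- formula.
  invFun w := r (c.symm (0, w))
  source := {y | (y : X) ∈ c.source}
  target := {w | (0, w) ∈ c.target}
  map_source' y hy := by
    have h : ((0 : ℝ), (c y).2) = c y := Prod.ext ((hc y hy).trans y.2).symm rfl
    change ((0 : ℝ), (c y).2) ∈ c.target
    rw [h]
    exact c.map_source hy
  map_target' w hw := by
    have hx := c.map_target hw
    have h0 : f (c.symm (0, w)) = 0 := by rw [← hc _ hx, c.right_inv hw]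
    have h1 := hr0 ⟨_, h0⟩
    change ((r (c.symm (0, w)) : {x // f x = 0}) : X) ∈ c.source
    rw [h1]
    exact hx
  left_inv' y hy := by
    have h : ((0 : ℝ), (c y).2) = c y := Prod.ext ((hc y hy).trans y.2).symm rfl
    rw [h, c.left_inv hy, hr0]
  right_inv' w hw := by
    have hx := c.map_target hw
    have h0 : f (c.symm (0, w)) = 0 := by rw [← hc _ hx, c.right_inv hw]
    have h1 := hr0 ⟨_, h0⟩
    rw [h1]
    exact congrArg Prod.snd (c.right_inv hw)
  open_source := c.open_source.preimage continuous_subtype_val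
  open_target := c.open_target.preimage (by fun_prop)
  continuousOn_toFun := continuous_snd.comp_continuousOn
    (c.continuousOn.comp continuous_subtype_val.continuousOn fun y hy => hy)
  continuousOn_invFun := hr.comp_continuousOn
    (c.symm.continuousOn.comp (by fun_prop) fun w hw => hw)

/-- The level set as a manifold. -/
@[reducible] def levelChartedSpace {f : X → ℝ} {r : X → {x // f x = 0}} (hr : Continuous r)
    (hr0 : ∀ x : {x // f x = 0}, r x = x)
    (c : {x // f x = 0} → OpenPartialHomeomorph X (ℝ × EuclideanSpace ℝ (Fin n)))
    (hc : ∀ p, ∀ x ∈ (c p).source, (c p x).1 = f x) (hp : ∀ p, (p : X) ∈ (c p).source) :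
    ChartedSpace (EuclideanSpace ℝ (Fin n)) {x // f x = 0} where
  atlas := Set.range fun p => levelChart hr hr0 (c p) (hc p)
  chartAt p := levelChart hr hr0 (c p) (hc p)
  mem_chart_source p := hp p
  chart_mem_atlas p := ⟨p, rfl⟩

end LevelSet

/-! ### The gradient splitting. -/

section Splitting

variable {n : ℕ} {X : Type u₁} [TopologicalSpace X] [T2Space X] [SecondCountableTopology X]
  [ChartedSpace (EuclideanSpace ℝ (Fin (n + 1))) X] [IsManifold (𝓡 (n + 1)) ∞ X]

/-- With `N = f⁻¹(0)` the flow restricted to `ℝ × N` has the inverse `x ↦ (f x, φ (-f x, x))`: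
flowing back for time `f x` reaches the zero level. -/
lemma hasGradientSplitting_of_flow {g : SmoothMetric (𝓡 (n + 1)) X} {f : X → ℝ}
    (hf : ContMDiff (𝓡 (n + 1)) 𝓘(ℝ, ℝ) ∞ f)
    (hp : ∀ p, mfderiv (𝓡 (n + 1)) 𝓘(ℝ, ℝ) f p ≠ 0) {φ : ℝ × X → X}
    (hφ : ContMDiff (𝓘(ℝ, ℝ).prod (𝓡 (n + 1))) (𝓡 (n + 1)) ∞ φ) (hφ0 : ∀ x, φ (0, x) = x)
    (hadd : ∀ s t x, φ (s + t, x) = φ (s, φ (t, x)))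
    (hcurve : ∀ x, IsMIntegralCurve (fun t => φ (t, x)) (grad g f))
    (hfφ : ∀ t x, f (φ (t, x)) = f x + t) : HasGradientSplitting g f := by
  have hρ : ContMDiff (𝓡 (n + 1)) (𝓡 (n + 1)) ∞ fun x => φ (-f x, x) :=
    hφ.comp (hf.neg.prodMk contMDiff_id)
  set r : X → {x // f x = 0} := fun x => ⟨φ (-f x, x), by rw [hfφ]; ring⟩ with hr
  have hrc : Continuous r := hρ.continuous.subtype_mk _
  have hr0 : ∀ x : {x // f x = 0}, r x = x := fun x => Subtype.ext (by
    simp [hr, x.2, hφ0])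
  choose c hcp hcs hct hcf using fun p : {x // f x = 0} => exists_adapted_chart hf p (hp p)
  let _ : ChartedSpace (EuclideanSpace ℝ (Fin n)) {x // f x = 0} :=
    levelChartedSpace hrc hr0 c hcf hcp
  have hinv : ∀ p, ContMDiffOn (𝓡 n) (𝓡 (n + 1)) ∞
      (fun w => φ (-f ((c p).symm (0, w)), (c p).symm (0, w))) {w | (0, w) ∈ (c p).target} := by
    intro p
    refine hρ.comp_contMDiffOn (ContMDiffOn.comp (hct p) ?_ fun w hw => hw)
    exact (contDiff_const.prodMk contDiff_id).contMDiff.contMDiffOn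
  have hmfd : IsManifold (𝓡 n) ∞ {x // f x = 0} := by
    refine isManifold_of_contDiffOn (𝓡 n) ∞ _ ?_
    rintro _ _ ⟨p, rfl⟩ ⟨q, rfl⟩
    have h1 : ContMDiffOn (𝓡 n) (𝓡 n) ∞
        (fun w => (c q (φ (-f ((c p).symm (0, w)), (c p).symm (0, w)))).2)
        ({w | (0, w) ∈ (c p).target} ∩
          {w | φ (-f ((c p).symm (0, w)), (c p).symm (0, w)) ∈ (c q).source}) := by
      refine ContMDiffOn.comp (contDiff_snd.contMDiff.contMDiffOn (s := Set.univ))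
        (ContMDiffOn.comp (hcs q) ((hinv p).mono Set.inter_subset_left) fun w hw => hw.2)
        fun w _ => Set.mem_univ _
    refine h1.contDiffOn.mono ?_
    intro w hw
    simpa [levelChart, OpenPartialHomeomorph.trans_source] using hw
  have hsub : ContMDiff (𝓡 n) (𝓡 (n + 1)) ∞ (Subtype.val : {x // f x = 0} → X) := by
    intro p
    have h1 : ContMDiffOn (𝓡 n) (𝓡 n) ∞ (levelChart hrc hr0 (c p) (hcf p)) _ :=
      contMDiffOn_chart (x := p)
    have h2 := (hinv p).comp h1 fun y hy => (levelChart hrc hr0 (c p) (hcf p)).map_source hy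
    refine (h2.contMDiffAt (chart_source_mem_nhds (EuclideanSpace ℝ (Fin n)) p)).congr_of_eventuallyEq ?_
    filter_upwards [chart_source_mem_nhds (EuclideanSpace ℝ (Fin n)) p] with y hy
    exact congrArg Subtype.val ((levelChart hrc hr0 (c p) (hcf p)).left_inv hy).symm
  have hrs : ContMDiff (𝓡 (n + 1)) (𝓡 n) ∞ r := by
    intro x
    rw [contMDiffAt_iff_target]
    refine ⟨hrc.continuousAt, ?_⟩
    have h1 : ContMDiffAt (𝓡 (n + 1)) 𝓘(ℝ, ℝ × EuclideanSpace ℝ (Fin n)) ∞ (c (r x)) (r x) :=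
      (hcs (r x)).contMDiffAt ((c (r x)).open_source.mem_nhds (hcp (r x)))
    have h2 := ContMDiffAt.comp x h1 (hρ x)
    exact ContMDiffAt.comp (g := Prod.snd) (I' := 𝓘(ℝ, ℝ × EuclideanSpace ℝ (Fin n))) x
      (contDiff_snd.contMDiff.contMDiffAt) h2
  let Φ : (ℝ × {x // f x = 0}) ≃ₘ^∞⟮𝓘(ℝ, ℝ).prod (𝓡 n), 𝓡 (n + 1)⟯ X :=
    { toFun := fun p => φ (p.1, p.2)
      invFun := fun x => (f x, r x)
      left_inv := fun p => by
        have h1 : f (φ (p.1, p.2)) = p.1 := by rw [hfφ, p.2.2, zero_add]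
        refine Prod.ext h1 (Subtype.ext ?_)
        simp only [hr]
        rw [h1, ← hadd, neg_add_cancel, hφ0]
      right_inv := fun x => by
        simp only [hr]
        rw [← hadd, add_neg_cancel, hφ0]
      contMDiff_toFun := hφ.comp (contMDiff_fst.prodMk (hsub.comp contMDiff_snd))
      contMDiff_invFun := hf.prodMk hrs }
  refine ⟨{x // f x = 0}, inferInstance, inferInstance,
    TopologicalSpace.Subtype.secondCountableTopology _, inferInstance, hmfd, Φ,
    fun t p => ?_, fun t p => ?_⟩
  · change f (φ (t, p)) = t
    rw [hfφ, p.2, zero_add]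
  · exact velocity_of_isMIntegralCurveAt ((hcurve p).isMIntegralCurveAt t)

theorem AdmissiblePair.hasGradientSplitting {g : SmoothMetric (𝓡 (n + 1)) X} {f : X → ℝ}
    (h : AdmissiblePair g f) : HasGradientSplitting g f := by
  have hV := isSmoothField_grad g h.smooth
  obtain ⟨φ, hφ, hφ0, hadd, hcurve⟩ := hV.exists_flow
    (exists_isMIntegralCurve_of_complete g h.complete hV h.norm_grad)
  refine hasGradientSplitting_of_flow h.smooth (fun p hp => ?_) hφ hφ0 hadd hcurve fun t x => ?_
  · have h1 := (formAt_grad g f p (grad g f p)).symm.trans (h.norm_grad p)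
    rw [hp] at h1
    exact zero_ne_one (α := ℝ) h1
  · have := apply_integralCurve_grad g h.smooth h.norm_grad (hcurve x) t
    rwa [hφ0] at this

end Splitting

/-! ### Determinants of nonnegative binary quadratic forms. -/

section BinaryForms

lemma sq_le_mul_of_forall_nonneg {p q r : ℝ}
    (h : ∀ s t : ℝ, 0 ≤ s ^ 2 * p + 2 * (s * t * q) + t ^ 2 * r) : q ^ 2 ≤ p * r := by
  have hr : 0 ≤ r := by simpa using h 0 1
  rcases hr.eq_or_lt with h0 | h0
  · have hp : 0 ≤ p := by simpa using h 1 0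
    by_contra hcon
    have hq : q ≠ 0 := fun hq => hcon (by rw [hq, ← h0]; simp)
    -- With `r = 0` the form is affine in `t`; this value of `t` makes it equal to `-p - 2 < 0`.
    have h1 := h 1 (-(p + 1) / q)
    have h2 : -(p + 1) / q * q = -(p + 1) := by field_simp
    rw [← h0, one_mul, h2] at h1
    linarith
  -- At `(s, t) = (r, -q)` the form equals `r (p r - q²)`.
  · have h1 := h r (-q)
    have h2 : 0 ≤ r * (p * r - q ^ 2) := by nlinarith
    have := nonneg_of_mul_nonneg_right h2 h0
    linarith

/-- The determinant is superadditive on nonnegative binary quadratic forms. -/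
lemma det_add_det_le {p q r p' q' r' : ℝ} (hp : 0 ≤ p) (hr : 0 ≤ r) (h : q ^ 2 ≤ p * r)
    (hp' : 0 ≤ p') (hr' : 0 ≤ r') (h' : q' ^ 2 ≤ p' * r') :
    (p * r - q ^ 2) + (p' * r' - q' ^ 2) ≤ (p + p') * (r + r') - (q + q') ^ 2 := by
  have h1 : (q * q') ^ 2 ≤ (p * r') * (r * p') := by
    calc (q * q') ^ 2 = q ^ 2 * q' ^ 2 := by ring
      _ ≤ (p * r) * (p' * r') := mul_le_mul h h' (sq_nonneg _) (by positivity)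
      _ = _ := by ring
  -- Arithmetic-geometric mean inequality for `p r'` and `r p'`; this is precisely the mixed term in
  -- the determinant of the sum.
  have h2 : 2 * (q * q') ≤ p * r' + r * p' := by
    refine le_of_sq_le_sq ?_ (by positivity)
    nlinarith [sq_nonneg (p * r' - r * p')]
  nlinarith

end BinaryForms

/-! ### Reducing curvature bounds to adapted bases of planes. -/

section PlaneReduction

variable {F : Type*} [NormedAddCommGroup F] [NormedSpace ℝ F]

/-- The curvature of the bivector `u ∧ v`. -/
def curvatureForm (K : F → F →L[ℝ] F →L[ℝ] ℝ) (z u v : F) : ℝ :=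
  K z (coordCurvature K z u v v) u

/-- The squared area of the bivector `u ∧ v`. -/
def gramForm (B : F →L[ℝ] F →L[ℝ] ℝ) (u v : F) : ℝ := B u u * B v v - B u v ^ 2

variable {K : F → F →L[ℝ] F →L[ℝ] ℝ}

lemma coordCurvature_antisymm (z u v w : F) :
    coordCurvature K z u v w = -coordCurvature K z v u w := by
  simp only [coordCurvature]
  abel

lemma coordCurvature_add_left (z u u' v w : F) :
    coordCurvature K z (u + u') v w = coordCurvature K z u v w + coordCurvature K z u' v w := by
  simp only [coordCurvature, map_add, add_apply]
  abel

lemma coordCurvature_smul_left (z u v w : F) (c : ℝ) :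
    coordCurvature K z (c • u) v w = c • coordCurvature K z u v w := by
  simp only [coordCurvature, map_smul, smul_apply, smul_sub, smul_add]

lemma coordCurvature_add_right (z u v w w' : F) :
    coordCurvature K z u v (w + w') = coordCurvature K z u v w + coordCurvature K z u v w' := by
  simp only [coordCurvature, map_add]
  abel

lemma coordCurvature_smul_right (z u v w : F) (c : ℝ) :
    coordCurvature K z u v (c • w) = c • coordCurvature K z u v w := by
  simp only [coordCurvature, map_smul, smul_sub, smul_add]

lemma coordCurvature_self (z u w : F) : coordCurvature K z u u w = 0 := by
  simp [coordCurvature]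

lemma curvatureForm_zero_right (z u : F) : curvatureForm K z u 0 = 0 := by
  have := coordCurvature_smul_right (K := K) z u 0 0 0
  simp only [zero_smul] at this
  simp [curvatureForm, this]

variable [FiniteDimensional ℝ F] {s : Set F}

/-- Polarization of `apply_curvature_self` at `w = u + v`; no Bianchi identity is needed. -/
lemma IsMetricOn.curvatureForm_comm (h : IsMetricOn K s) {z : F} (hz : z ∈ s) (u v : F) :
    curvatureForm K z u v = curvatureForm K z v u := by
  have h1 := h.apply_curvature_self hz u v (u + v)
  rw [coordCurvature_add_right] at h1
  simp only [map_add, add_apply, h.apply_curvature_self hz] at h1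
  rw [curvatureForm, curvatureForm, coordCurvature_antisymm z v u u, map_neg, neg_apply]
  linarith

lemma IsMetricOn.curvatureForm_add_smul (h : IsMetricOn K s) {z : F} (hz : z ∈ s) (u v : F)
    (c : ℝ) : curvatureForm K z (u + c • v) v = curvatureForm K z u v := by
  rw [curvatureForm, coordCurvature_add_left, coordCurvature_smul_left, coordCurvature_self,
    smul_zero, add_zero, map_add, map_smul, h.apply_curvature_self hz, smul_zero, add_zero,
    curvatureForm]

lemma IsMetricOn.curvatureForm_add_smul' (h : IsMetricOn K s) {z : F} (hz : z ∈ s) (u v : F)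
    (c : ℝ) : curvatureForm K z u (v + c • u) = curvatureForm K z u v := by
  rw [h.curvatureForm_comm hz, h.curvatureForm_add_smul hz, h.curvatureForm_comm hz]

lemma gramForm_comm {B : F →L[ℝ] F →L[ℝ] ℝ} (hB : ∀ u v, B u v = B v u) (u v : F) :
    gramForm B u v = gramForm B v u := by
  rw [gramForm, gramForm, hB u v]
  ring

lemma gramForm_add_smul {B : F →L[ℝ] F →L[ℝ] ℝ} (hB : ∀ u v, B u v = B v u) (u v : F) (c : ℝ) :
    gramForm B (u + c • v) v = gramForm B u v := by
  simp only [gramForm, map_add, add_apply, map_smul, smul_apply, smul_eq_mul, hB v u]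
  ring

lemma gramForm_add_smul' {B : F →L[ℝ] F →L[ℝ] ℝ} (hB : ∀ u v, B u v = B v u) (u v : F) (c : ℝ) :
    gramForm B u (v + c • u) = gramForm B u v := by
  rw [gramForm_comm hB, gramForm_add_smul hB, gramForm_comm hB]

/-- Curvature bounds have to be checked only on the bases of planes that are adapted to a linear
form. -/
lemma IsMetricOn.curvature_bounds_of_adapted (h : IsMetricOn K s) {z : F} (hz : z ∈ s)
    (ℓ : F →L[ℝ] ℝ) {a b : ℝ}
    (hab : ∀ u v, ℓ v = 0 → K z u v = 0 → b * gramForm (K z) u v ≤ curvatureForm K z u v ∧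
      curvatureForm K z u v ≤ a * gramForm (K z) u v) (u v : F) :
    b * gramForm (K z) u v ≤ curvatureForm K z u v ∧
      curvatureForm K z u v ≤ a * gramForm (K z) u v := by
  have hB := h.symm z hz
  have step : ∀ u v, ℓ v = 0 → b * gramForm (K z) u v ≤ curvatureForm K z u v ∧
      curvatureForm K z u v ≤ a * gramForm (K z) u v := by
    intro u v hv
    by_cases hv0 : v = 0
    · rw [hv0, curvatureForm_zero_right]
      simp [gramForm]
    · have hpos := h.pos z hz v hv0
      -- One Gram-Schmidt step. The curvature and Gram forms depend only on `u ∧ v`, so the shear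
      -- changes neither.
      have key := hab (u + (-(K z u v / K z v v)) • v) v hv (by
        simp only [map_add, add_apply, map_smul, smul_apply, smul_eq_mul]
        field_simp
        ring)
      rwa [h.curvatureForm_add_smul hz, gramForm_add_smul hB] at key
  by_cases hv : ℓ v = 0
  · exact step u v hv
  -- This combination is the direction of the plane that lies in the kernel of `ℓ`; the two basis
  -- vectors then exchange roles.
  · have key := step v (u + (-(ℓ u / ℓ v)) • v) (by
      simp only [map_add, map_smul, smul_eq_mul]
      field_simp
      ring)
    rwa [h.curvatureForm_add_smul' hz, gramForm_add_smul' hB, h.curvatureForm_comm hz,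
      gramForm_comm hB] at key

end PlaneReduction

/-! ### Curvature estimates on a single factor. -/

section Pinching

/-- A metric tensor of the form `dt² + γ(t)` with bounded curvature, negative radial curvature and
pinched convex slices. -/
structure IsPinchedUnitLapse {E : Type*} [NormedAddCommGroup E] [NormedSpace ℝ E]
    (G : ℝ × E → (ℝ × E) →L[ℝ] (ℝ × E) →L[ℝ] ℝ) (s : Set (ℝ × E)) (Λ δ c₁ c₂ : ℝ) : Prop
    extends IsUnitLapse G s where
  abs_curvature_le : ∀ z ∈ s, ∀ u v, |curvatureForm G z u v| ≤ Λ * gramForm (G z) u v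
  radial_curvature_le : ∀ z ∈ s, ∀ v : ℝ × E, v.1 = 0 →
    curvatureForm G z (1, 0) v ≤ -δ * G z v v
  le_sliceForm : ∀ z ∈ s, ∀ v : ℝ × E, v.1 = 0 → c₁ * G z v v ≤ sliceForm G z v v
  sliceForm_le : ∀ z ∈ s, ∀ v : ℝ × E, v.1 = 0 → sliceForm G z v v ≤ c₂ * G z v v

variable {E : Type*} [NormedAddCommGroup E] [NormedSpace ℝ E] [FiniteDimensional ℝ E]
  {G : ℝ × E → (ℝ × E) →L[ℝ] (ℝ × E) →L[ℝ] ℝ} {s : Set (ℝ × E)} {Λ δ c₁ c₂ : ℝ}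

/-- The field `∂_t` has constant length, so `Γ(u, ∂_t)` is orthogonal to it. Hence the `∂_t`
components of vectors do not affect the second fundamental forms. -/
lemma IsUnitLapse.sliceForm_vertical (h : IsUnitLapse G s) {z : ℝ × E} (hz : z ∈ s)
    (u : ℝ × E) : sliceForm G z u (1, 0) = 0 := by
  have h1 := h.apply_christoffel_vertical hz u (1, 0)
  rw [h.lapse' hz] at h1
  rw [sliceForm] at h1 ⊢
  linarith

lemma sliceForm_add_smul_right (z u v w : ℝ × E) (c : ℝ) :
    sliceForm G z u (v + c • w) = sliceForm G z u v + c * sliceForm G z u w := by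
  simp only [sliceForm, map_add, map_smul, Prod.fst_add, Prod.smul_fst, smul_eq_mul]
  ring

lemma sliceForm_add_smul_left (z u v w : ℝ × E) (c : ℝ) :
    sliceForm G z (u + c • w) v = sliceForm G z u v + c * sliceForm G z w v := by
  simp only [sliceForm, map_add, map_smul, add_apply, smul_apply, Prod.fst_add, Prod.smul_fst,
    smul_eq_mul]
  ring

lemma IsPinchedUnitLapse.form_nonneg (h : IsPinchedUnitLapse G s Λ δ c₁ c₂) {z : ℝ × E}
    (hz : z ∈ s) (v : ℝ × E) : 0 ≤ G z v v := by
  by_cases h0 : v = 0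
  · rw [h0]; simp
  · exact (h.pos z hz _ h0).le

/-- The second fundamental form of the slices is at least `c₁` times the metric, in the sense of
binary forms. -/
lemma IsPinchedUnitLapse.sq_sliceForm_sub_le (h : IsPinchedUnitLapse G s Λ δ c₁ c₂) {z : ℝ × E}
    (hz : z ∈ s) {u v : ℝ × E} (hu : u.1 = 0) (hv : v.1 = 0) :
    (sliceForm G z u v - c₁ * G z u v) ^ 2 ≤
      (sliceForm G z u u - c₁ * G z u u) * (sliceForm G z v v - c₁ * G z v v) := by
  refine sq_le_mul_of_forall_nonneg fun a b => ?_
  have h1 := h.le_sliceForm z hz (a • u + b • v) (by simp [hu, hv])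
  have e1 : sliceForm G z (a • u + b • v) (a • u + b • v) = a ^ 2 * sliceForm G z u u
      + 2 * (a * b * sliceForm G z u v) + b ^ 2 * sliceForm G z v v := by
    have hs := sliceForm_symm h.toIsUnitLapse hz u v
    simp only [sliceForm, map_add, map_smul, add_apply, smul_apply, Prod.fst_add, Prod.smul_fst,
      smul_eq_mul] at hs ⊢
    linear_combination (-(a * b)) * hs
  have e2 : G z (a • u + b • v) (a • u + b • v) = a ^ 2 * G z u u
      + 2 * (a * b * G z u v) + b ^ 2 * G z v v := by
    simp only [map_add, map_smul, add_apply, smul_apply, smul_eq_mul, h.symm z hz v u]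
    ring
  rw [e1, e2] at h1
  linarith

lemma IsPinchedUnitLapse.sq_form_le (h : IsPinchedUnitLapse G s Λ δ c₁ c₂) {z : ℝ × E}
    (hz : z ∈ s) (u v : ℝ × E) : G z u v ^ 2 ≤ G z u u * G z v v := by
  refine sq_le_mul_of_forall_nonneg fun a b => ?_
  have h1 := h.form_nonneg hz (a • u + b • v)
  simp only [map_add, map_smul, add_apply, smul_apply, smul_eq_mul, h.symm z hz v u] at h1
  linarith

/-- The curvature of the planes spanned by `a ∂_t + u` and `v`. -/
lemma IsPinchedUnitLapse.curvatureForm_le (h : IsPinchedUnitLapse G s Λ δ c₁ c₂) (hΛ : 0 < Λ)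
    (hδ : 0 < δ) {z : ℝ × E} (hz : z ∈ s) {u v : ℝ × E} (hu : u.1 = 0) (hv : v.1 = 0) (a : ℝ) :
    curvatureForm G z (u + a • (1, 0)) v ≤
      -(δ / 2) * (a ^ 2 * G z v v) + (Λ + 2 * Λ ^ 2 / δ) * (G z u u * G z v v) := by
  set B : ℝ := G z (coordCurvature G z u v v) (1, 0) + G z (coordCurvature G z (1, 0) v v) u
    with hB
  have expand : ∀ r : ℝ, curvatureForm G z (u + r • (1, 0)) v =
      r ^ 2 * curvatureForm G z (1, 0) v + r * B + curvatureForm G z u v := by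
    intro r
    simp only [curvatureForm, coordCurvature_add_left, coordCurvature_smul_left, map_add, map_smul,
      add_apply, smul_apply, smul_eq_mul, hB]
    ring
  have hu1 : G z u (1, 0) = 0 := by rw [h.lapse' hz, hu]
  have hv1 : G z (1, 0) v = 0 := by rw [h.lapse z hz, hv]
  have h11 : G z (1, 0) (1, 0) = 1 := h.lapse z hz _
  have gram : ∀ r : ℝ, gramForm (G z) (u + r • (1, 0)) v ≤ (r ^ 2 + G z u u) * G z v v := by
    intro r
    have h1u : G z (1, 0) u = 0 := by rw [h.lapse z hz, hu]
    simp only [gramForm, map_add, map_smul, add_apply, smul_apply, smul_eq_mul, hu1, hv1, h11, h1u]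
    nlinarith [sq_nonneg (G z u v)]
  have bound : ∀ r : ℝ, |curvatureForm G z (u + r • (1, 0)) v| ≤
      Λ * ((r ^ 2 + G z u u) * G z v v) := fun r =>
    (h.abs_curvature_le z hz _ _).trans (mul_le_mul_of_nonneg_left (gram r) hΛ.le)
  have hrad := h.radial_curvature_le z hz v hv
  have h0 := abs_le.1 (bound 0)
  simp only [expand] at bound h0
  -- Subtracting the curvature bounds for `r` and `-r` isolates the part of the curvature that is
  -- linear in `r`.
  have cross : ∀ r : ℝ, r * B ≤ Λ * ((r ^ 2 + G z u u) * G z v v) := by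
    intro r
    have b1 := (abs_le.1 (bound r)).2
    have b2 := (abs_le.1 (bound (-r))).1
    rw [neg_sq] at b2
    linarith
  -- Weighted Young inequality: applying `cross` to `τ a` with `τ = δ / (2 Λ)` and dividing by `τ`
  -- makes the `a²` part cost `δ / 2`, half of what the radial curvature supplies. The rest goes
  -- into `2 Λ² / δ`.
  have hτ : 0 < δ / (2 * Λ) := by positivity
  have key := cross (δ / (2 * Λ) * a)
  have key' : a * B ≤ δ / 2 * (a ^ 2 * G z v v) + 2 * Λ ^ 2 / δ * (G z u u * G z v v) := by
    have e : a * B = (δ / (2 * Λ))⁻¹ * (δ / (2 * Λ) * a * B) := by field_simp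
    rw [e]
    refine (mul_le_mul_of_nonneg_left key (inv_nonneg.2 hτ.le)).trans (le_of_eq ?_)
    field_simp
  rw [expand]
  have : a ^ 2 * curvatureForm G z (1, 0) v ≤ a ^ 2 * (-δ * G z v v) :=
    mul_le_mul_of_nonneg_left hrad (sq_nonneg a)
  nlinarith

lemma IsPinchedUnitLapse.le_curvatureForm (h : IsPinchedUnitLapse G s Λ δ c₁ c₂) (hΛ : 0 < Λ)
    {z : ℝ × E} (hz : z ∈ s) {u v : ℝ × E} (hu : u.1 = 0) (hv : v.1 = 0) (a : ℝ) :
    -Λ * ((a ^ 2 + G z u u) * G z v v) ≤ curvatureForm G z (u + a • (1, 0)) v := by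
  have gram : gramForm (G z) (u + a • (1, 0)) v ≤ (a ^ 2 + G z u u) * G z v v := by
    have hu1 : G z u (1, 0) = 0 := by rw [h.lapse' hz, hu]
    have hv1 : G z (1, 0) v = 0 := by rw [h.lapse z hz, hv]
    have h11 : G z (1, 0) (1, 0) = 1 := h.lapse z hz _
    have h1u : G z (1, 0) u = 0 := by rw [h.lapse z hz, hu]
    simp only [gramForm, map_add, map_smul, add_apply, smul_apply, smul_eq_mul, hu1, hv1, h11, h1u]
    nlinarith [sq_nonneg (G z u v)]
  have h1 := (abs_le.1 (h.abs_curvature_le z hz (u + a • (1, 0)) v)).1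
  have := mul_le_mul_of_nonneg_left gram hΛ.le
  linarith

end Pinching

/-! ### The pinching estimate for `ρ dt² + γ₁(t) + γ₂(t)`. -/

section FibrePinching

/-- The indices are the two factors; `x`, `y`, `m` are the entries of the metric and `α`, `β`, `γ`
those of the second fundamental form on a pair of slice vectors. The second fundamental form is `c₁`
times the metric plus a nonnegative form, and determinants are superadditive. Orthogonality `m₁ + m₂
= 0` makes the determinant of the metric part the full product `(x₁ + x₂) (y₁ + y₂)`. -/
lemma det_sum_bounds {c₁ c₂ x₁ y₁ m₁ α₁ β₁ γ₁ x₂ y₂ m₂ α₂ β₂ γ₂ : ℝ} (hc₁ : 0 ≤ c₁)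
    (hx₁ : 0 ≤ x₁) (hy₁ : 0 ≤ y₁) (hm₁ : m₁ ^ 2 ≤ x₁ * y₁) (hα₁ : c₁ * x₁ ≤ α₁)
    (hα₁' : α₁ ≤ c₂ * x₁) (hβ₁ : c₁ * y₁ ≤ β₁) (hβ₁' : β₁ ≤ c₂ * y₁)
    (hγ₁ : (γ₁ - c₁ * m₁) ^ 2 ≤ (α₁ - c₁ * x₁) * (β₁ - c₁ * y₁))
    (hx₂ : 0 ≤ x₂) (hy₂ : 0 ≤ y₂) (hm₂ : m₂ ^ 2 ≤ x₂ * y₂) (hα₂ : c₁ * x₂ ≤ α₂)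
    (hα₂' : α₂ ≤ c₂ * x₂) (hβ₂ : c₁ * y₂ ≤ β₂) (hβ₂' : β₂ ≤ c₂ * y₂)
    (hγ₂ : (γ₂ - c₁ * m₂) ^ 2 ≤ (α₂ - c₁ * x₂) * (β₂ - c₁ * y₂)) (hm : m₁ + m₂ = 0) :
    c₁ ^ 2 * ((x₁ + x₂) * (y₁ + y₂)) ≤ (α₁ + α₂) * (β₁ + β₂) - (γ₁ + γ₂) ^ 2 ∧
    (α₁ + α₂) * (β₁ + β₂) - (γ₁ + γ₂) ^ 2 ≤ c₂ ^ 2 * ((x₁ + x₂) * (y₁ + y₂)) ∧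
    0 ≤ (α₁ * β₁ - γ₁ ^ 2) + (α₂ * β₂ - γ₂ ^ 2) ∧
    (α₁ * β₁ - γ₁ ^ 2) + (α₂ * β₂ - γ₂ ^ 2) ≤ c₂ ^ 2 * ((x₁ + x₂) * (y₁ + y₂)) := by
  have pos : ∀ {x c α : ℝ}, 0 ≤ c → 0 ≤ x → c * x ≤ α → 0 ≤ α := fun hc hx h =>
    (mul_nonneg hc hx).trans h
  have hα₁0 := pos hc₁ hx₁ hα₁
  have hα₂0 := pos hc₁ hx₂ hα₂
  have hβ₁0 := pos hc₁ hy₁ hβ₁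
  have hβ₂0 := pos hc₁ hy₂ hβ₂
  have d1 := det_add_det_le (sub_nonneg.2 hα₁) (sub_nonneg.2 hβ₁) hγ₁ (sub_nonneg.2 hα₂)
    (sub_nonneg.2 hβ₂) hγ₂
  have hm' : (γ₁ - c₁ * m₁ + (γ₂ - c₁ * m₂)) = γ₁ + γ₂ := by linear_combination -c₁ * hm
  rw [hm'] at d1
  have d2 := det_add_det_le (p := c₁ * (x₁ + x₂)) (q := 0) (r := c₁ * (y₁ + y₂))
    (p' := α₁ - c₁ * x₁ + (α₂ - c₁ * x₂)) (q' := γ₁ + γ₂)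
    (r' := β₁ - c₁ * y₁ + (β₂ - c₁ * y₂)) (by positivity) (by positivity)
    (by rw [zero_pow two_ne_zero]; positivity) (by linarith) (by linarith) (by linarith)
  have hdet : ∀ {x y m α β γ : ℝ}, 0 ≤ x → 0 ≤ y → m ^ 2 ≤ x * y → c₁ * x ≤ α → c₁ * y ≤ β →
      (γ - c₁ * m) ^ 2 ≤ (α - c₁ * x) * (β - c₁ * y) → 0 ≤ α * β - γ ^ 2 := by
    intro x y m α β γ hx hy hm hα hβ hγ
    have h1 : (c₁ * m) ^ 2 ≤ (c₁ * x) * (c₁ * y) := by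
      have := mul_le_mul_of_nonneg_left hm (sq_nonneg c₁)
      linarith
    have h2 := det_add_det_le (mul_nonneg hc₁ hx) (mul_nonneg hc₁ hy) h1 (sub_nonneg.2 hα)
      (sub_nonneg.2 hβ) hγ
    have e1 : c₁ * x + (α - c₁ * x) = α := by ring
    have e2 : c₁ * y + (β - c₁ * y) = β := by ring
    have e3 : c₁ * m + (γ - c₁ * m) = γ := by ring
    rw [e1, e2, e3] at h2
    linarith
  have n1 := hdet hx₁ hy₁ hm₁ hα₁ hβ₁ hγ₁
  have n2 := hdet hx₂ hy₂ hm₂ hα₂ hβ₂ hγ₂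
  have up : (α₁ + α₂) * (β₁ + β₂) ≤ c₂ ^ 2 * ((x₁ + x₂) * (y₁ + y₂)) := by
    calc (α₁ + α₂) * (β₁ + β₂) ≤ (c₂ * (x₁ + x₂)) * (c₂ * (y₁ + y₂)) :=
          mul_le_mul (by linarith) (by linarith) (by linarith) (by linarith)
      _ = _ := by ring
  refine ⟨?_, by linarith [sq_nonneg (γ₁ + γ₂)], by linarith, ?_⟩
  · have e1 : c₁ * (x₁ + x₂) + (α₁ - c₁ * x₁ + (α₂ - c₁ * x₂)) = α₁ + α₂ := by ring
    have e2 : c₁ * (y₁ + y₂) + (β₁ - c₁ * y₁ + (β₂ - c₁ * y₂)) = β₁ + β₂ := by ring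
    rw [e1, e2, zero_add] at d2
    linarith
  · have := mul_nonneg hα₁0 hβ₂0
    have := mul_nonneg hα₂0 hβ₁0
    linarith [sq_nonneg γ₁, sq_nonneg γ₂]

variable {E₁ : Type*} [NormedAddCommGroup E₁] [NormedSpace ℝ E₁] [FiniteDimensional ℝ E₁]
  {E₂ : Type*} [NormedAddCommGroup E₂] [NormedSpace ℝ E₂] [FiniteDimensional ℝ E₂]
  {G₁ : ℝ × E₁ → (ℝ × E₁) →L[ℝ] (ℝ × E₁) →L[ℝ] ℝ}
  {G₂ : ℝ × E₂ → (ℝ × E₂) →L[ℝ] (ℝ × E₂) →L[ℝ] ℝ} {s₁ : Set (ℝ × E₁)} {s₂ : Set (ℝ × E₂)}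
  {Λ δ c₁ c₂ ρ : ℝ}

/-- The metric `ρ dt² + γ₁(t) + γ₂(t)` has pinched negative curvature if `ρ` is small. -/
lemma curvature_bounds_fibreMetric (h₁ : IsPinchedUnitLapse G₁ s₁ Λ δ c₁ c₂)
    (h₂ : IsPinchedUnitLapse G₂ s₂ Λ δ c₁ c₂) (hΛ : 0 < Λ) (hδ : 0 < δ) (hc₁ : 0 < c₁)
    (hρ : 0 < ρ) (hρ2 : ρ ≤ 2) (hρc : ρ * (Λ + 2 * Λ ^ 2 / δ + c₂ ^ 2 + 1) ≤ c₁ ^ 2)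
    {z : ℝ × E₁ × E₂} (hz : z ∈ fibreFst E₁ E₂ ⁻¹' s₁ ∩ fibreSnd E₁ E₂ ⁻¹' s₂)
    (u v : ℝ × E₁ × E₂) :
    -(Λ / ρ + Λ + c₂ ^ 2 / ρ) * gramForm (fibreMetric ρ G₁ G₂ z) u v ≤
        curvatureForm (fibreMetric ρ G₁ G₂) z u v ∧
      curvatureForm (fibreMetric ρ G₁ G₂) z u v ≤
        -(min (δ / 4) 1) * gramForm (fibreMetric ρ G₁ G₂ z) u v := by
  have hK := isMetricOn_fibreMetric hρ h₁.toIsUnitLapse h₂.toIsUnitLapse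
  -- With the linear form `dt`, it suffices to treat orthogonal pairs in which `v` is tangent to the
  -- slice.
  refine hK.curvature_bounds_of_adapted hz (ContinuousLinearMap.fst ℝ ℝ (E₁ × E₂))
    (fun u v hv huv => ?_) u v
  rcases u with ⟨a, p₁, p₂⟩
  rcases v with ⟨b, q₁, q₂⟩
  obtain rfl : b = 0 := hv
  set z₁ := fibreFst E₁ E₂ z with hz₁
  set z₂ := fibreSnd E₁ E₂ z with hz₂
  set w₁ : ℝ × E₁ := (0, p₁) with hw₁
  set w₂ : ℝ × E₂ := (0, p₂) with hw₂
  set v₁ : ℝ × E₁ := (0, q₁) with hv₁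
  set v₂ : ℝ × E₂ := (0, q₂) with hv₂
  have eu₁ : fibreFst E₁ E₂ (a, p₁, p₂) = w₁ + a • (1, 0) := by simp [hw₁]
  have eu₂ : fibreSnd E₁ E₂ (a, p₁, p₂) = w₂ + a • (1, 0) := by simp [hw₂]
  have ev₁ : fibreFst E₁ E₂ (0, q₁, q₂) = v₁ := rfl
  have ev₂ : fibreSnd E₁ E₂ (0, q₁, q₂) = v₂ := rfl
  have l₁ := h₁.lapse z₁ hz.1
  have l₂ := h₂.lapse z₂ hz.2
  have l₁' := fun v => h₁.lapse' hz.1 v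
  have l₂' := fun v => h₂.lapse' hz.2 v
  have huv' : G₁ z₁ w₁ v₁ + G₂ z₂ w₂ v₂ = 0 := by
    rw [fibreMetric_apply, eu₁, eu₂, ev₁, ev₂] at huv
    simp only [map_add, map_smul, add_apply, smul_apply, smul_eq_mul, ← hz₁, ← hz₂, l₁, l₂] at huv
    simpa only [hv₁, hv₂, mul_zero, add_zero] using huv
  have huu : fibreMetric ρ G₁ G₂ z (a, p₁, p₂) (a, p₁, p₂) =
      ρ * a ^ 2 + (G₁ z₁ w₁ w₁ + G₂ z₂ w₂ w₂) := by
    rw [fibreMetric_apply, eu₁, eu₂]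
    simp only [map_add, map_smul, add_apply, smul_apply, smul_eq_mul, ← hz₁, ← hz₂, l₁, l₂]
    rw [l₁', l₂']
    simp only [hw₁, hw₂]
    ring
  have hvv : fibreMetric ρ G₁ G₂ z (0, q₁, q₂) (0, q₁, q₂) = G₁ z₁ v₁ v₁ + G₂ z₂ v₂ v₂ := by
    rw [fibreMetric_apply, ev₁, ev₂, ← hz₁, ← hz₂, mul_zero, mul_zero, add_zero]
  have slice₁ : ∀ v, sliceForm G₁ z₁ (w₁ + a • (1, 0)) v = sliceForm G₁ z₁ w₁ v := fun v => by
    rw [sliceForm_add_smul_left, sliceForm_symm h₁.toIsUnitLapse hz.1 (1, 0),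
      h₁.sliceForm_vertical hz.1, mul_zero, add_zero]
  have slice₂ : ∀ v, sliceForm G₂ z₂ (w₂ + a • (1, 0)) v = sliceForm G₂ z₂ w₂ v := fun v => by
    rw [sliceForm_add_smul_left, sliceForm_symm h₂.toIsUnitLapse hz.2 (1, 0),
      h₂.sliceForm_vertical hz.2, mul_zero, add_zero]
  have hcurv := curvature_fibreMetric hρ h₁.toIsUnitLapse h₂.toIsUnitLapse hz (a, p₁, p₂)
    (0, q₁, q₂) hz₁.symm eu₁ ev₁ hz₂.symm eu₂ ev₂
  rw [← curvatureForm, ← curvatureForm, ← curvatureForm, slice₁, slice₁, slice₂, slice₂,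
    sliceForm_add_smul_right, h₁.sliceForm_vertical hz.1, sliceForm_add_smul_right,
    h₂.sliceForm_vertical hz.2, mul_zero, add_zero, add_zero] at hcurv
  obtain ⟨b1, b2, b3, b4⟩ := det_sum_bounds hc₁.le (h₁.form_nonneg hz.1 w₁)
    (h₁.form_nonneg hz.1 v₁) (h₁.sq_form_le hz.1 w₁ v₁) (h₁.le_sliceForm z₁ hz.1 w₁ rfl)
    (h₁.sliceForm_le z₁ hz.1 w₁ rfl) (h₁.le_sliceForm z₁ hz.1 v₁ rfl)
    (h₁.sliceForm_le z₁ hz.1 v₁ rfl) (h₁.sq_sliceForm_sub_le hz.1 (u := w₁) (v := v₁) rfl rfl)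
    (h₂.form_nonneg hz.2 w₂)
    (h₂.form_nonneg hz.2 v₂) (h₂.sq_form_le hz.2 w₂ v₂) (h₂.le_sliceForm z₂ hz.2 w₂ rfl)
    (h₂.sliceForm_le z₂ hz.2 w₂ rfl) (h₂.le_sliceForm z₂ hz.2 v₂ rfl)
    (h₂.sliceForm_le z₂ hz.2 v₂ rfl) (h₂.sq_sliceForm_sub_le hz.2 (u := w₂) (v := v₂) rfl rfl) huv'
  have up₁ := h₁.curvatureForm_le hΛ hδ hz.1 (u := w₁) (v := v₁) rfl rfl a
  have up₂ := h₂.curvatureForm_le hΛ hδ hz.2 (u := w₂) (v := v₂) rfl rfl a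
  have lo₁ := h₁.le_curvatureForm hΛ hz.1 (u := w₁) (v := v₁) rfl rfl a
  have lo₂ := h₂.le_curvatureForm hΛ hz.2 (u := w₂) (v := v₂) rfl rfl a
  have x₁0 := h₁.form_nonneg hz.1 w₁
  have x₂0 := h₂.form_nonneg hz.2 w₂
  have y₁0 := h₁.form_nonneg hz.1 v₁
  have y₂0 := h₂.form_nonneg hz.2 v₂
  rw [gramForm, huv, huu, hvv, hcurv]
  generalize (sliceForm G₁ z₁ w₁ w₁ + sliceForm G₂ z₂ w₂ w₂) *
    (sliceForm G₁ z₁ v₁ v₁ + sliceForm G₂ z₂ v₂ v₂) -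
    (sliceForm G₁ z₁ w₁ v₁ + sliceForm G₂ z₂ w₂ v₂) ^ 2 = D at *
  generalize hD₁ : sliceForm G₁ z₁ w₁ w₁ * sliceForm G₁ z₁ v₁ v₁ - sliceForm G₁ z₁ w₁ v₁ ^ 2 = D₁
    at *
  generalize hD₂ : sliceForm G₂ z₂ w₂ w₂ * sliceForm G₂ z₂ v₂ v₂ - sliceForm G₂ z₂ w₂ v₂ ^ 2 = D₂
    at *
  generalize curvatureForm G₁ z₁ (w₁ + a • (1, 0)) v₁ = N₁ at *
  generalize curvatureForm G₂ z₂ (w₂ + a • (1, 0)) v₂ = N₂ at *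
  generalize G₁ z₁ w₁ w₁ = x₁ at *
  generalize G₂ z₂ w₂ w₂ = x₂ at *
  generalize G₁ z₁ v₁ v₁ = y₁ at *
  generalize G₂ z₂ v₂ v₂ = y₂ at *
  have hxy : x₁ * y₁ + x₂ * y₂ ≤ (x₁ + x₂) * (y₁ + y₂) := by
    have := mul_nonneg x₁0 y₂0
    have := mul_nonneg x₂0 y₁0
    linarith
  -- The squared area splits as `ρ Q + P`, where `P` comes from the slice part of `u` and `Q` from
  -- its `∂_t` part; each curvature term is compared with `P` and `Q` separately.
  set P := (x₁ + x₂) * (y₁ + y₂) with hP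
  have hP0 : 0 ≤ P := mul_nonneg (by linarith) (by linarith)
  set Q := a ^ 2 * (y₁ + y₂) with hQ
  have hQ0 : 0 ≤ Q := mul_nonneg (sq_nonneg a) (by linarith)
  have hgram : (ρ * a ^ 2 + (x₁ + x₂)) * (y₁ + y₂) - 0 ^ 2 = ρ * Q + P := by
    rw [hP, hQ]; ring
  rw [hgram]
  set C := Λ + 2 * Λ ^ 2 / δ with hC
  have hC0 : 0 ≤ C := by positivity
  constructor
  · have d1 : ρ⁻¹ * D ≤ c₂ ^ 2 / ρ * P := by
      have := mul_le_mul_of_nonneg_left b2 (inv_nonneg.2 hρ.le)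
      rw [div_eq_mul_inv]
      linarith
    have n1 : -Λ * (Q + P) ≤ N₁ + N₂ := by
      have := mul_le_mul_of_nonneg_left hxy hΛ.le
      linarith
    have e1 : Λ / ρ * (ρ * Q) = Λ * Q := by field_simp
    have e2 : c₂ ^ 2 / ρ * (ρ * Q) = c₂ ^ 2 * Q := by field_simp
    have p1 : 0 ≤ Λ / ρ * P := by positivity
    have p2 : 0 ≤ Λ * (ρ * Q) := by positivity
    have p3 : 0 ≤ c₂ ^ 2 * Q := by positivity
    linarith
  -- The smallness of `ρ` is used here: the term with `ρ⁻¹` outweighs `C P` from the curvatures of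
  -- the factors and `c₂² P` from their determinants, with `P` to spare. On `Q` the radial part `-δ
  -- / 2` remains, and `ρ ≤ 2` turns it into `-(δ / 4) ρ`.
  · have d1 : (C + c₂ ^ 2 + 1) * P ≤ ρ⁻¹ * D := by
      rw [inv_mul_eq_div, le_div_iff₀ hρ]
      have := mul_le_mul_of_nonneg_right hρc hP0
      linarith
    have n1 : N₁ + N₂ ≤ -(δ / 2) * Q + C * P := by
      have := mul_le_mul_of_nonneg_left hxy hC0
      linarith
    have k1 : min (δ / 4) 1 * (ρ * Q) ≤ δ / 2 * Q := by
      calc min (δ / 4) 1 * (ρ * Q) ≤ (δ / 4) * (2 * Q) :=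
            mul_le_mul (min_le_left _ _) (mul_le_mul_of_nonneg_right hρ2 hQ0) (by positivity)
              (by positivity)
        _ = δ / 2 * Q := by ring
    have k2 : min (δ / 4) 1 * P ≤ 1 * P := mul_le_mul_of_nonneg_right (min_le_right _ _) hP0
    linarith

end FibrePinching

/-! ### Sectional curvature and Hessian of a manifold in a parametrization. -/

section Parametrizations

variable {F : Type*} [NormedAddCommGroup F] [NormedSpace ℝ F] [FiniteDimensional ℝ F]
  {K : F → F →L[ℝ] F →L[ℝ] ℝ} {s : Set F}

lemma IsMetricOn.gramForm_pos (h : IsMetricOn K s) {z : F} (hz : z ∈ s) {u v : F}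
    (huv : LinearIndependent ℝ ![u, v]) : 0 < gramForm (K z) u v := by
  have hv : v ≠ 0 := huv.ne_zero 1
  have hpos := h.pos z hz v hv
  have hw : u + (-(K z u v / K z v v)) • v ≠ 0 := by
    intro h0
    have := (LinearIndependent.pair_iff.1 huv) 1 (-(K z u v / K z v v)) (by rw [one_smul, h0])
    exact one_ne_zero this.1
  have h1 := mul_pos (h.pos z hz _ hw) hpos
  rw [← gramForm_add_smul (h.symm z hz) u v (-(K z u v / K z v v)), gramForm]
  have h2 : K z (u + (-(K z u v / K z v v)) • v) v = 0 := by
    simp only [map_add, add_apply, map_smul, smul_apply, smul_eq_mul]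
    field_simp
    ring
  rw [h2]
  linarith

lemma exists_smul_eq_of_not_linearIndependent {u v : F} (h : ¬LinearIndependent ℝ ![u, v])
    (hv : v ≠ 0) : ∃ c : ℝ, u = c • v := by
  by_contra! hc
  refine h ?_
  rw [LinearIndependent.pair_symm_iff, LinearIndependent.pair_iff' hv]
  exact fun a ha => hc a ha.symm

lemma curvatureForm_eq_zero {z u v : F} (h : ¬LinearIndependent ℝ ![u, v]) :
    curvatureForm K z u v = 0 := by
  by_cases hv : v = 0
  · rw [hv, curvatureForm_zero_right]
  · obtain ⟨c, rfl⟩ := exists_smul_eq_of_not_linearIndependent h hv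
    rw [curvatureForm, coordCurvature_smul_left, coordCurvature_self]
    simp

lemma gramForm_eq_zero {B : F →L[ℝ] F →L[ℝ] ℝ} {u v : F} (h : ¬LinearIndependent ℝ ![u, v]) :
    gramForm B u v = 0 := by
  by_cases hv : v = 0
  · rw [hv]
    simp [gramForm]
  · obtain ⟨c, rfl⟩ := exists_smul_eq_of_not_linearIndependent h hv
    simp only [gramForm, map_smul, smul_apply, smul_eq_mul]
    ring

lemma coordHessian_congr {f f' : F → ℝ} {z : F} (h : f =ᶠ[𝓝 z] f') (u v : F) :
    coordHessian K f z u v = coordHessian K f' z u v := by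
  rw [coordHessian, coordHessian, h.fderiv_eq, h.fderiv.fderiv_eq]

variable {E : Type*} [NormedAddCommGroup E] [NormedSpace ℝ E] [FiniteDimensional ℝ E]
  {H : Type*} [TopologicalSpace H] {I : ModelWithCorners ℝ E H} [I.Boundaryless]
  {M : Type*} [TopologicalSpace M] [ChartedSpace H M] [IsManifold I ∞ M]
  {φ : F → M} {U : Set F}

lemma curvatureForm_pullbackForm (g : SmoothMetric I M) (hU : IsOpen U)
    (hφ : ContMDiffOn 𝓘(ℝ, F) I ∞ φ U)
    (hbij : ∀ z ∈ U, Function.Bijective (paramDeriv I φ z)) {z : F} (hz : z ∈ U) {u v : F}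
    (huv : LinearIndependent ℝ ![u, v]) :
    curvatureForm (pullbackForm g.inner φ) z u v =
      sectionalCurvature g (φ z) (paramDeriv I φ z u) (paramDeriv I φ z v) *
        gramForm (pullbackForm g.inner φ z) u v := by
  have hG := isMetricOn_pullbackMetric g hU hφ fun z hz => (hbij z hz).1
  have h1 := (hG.gramForm_pos hz huv).ne'
  have h2 : curvatureForm (pullbackForm g.inner φ) z u v =
      formAt g.inner (φ z) (riemannTensor g (φ z) (paramDeriv I φ z u) (paramDeriv I φ z v)
        (paramDeriv I φ z v) : E) (paramDeriv I φ z u) := by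
    rw [curvatureForm, pullbackForm_apply, paramDeriv_coordCurvature g hU hφ hbij hz]
  rw [h2, eq_comm]
  exact div_mul_cancel₀ _ h1

lemma linearIndependent_paramDeriv {z : F} (hinj : Function.Injective (paramDeriv I φ z))
    {u v : F} (huv : LinearIndependent ℝ ![u, v]) :
    LinearIndependent ℝ ![paramDeriv I φ z u, paramDeriv I φ z v] := by
  have h := huv.map' (paramDeriv I φ z : F →ₗ[ℝ] E) (LinearMap.ker_eq_bot.2 hinj)
  have e : ![paramDeriv I φ z u, paramDeriv I φ z v] =
      (paramDeriv I φ z : F →ₗ[ℝ] E) ∘ ![u, v] := by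
    funext i
    fin_cases i <;> rfl
  rw [e]
  exact h

/-- The Hessian on the level sets, in an arbitrary parametrization. -/
lemma coordHessian_pullbackForm (g : SmoothMetric I M) (hU : IsOpen U)
    (hφ : ContMDiffOn 𝓘(ℝ, F) I ∞ φ U)
    (hbij : ∀ z ∈ U, Function.Bijective (paramDeriv I φ z)) {f : M → ℝ}
    (hf : ContMDiff I 𝓘(ℝ, ℝ) ∞ f) {z : F} (hz : z ∈ U) (u v : F) :
    coordHessian (pullbackForm g.inner φ) (f ∘ φ) z u v =
      coordHessian (coordMetric g (φ z)) (f ∘ (extChartAt I (φ z)).symm)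
        (extChartAt I (φ z) (φ z)) (paramDeriv I φ z u) (paramDeriv I φ z v) := by
  set x := φ z with hx
  set V := U ∩ φ ⁻¹' (extChartAt I x).source with hV
  have hVo : IsOpen V := isOpen_inter_preimage_chart hU hφ x
  have hzV : z ∈ V := ⟨hz, mem_extChartAt_source x⟩
  have hφV := hφ.mono (Set.inter_subset_left : V ⊆ U)
  have hxV : Set.MapsTo φ V (extChartAt I x).source := fun y hy => hy.2
  have hiso := isCoordIsometry_chart_comp g hVo hφV hxV fun y hy => (hbij y hy.1).2
  have hG := isMetricOn_coordMetric g x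
  have hG' := (isMetricOn_pullbackMetric g hU hφ fun z hz => (hbij z hz).1).mono
    hVo (Set.inter_subset_left : V ⊆ U)
  have hft : ContDiffOn ℝ ∞ (f ∘ (extChartAt I x).symm) (extChartAt I x).target :=
    (hf.comp_contMDiffOn (contMDiffOn_extChartAt_symm x)).contDiffOn
  have h1 := hiso.coordHessian_comp hG hG' hft hzV u v
  have h2 : f ∘ φ =ᶠ[𝓝 z] (f ∘ (extChartAt I x).symm) ∘ (extChartAt I x ∘ φ) := by
    filter_upwards [hVo.mem_nhds hzV] with y hy
    exact congrArg f ((extChartAt I x).left_inv hy.2).symm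
  have h3 : fderiv ℝ (extChartAt I x ∘ φ) z = paramDeriv I φ z := by
    rw [paramDeriv_eq_comp hVo hφV hxV hzV, ← hx, paramDeriv_extChartAt_symm_self,
      ContinuousLinearMap.id_comp]
  rw [coordHessian_congr h2, h1, h3]
  rfl

end Parametrizations

/-! ### An admissible pair in the coordinates of a splitting. -/

section Splittings

variable {n : ℕ} {X : Type*} [TopologicalSpace X]
  [ChartedSpace (EuclideanSpace ℝ (Fin (n + 1))) X] [IsManifold (𝓡 (n + 1)) ∞ X]
  {N : Type*} [TopologicalSpace N] [ChartedSpace (EuclideanSpace ℝ (Fin n)) N]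
  [IsManifold (𝓡 n) ∞ N]

/-- The parametrization of `X` defined by a splitting and a chart of `N`. -/
def splitParam (Φ : ℝ × N → X) (p : N) (z : ℝ × EuclideanSpace ℝ (Fin n)) : X :=
  Φ (z.1, (extChartAt (𝓡 n) p).symm z.2)

variable (n) in
/-- The domain of `splitParam`. -/
def splitDomain (p : N) : Set (ℝ × EuclideanSpace ℝ (Fin n)) :=
  Prod.snd ⁻¹' (extChartAt (𝓡 n) p).target

lemma isOpen_splitDomain (p : N) : IsOpen (splitDomain n p) :=
  (isOpen_extChartAt_target p).preimage continuous_snd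

variable {g : SmoothMetric (𝓡 (n + 1)) X} {f : X → ℝ}
  {Φ : (ℝ × N) ≃ₘ^∞⟮𝓘(ℝ, ℝ).prod (𝓡 n), 𝓡 (n + 1)⟯ X}

lemma contMDiffOn_splitParam (Φ : (ℝ × N) ≃ₘ^∞⟮𝓘(ℝ, ℝ).prod (𝓡 n), 𝓡 (n + 1)⟯ X) (p : N) :
    ContMDiffOn 𝓘(ℝ, ℝ × EuclideanSpace ℝ (Fin n)) (𝓡 (n + 1)) ∞ (splitParam Φ p)
      (splitDomain n p) := by
  have h1 : ContMDiffOn 𝓘(ℝ, ℝ × EuclideanSpace ℝ (Fin n)) (𝓘(ℝ, ℝ).prod (𝓡 n)) ∞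
      (fun z : ℝ × EuclideanSpace ℝ (Fin n) => (z.1, (extChartAt (𝓡 n) p).symm z.2))
      (splitDomain n p) :=
    contDiff_fst.contMDiff.contMDiffOn.prodMk
      ((contMDiffOn_extChartAt_symm (I := 𝓡 n) (n := ∞) p).comp
        contDiff_snd.contMDiff.contMDiffOn fun z hz => hz)
  exact Φ.contMDiff.comp_contMDiffOn h1

lemma contMDiffAt_splitParam (Φ : (ℝ × N) ≃ₘ^∞⟮𝓘(ℝ, ℝ).prod (𝓡 n), 𝓡 (n + 1)⟯ X) (p : N)
    {z : ℝ × EuclideanSpace ℝ (Fin n)} (hz : z ∈ splitDomain n p) :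
    ContMDiffAt 𝓘(ℝ, ℝ × EuclideanSpace ℝ (Fin n)) (𝓡 (n + 1)) ∞ (splitParam Φ p) z :=
  (contMDiffOn_splitParam Φ p).contMDiffAt ((isOpen_splitDomain p).mem_nhds hz)

/-- The inverse of `Φ` followed by the chart of `N` is a smooth local left inverse, so the
differential is injective, and the dimensions agree. -/
lemma paramDeriv_splitParam_bijective
    (Φ : (ℝ × N) ≃ₘ^∞⟮𝓘(ℝ, ℝ).prod (𝓡 n), 𝓡 (n + 1)⟯ X) (p : N)
    {z : ℝ × EuclideanSpace ℝ (Fin n)} (hz : z ∈ splitDomain n p) :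
    Function.Bijective (paramDeriv (𝓡 (n + 1)) (splitParam Φ p) z) := by
  have hinj : Function.Injective (paramDeriv (𝓡 (n + 1)) (splitParam Φ p) z) := by
    set q : N := (extChartAt (𝓡 n) p).symm z.2 with hq
    have hq' : q ∈ (chartAt (EuclideanSpace ℝ (Fin n)) p).source := by
      rw [← extChartAt_source (𝓡 n)]
      exact (extChartAt (𝓡 n) p).map_target hz
    have hΦz : Φ.symm (splitParam Φ p z) = (z.1, q) := Φ.left_inv (z.1, q)
    have h1 : ContMDiffAt (𝓘(ℝ, ℝ).prod (𝓡 n)) 𝓘(ℝ, ℝ × EuclideanSpace ℝ (Fin n)) ∞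
        (fun w : ℝ × N => (w.1, extChartAt (𝓡 n) p w.2)) (Φ.symm (splitParam Φ p z)) := by
      rw [hΦz]
      exact contMDiffAt_fst.prodMk_space
        ((contMDiffAt_extChartAt' (I := 𝓡 n) (n := ∞) hq').comp (z.1, q) contMDiffAt_snd)
    have h2 : ContMDiffAt (𝓡 (n + 1)) 𝓘(ℝ, ℝ × EuclideanSpace ℝ (Fin n)) ∞
        ((fun w : ℝ × N => (w.1, extChartAt (𝓡 n) p w.2)) ∘ Φ.symm) (splitParam Φ p z) :=
      h1.comp _ (Φ.symm.contMDiff _)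
    have h3 := mfderiv_comp z (h2.mdifferentiableAt (by simp))
      ((contMDiffAt_splitParam Φ p hz).mdifferentiableAt (by simp))
    have h4 : ((fun w : ℝ × N => (w.1, extChartAt (𝓡 n) p w.2)) ∘ Φ.symm) ∘ splitParam Φ p
        =ᶠ[𝓝 z] id := by
      filter_upwards [(isOpen_splitDomain p).mem_nhds hz] with y hy
      have e1 : Φ.symm (splitParam Φ p y) = (y.1, (extChartAt (𝓡 n) p).symm y.2) :=
        Φ.left_inv _
      simp only [Function.comp_apply, e1, (extChartAt (𝓡 n) p).right_inv hy, id]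
    rw [h4.mfderiv_eq, mfderiv_id] at h3
    intro u v huv
    have hu := congrArg (fun L : (ℝ × EuclideanSpace ℝ (Fin n)) →L[ℝ]
      ℝ × EuclideanSpace ℝ (Fin n) => L u) h3
    have hv := congrArg (fun L : (ℝ × EuclideanSpace ℝ (Fin n)) →L[ℝ]
      ℝ × EuclideanSpace ℝ (Fin n) => L v) h3
    refine Eq.trans hu (Eq.trans ?_ hv.symm)
    exact congrArg (mfderiv (𝓡 (n + 1)) 𝓘(ℝ, ℝ × EuclideanSpace ℝ (Fin n))
      ((fun w : ℝ × N => (w.1, extChartAt (𝓡 n) p w.2)) ∘ Φ.symm) (splitParam Φ p z)) huv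
  have hfr : Module.finrank ℝ (ℝ × EuclideanSpace ℝ (Fin n)) =
      Module.finrank ℝ (EuclideanSpace ℝ (Fin (n + 1))) := by
    rw [Module.finrank_prod, finrank_euclideanSpace_fin, finrank_euclideanSpace_fin,
      Module.finrank_self, add_comm]
  exact ⟨hinj, (LinearMap.injective_iff_surjective_of_finrank_eq_finrank
    (f := (paramDeriv (𝓡 (n + 1)) (splitParam Φ p) z :
      (ℝ × EuclideanSpace ℝ (Fin n)) →ₗ[ℝ] EuclideanSpace ℝ (Fin (n + 1)))) hfr).1 hinj⟩

namespace IsGradientSplitting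

lemma comp_splitParam (h : IsGradientSplitting g f Φ) (p : N) :
    f ∘ splitParam (n := n) Φ p = (Prod.fst : ℝ × EuclideanSpace ℝ (Fin n) → ℝ) := by
  funext z
  exact h.level _ _

lemma paramDeriv_vertical (h : IsGradientSplitting g f Φ) (p : N)
    {z : ℝ × EuclideanSpace ℝ (Fin n)} (hz : z ∈ splitDomain n p) :
    paramDeriv (𝓡 (n + 1)) (splitParam Φ p) z (1, 0) = grad g f (splitParam Φ p z) := by
  refine Eq.trans ?_ (h.flow z.1 ((extChartAt (𝓡 n) p).symm z.2))
  have h1 : HasFDerivAt (fun s : ℝ => (s, z.2))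
      (ContinuousLinearMap.inl ℝ ℝ (EuclideanSpace ℝ (Fin n))) z.1 :=
    hasFDerivAt_prodMk_left z.1 z.2
  have h2 := mfderiv_comp (f := fun s : ℝ => (s, z.2)) z.1
    ((contMDiffAt_splitParam Φ p hz).mdifferentiableAt (by simp))
    h1.differentiableAt.mdifferentiableAt
  rw [mfderiv_eq_fderiv, h1.fderiv] at h2
  exact (congrArg (fun L : ℝ →L[ℝ] EuclideanSpace ℝ (Fin (n + 1)) => L 1) h2).symm

lemma mfderiv_paramDeriv (h : IsGradientSplitting g f Φ)
    (hf : ContMDiff (𝓡 (n + 1)) 𝓘(ℝ, ℝ) ∞ f) (p : N)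
    {z : ℝ × EuclideanSpace ℝ (Fin n)} (hz : z ∈ splitDomain n p)
    (v : ℝ × EuclideanSpace ℝ (Fin n)) :
    mfderiv (𝓡 (n + 1)) 𝓘(ℝ, ℝ) f (splitParam Φ p z)
      (paramDeriv (𝓡 (n + 1)) (splitParam Φ p) z v) = v.1 := by
  refine (fderiv_comp_param (contMDiffAt_splitParam Φ p hz) hf v).symm.trans ?_
  rw [h.comp_splitParam, fderiv_fst]
  rfl

lemma isUnitLapse (h : IsGradientSplitting g f Φ) (hf : ContMDiff (𝓡 (n + 1)) 𝓘(ℝ, ℝ) ∞ f)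
    (p : N) : IsUnitLapse (pullbackForm g.inner (splitParam Φ p)) (splitDomain n p) where
  toIsMetricOn := isMetricOn_pullbackMetric g (isOpen_splitDomain p)
    (contMDiffOn_splitParam Φ p) fun _ hz => (paramDeriv_splitParam_bijective Φ p hz).1
  lapse z hz v := by
    rw [pullbackForm_apply, h.paramDeriv_vertical p hz]
    exact (formAt_grad g f _ _).trans (h.mfderiv_paramDeriv hf p hz v)

end IsGradientSplitting

/-- Brings the two factors to common constants. -/
lemma IsPinchedUnitLapse.mono {E : Type*} [NormedAddCommGroup E] [NormedSpace ℝ E]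
    [FiniteDimensional ℝ E]
    {G : ℝ × E → (ℝ × E) →L[ℝ] (ℝ × E) →L[ℝ] ℝ} {s : Set (ℝ × E)} {Λ δ c₁ c₂ Λ' δ' c₁' c₂' : ℝ}
    (h : IsPinchedUnitLapse G s Λ δ c₁ c₂) (hΛ : Λ ≤ Λ') (hδ : δ' ≤ δ) (h₁ : c₁' ≤ c₁)
    (h₂ : c₂ ≤ c₂') : IsPinchedUnitLapse G s Λ' δ' c₁' c₂' where
  toIsUnitLapse := h.toIsUnitLapse
  abs_curvature_le z hz u v := by
    refine (h.abs_curvature_le z hz u v).trans (mul_le_mul_of_nonneg_right hΛ ?_)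
    have := h.sq_form_le hz u v
    rw [gramForm]
    linarith
  radial_curvature_le z hz v hv := (h.radial_curvature_le z hz v hv).trans
    (mul_le_mul_of_nonneg_right (neg_le_neg hδ) (h.form_nonneg hz v))
  le_sliceForm z hz v hv := (mul_le_mul_of_nonneg_right h₁ (h.form_nonneg hz v)).trans
    (h.le_sliceForm z hz v hv)
  sliceForm_le z hz v hv := (h.sliceForm_le z hz v hv).trans
    (mul_le_mul_of_nonneg_right h₂ (h.form_nonneg hz v))

/-- The metric of an admissible pair in the coordinates of a splitting. -/
theorem AdmissiblePair.exists_isPinchedUnitLapse (h : AdmissiblePair g f) :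
    ∃ Λ δ c₁ c₂ : ℝ, 0 < δ ∧ 0 < c₁ ∧
      ∀ Φ : (ℝ × N) ≃ₘ^∞⟮𝓘(ℝ, ℝ).prod (𝓡 n), 𝓡 (n + 1)⟯ X, IsGradientSplitting g f Φ →
        ∀ p : N, IsPinchedUnitLapse (pullbackForm g.inner (splitParam Φ p)) (splitDomain n p)
          Λ δ c₁ c₂ := by
  obtain ⟨Λ, hΛ⟩ := h.bounded_curvature
  obtain ⟨δ, hδ, hrad⟩ := h.radial_curvature
  obtain ⟨c₁, c₂, hc₁, -, hc⟩ := h.pinched_convex_levels.hessian h.smooth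
  refine ⟨Λ, δ, c₁, c₂, hδ, hc₁, fun Φ hΦ p => ?_⟩
  have hG := hΦ.isUnitLapse h.smooth p
  have hU := isOpen_splitDomain (n := n) p
  have hφ := contMDiffOn_splitParam Φ p
  have hbij := fun z (hz : z ∈ splitDomain n p) => paramDeriv_splitParam_bijective Φ p hz
  set φ := splitParam (n := n) Φ p with hφdef
  have hslice : ∀ z ∈ splitDomain n p, ∀ v : ℝ × EuclideanSpace ℝ (Fin n), v.1 = 0 →
      c₁ * pullbackForm g.inner φ z v v ≤ sliceForm (pullbackForm g.inner φ) z v v ∧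
      sliceForm (pullbackForm g.inner φ) z v v ≤ c₂ * pullbackForm g.inner φ z v v := by
    intro z hz v hv
    by_cases hv0 : v = 0
    · rw [hv0]
      simp [sliceForm]
    have hpos := hG.pos z hz v hv0
    -- The Hessian bounds are available for unit vectors only; both sides scale quadratically.
    set r := (Real.sqrt (pullbackForm g.inner φ z v v))⁻¹ with hr
    have hr2 : r ^ 2 * pullbackForm g.inner φ z v v = 1 := by
      rw [hr, inv_pow, Real.sq_sqrt hpos.le, inv_mul_cancel₀ hpos.ne']
    have hunit : formAt g.inner (φ z) (paramDeriv (𝓡 (n + 1)) φ z (r • v))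
        (paramDeriv (𝓡 (n + 1)) φ z (r • v)) = 1 := by
      rw [← pullbackForm_apply]
      simp only [map_smul, smul_apply, smul_eq_mul]
      linarith
    have hlevel : fderiv ℝ (f ∘ (extChartAt (𝓡 (n + 1)) (φ z)).symm)
        (extChartAt (𝓡 (n + 1)) (φ z) (φ z)) (paramDeriv (𝓡 (n + 1)) φ z (r • v)) = 0 := by
      rw [fderiv_comp_param (contMDiffAt_extChartAt_symm (φ z) (mem_extChartAt_target (φ z)))
        h.smooth, paramDeriv_extChartAt_symm_self, extChartAt_to_inv]
      refine (hΦ.mfderiv_paramDeriv h.smooth p hz (r • v)).trans ?_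
      exact (congrArg (r * ·) hv).trans (mul_zero r)
    have key := hc (φ z) (paramDeriv (𝓡 (n + 1)) φ z (r • v)) hunit hlevel
    rw [← coordHessian_pullbackForm g hU hφ hbij h.smooth hz, hΦ.comp_splitParam] at key
    -- In splitting coordinates `f` is the linear function `t`. Its second derivative vanishes and
    -- its Hessian is minus the `t` component of the Christoffel symbol, which is the slice form.
    have e1 : coordHessian (pullbackForm g.inner φ) Prod.fst z (r • v) (r • v) =
        r ^ 2 * sliceForm (pullbackForm g.inner φ) z v v := by
      have e2 : fderiv ℝ (Prod.fst : ℝ × EuclideanSpace ℝ (Fin n) → ℝ) =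
          fun _ => ContinuousLinearMap.fst ℝ ℝ (EuclideanSpace ℝ (Fin n)) :=
        funext fun _ => fderiv_fst
      rw [coordHessian, e2, fderiv_fun_const]
      simp only [sliceForm, map_smul, smul_apply, Pi.zero_apply, zero_apply, smul_eq_mul,
        ContinuousLinearMap.coe_fst']
      ring
    rw [e1] at key
    have hr0 : 0 < r ^ 2 := by positivity
    constructor
    · refine le_of_mul_le_mul_left ?_ hr0
      linear_combination key.1 + c₁ * hr2
    · refine le_of_mul_le_mul_left ?_ hr0
      linear_combination key.2 - c₂ * hr2
  refine ⟨hG, fun z hz u v => ?_, fun z hz v hv => ?_, fun z hz v hv => (hslice z hz v hv).1,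
    fun z hz v hv => (hslice z hz v hv).2⟩
  · by_cases huv : LinearIndependent ℝ ![u, v]
    · have hpos := hG.gramForm_pos hz huv
      rw [curvatureForm_pullbackForm g hU hφ hbij hz huv, abs_mul, abs_of_pos hpos]
      exact mul_le_mul_of_nonneg_right
        (hΛ _ _ _ (linearIndependent_paramDeriv (hbij z hz).1 huv)) hpos.le
    · rw [curvatureForm_eq_zero huv, gramForm_eq_zero huv]
      simp
  · by_cases hv0 : v = 0
    · rw [hv0, curvatureForm_zero_right]
      simp
    have huv : LinearIndependent ℝ ![((1, 0) : ℝ × EuclideanSpace ℝ (Fin n)), v] := by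
      rw [LinearIndependent.pair_iff]
      intro a b hab
      have ha : a = 0 := by
        have := congrArg Prod.fst hab
        simpa [hv] using this
      refine ⟨ha, ?_⟩
      rw [ha, zero_smul, zero_add] at hab
      exact (smul_eq_zero.1 hab).resolve_right hv0
    have hli := linearIndependent_paramDeriv (hbij z hz).1 huv
    have hgram : gramForm (pullbackForm g.inner φ z) (1, 0) v = pullbackForm g.inner φ z v v := by
      rw [gramForm, hG.lapse z hz, hG.lapse z hz, hv]
      ring
    rw [curvatureForm_pullbackForm g hU hφ hbij hz huv, hgram]
    rw [hΦ.paramDeriv_vertical p hz] at hli ⊢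
    exact mul_le_mul_of_nonneg_right (hrad _ _ hli).le (hG.pos z hz v hv0).le

end Splittings

/-! ### Riemannian metrics from fields of bilinear forms. -/

section MetricOfForm

variable {E : Type*} [NormedAddCommGroup E] [NormedSpace ℝ E] [FiniteDimensional ℝ E]
  {H : Type*} [TopologicalSpace H] {I : ModelWithCorners ℝ E H} [I.Boundaryless]
  {M : Type*} [TopologicalSpace M] [ChartedSpace H M] [IsManifold I ∞ M]

/-- Compactness of the unit sphere bounds the form below by a multiple of the squared norm; the
sphere is empty when the space is trivial, hence the case distinction. -/
lemma isVonNBounded_of_pos {B : E →L[ℝ] E →L[ℝ] ℝ} (hB : ∀ u, u ≠ 0 → 0 < B u u) :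
    Bornology.IsVonNBounded ℝ {u : E | B u u < 1} := by
  rw [NormedSpace.isVonNBounded_iff, isBounded_iff_forall_norm_le]
  have hcont : Continuous fun u : E => B u u :=
    B.continuous₂.comp (continuous_id.prodMk continuous_id)
  obtain ⟨c, hc, hcB⟩ : ∃ c : ℝ, 0 < c ∧ ∀ u ∈ Metric.sphere (0 : E) 1, c ≤ B u u := by
    rcases (Metric.sphere (0 : E) 1).eq_empty_or_nonempty with h | h
    · exact ⟨1, one_pos, by simp [h]⟩
    · obtain ⟨u, hu, hmin⟩ := (isCompact_sphere (0 : E) 1).exists_isMinOn h hcont.continuousOn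
      exact ⟨B u u, hB u (ne_zero_of_mem_unit_sphere ⟨u, hu⟩), fun v hv => hmin hv⟩
  refine ⟨(Real.sqrt c)⁻¹, fun u hu => ?_⟩
  by_cases hu0 : u = 0
  · rw [hu0, norm_zero]
    positivity
  have hn : 0 < ‖u‖ := norm_pos_iff.2 hu0
  have h1 := hcB (‖u‖⁻¹ • u) (by simp [norm_smul, hn.ne'])
  simp only [map_smul, smul_apply, smul_eq_mul] at h1
  have h2 : c * ‖u‖ ^ 2 < 1 := by
    have h3 : c * ‖u‖ ^ 2 ≤ B u u := by
      have := mul_le_mul_of_nonneg_right h1 (sq_nonneg ‖u‖)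
      field_simp at this
      linarith
    exact h3.trans_lt hu
  rw [← Real.sqrt_inv]
  refine Real.le_sqrt_of_sq_le ?_
  rw [← one_div, le_div_iff₀ hc]
  linarith

lemma pullbackForm_extChartAt_symm_self
    (B : ∀ x : M, TangentSpace I x →L[ℝ] TangentSpace I x →L[ℝ] ℝ) (x : M) :
    pullbackForm B (extChartAt I x).symm (extChartAt I x x) = formAt B x := by
  ext u v
  rw [pullbackForm_apply, paramDeriv_extChartAt_symm_self, extChartAt_to_inv]
  rfl

/-- The Riemannian metric defined by a field of bilinear forms that is a metric tensor in the
coordinates near each point. -/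
def SmoothMetric.ofForm (B : ∀ x : M, TangentSpace I x →L[ℝ] TangentSpace I x →L[ℝ] ℝ)
    (hB : ∀ x : M, ∃ s, extChartAt I x x ∈ s ∧
      IsMetricOn (pullbackForm B (extChartAt I x).symm) s) : SmoothMetric I M where
  inner := B
  symm x u v := by
    obtain ⟨s, hx, hs⟩ := hB x
    have := hs.symm _ hx u v
    rw [pullbackForm_extChartAt_symm_self] at this
    exact this
  pos x u hu := by
    obtain ⟨s, hx, hs⟩ := hB x
    have := hs.pos _ hx u hu
    rw [pullbackForm_extChartAt_symm_self] at this
    exact this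
  isVonNBounded x := by
    obtain ⟨s, hx, hs⟩ := hB x
    have := isVonNBounded_of_pos (hs.pos _ hx)
    rw [pullbackForm_extChartAt_symm_self] at this
    exact this
  contMDiff := contMDiff_of_pullbackForm B fun x => by
    obtain ⟨s, hx, hs⟩ := hB x
    exact hs.smooth.contDiffAt (hs.isOpen.mem_nhds hx)

end MetricOfForm

/-! ### The family of metrics on `ℝ × N₁ × N₂`. -/

section Diagonal

variable {n₁ n₂ : ℕ}
  {X₁ : Type*} [TopologicalSpace X₁] [ChartedSpace (EuclideanSpace ℝ (Fin (n₁ + 1))) X₁]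
  [IsManifold (𝓡 (n₁ + 1)) ∞ X₁]
  {X₂ : Type*} [TopologicalSpace X₂] [ChartedSpace (EuclideanSpace ℝ (Fin (n₂ + 1))) X₂]
  [IsManifold (𝓡 (n₂ + 1)) ∞ X₂]
  {N₁ : Type*} [TopologicalSpace N₁] [ChartedSpace (EuclideanSpace ℝ (Fin n₁)) N₁]
  [IsManifold (𝓡 n₁) ∞ N₁]
  {N₂ : Type*} [TopologicalSpace N₂] [ChartedSpace (EuclideanSpace ℝ (Fin n₂)) N₂]
  [IsManifold (𝓡 n₂) ∞ N₂]

variable (n₁ n₂) in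
/-- The model of `ℝ × N₁ × N₂`. -/
abbrev diagonalModel := 𝓘(ℝ, ℝ).prod ((𝓡 n₁).prod (𝓡 n₂))

variable (n₁ n₂) in
/-- The model vector space of `ℝ × N₁ × N₂`. -/
abbrev DiagonalSpace := ℝ × EuclideanSpace ℝ (Fin n₁) × EuclideanSpace ℝ (Fin n₂)

variable (N₁ N₂) in
/-- The projection `(t, y, y') ↦ (t, y)`. -/
def dropSnd (q : ℝ × N₁ × N₂) : ℝ × N₁ := (q.1, q.2.1)

variable (N₁ N₂) in
/-- The projection `(t, y, y') ↦ (t, y')`. -/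
def dropFst (q : ℝ × N₁ × N₂) : ℝ × N₂ := (q.1, q.2.2)

lemma contMDiff_dropSnd : ContMDiff (diagonalModel n₁ n₂) (𝓘(ℝ, ℝ).prod (𝓡 n₁)) ∞
    (dropSnd N₁ N₂) :=
  contMDiff_fst.prodMk (contMDiff_fst.comp contMDiff_snd)

lemma contMDiff_dropFst : ContMDiff (diagonalModel n₁ n₂) (𝓘(ℝ, ℝ).prod (𝓡 n₂)) ∞
    (dropFst N₁ N₂) :=
  contMDiff_fst.prodMk (contMDiff_snd.comp contMDiff_snd)

lemma extChartAt_diagonal_symm (y : ℝ × N₁ × N₂) (z : DiagonalSpace n₁ n₂) :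
    (extChartAt (diagonalModel n₁ n₂) y).symm z =
      (z.1, (extChartAt (𝓡 n₁) y.2.1).symm z.2.1, (extChartAt (𝓡 n₂) y.2.2).symm z.2.2) := by
  rw [extChartAt_prod, extChartAt_prod, extChartAt_model_space_eq_id]
  rfl

lemma extChartAt_diagonal_target (y : ℝ × N₁ × N₂) :
    (extChartAt (diagonalModel n₁ n₂) y).target =
      fibreFst _ _ ⁻¹' splitDomain n₁ y.2.1 ∩ fibreSnd _ _ ⁻¹' splitDomain n₂ y.2.2 := by
  rw [extChartAt_prod, extChartAt_prod, extChartAt_model_space_eq_id]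
  ext z
  simp only [PartialEquiv.prod_target, Set.mem_prod, splitDomain, Set.mem_inter_iff,
    Set.mem_preimage, fibreFst_apply, fibreSnd_apply, PartialEquiv.refl_target, Set.mem_univ,
    true_and]

lemma mfderiv_paramDeriv_comp {E H M E' H' M' F : Type*}
    [NormedAddCommGroup E] [NormedSpace ℝ E] [TopologicalSpace H] {I : ModelWithCorners ℝ E H}
    [TopologicalSpace M] [ChartedSpace H M]
    [NormedAddCommGroup E'] [NormedSpace ℝ E'] [TopologicalSpace H']
    {I' : ModelWithCorners ℝ E' H'} [TopologicalSpace M'] [ChartedSpace H' M']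
    [NormedAddCommGroup F] [NormedSpace ℝ F] {φ : F → M} {z : F} {a : M → M'}
    (ha : MDifferentiableAt I I' a (φ z)) (hφ : MDifferentiableAt 𝓘(ℝ, F) I φ z) (u : F) :
    (mfderiv I I' a (φ z) : E →L[ℝ] E') (paramDeriv I φ z u) = paramDeriv I' (a ∘ φ) z u :=
  (congrArg (fun L : F →L[ℝ] E' => L u) (mfderiv_comp z ha hφ)).symm

/-- The form `Φ₁^* g₁ + Φ₂^* g₂ + (ρ - 2) dt²` on `ℝ × N₁ × N₂`. -/
def diagonalForm (ρ : ℝ) (g₁ : SmoothMetric (𝓡 (n₁ + 1)) X₁) (g₂ : SmoothMetric (𝓡 (n₂ + 1)) X₂)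
    (Φ₁ : ℝ × N₁ → X₁) (Φ₂ : ℝ × N₂ → X₂) (y : ℝ × N₁ × N₂) :
    DiagonalSpace n₁ n₂ →L[ℝ] DiagonalSpace n₁ n₂ →L[ℝ] ℝ :=
  let d₁ : DiagonalSpace n₁ n₂ →L[ℝ] EuclideanSpace ℝ (Fin (n₁ + 1)) :=
    mfderiv (diagonalModel n₁ n₂) (𝓡 (n₁ + 1)) (Φ₁ ∘ dropSnd N₁ N₂) y
  let d₂ : DiagonalSpace n₁ n₂ →L[ℝ] EuclideanSpace ℝ (Fin (n₂ + 1)) :=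
    mfderiv (diagonalModel n₁ n₂) (𝓡 (n₂ + 1)) (Φ₂ ∘ dropFst N₁ N₂) y
  let dt : DiagonalSpace n₁ n₂ →L[ℝ] ℝ :=
    mfderiv (diagonalModel n₁ n₂) 𝓘(ℝ, ℝ) Prod.fst y
  (formAt g₁.inner (Φ₁ (dropSnd N₁ N₂ y))).bilinearComp d₁ d₁ +
    (formAt g₂.inner (Φ₂ (dropFst N₁ N₂ y))).bilinearComp d₂ d₂ +
    (ρ - 2) • (ContinuousLinearMap.mul ℝ ℝ).bilinearComp dt dt

variable {g₁ : SmoothMetric (𝓡 (n₁ + 1)) X₁} {g₂ : SmoothMetric (𝓡 (n₂ + 1)) X₂}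

/-- In product charts the projections to `ℝ × N₁` and `ℝ × N₂` become the linear maps `fibreFst` and
`fibreSnd`, so the global form is locally the model `fibreMetric ρ`. -/
lemma pullbackForm_diagonalForm (ρ : ℝ)
    (Φ₁ : (ℝ × N₁) ≃ₘ^∞⟮𝓘(ℝ, ℝ).prod (𝓡 n₁), 𝓡 (n₁ + 1)⟯ X₁)
    (Φ₂ : (ℝ × N₂) ≃ₘ^∞⟮𝓘(ℝ, ℝ).prod (𝓡 n₂), 𝓡 (n₂ + 1)⟯ X₂) (y : ℝ × N₁ × N₂)
    {z : DiagonalSpace n₁ n₂} (hz : z ∈ (extChartAt (diagonalModel n₁ n₂) y).target) :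
    pullbackForm (I := diagonalModel n₁ n₂) (diagonalForm ρ g₁ g₂ Φ₁ Φ₂)
        (extChartAt (diagonalModel n₁ n₂) y).symm z =
      fibreMetric ρ (pullbackForm g₁.inner (splitParam Φ₁ y.2.1))
        (pullbackForm g₂.inner (splitParam Φ₂ y.2.2)) z := by
  set P : DiagonalSpace n₁ n₂ → ℝ × N₁ × N₂ := ⇑(extChartAt (diagonalModel n₁ n₂) y).symm with hP
  have hPz : MDifferentiableAt 𝓘(ℝ, DiagonalSpace n₁ n₂) (diagonalModel n₁ n₂) P z :=
    (contMDiffAt_extChartAt_symm y hz).mdifferentiableAt (by simp)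
  have hz' := hz
  rw [extChartAt_diagonal_target] at hz'
  have c₁ : (Φ₁ ∘ dropSnd N₁ N₂) ∘ P = splitParam Φ₁ y.2.1 ∘ fibreFst _ _ := by
    funext w
    exact congrArg (fun q => Φ₁ (dropSnd N₁ N₂ q)) (extChartAt_diagonal_symm y w)
  have c₂ : (Φ₂ ∘ dropFst N₁ N₂) ∘ P = splitParam Φ₂ y.2.2 ∘ fibreSnd _ _ := by
    funext w
    exact congrArg (fun q => Φ₂ (dropFst N₁ N₂ q)) (extChartAt_diagonal_symm y w)
  have ct : Prod.fst ∘ P = (Prod.fst : DiagonalSpace n₁ n₂ → ℝ) := by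
    funext w
    exact congrArg Prod.fst (extChartAt_diagonal_symm y w)
  have e₁ : ∀ u, (mfderiv (diagonalModel n₁ n₂) (𝓡 (n₁ + 1)) (Φ₁ ∘ dropSnd N₁ N₂) (P z) :
      DiagonalSpace n₁ n₂ →L[ℝ] EuclideanSpace ℝ (Fin (n₁ + 1)))
      (paramDeriv (diagonalModel n₁ n₂) P z u) =
      paramDeriv (𝓡 (n₁ + 1)) (splitParam Φ₁ y.2.1) (fibreFst _ _ z) (fibreFst _ _ u) := by
    intro u
    rw [mfderiv_paramDeriv_comp
      (((Φ₁.contMDiff.comp contMDiff_dropSnd) _).mdifferentiableAt (by simp)) hPz, c₁]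
    have hd : MDifferentiableAt 𝓘(ℝ, DiagonalSpace n₁ n₂) 𝓘(ℝ, ℝ × EuclideanSpace ℝ (Fin n₁))
        (fibreFst (EuclideanSpace ℝ (Fin n₁)) (EuclideanSpace ℝ (Fin n₂))) z :=
      ContinuousLinearMap.differentiableAt _ |>.mdifferentiableAt
    have := mfderiv_paramDeriv_comp
      ((contMDiffAt_splitParam Φ₁ y.2.1 hz'.1).mdifferentiableAt (by simp)) hd u
    rw [← this, paramDeriv, paramDeriv, mfderiv_eq_fderiv]
    rw [ContinuousLinearMap.fderiv]
    rfl
  have e₂ : ∀ u, (mfderiv (diagonalModel n₁ n₂) (𝓡 (n₂ + 1)) (Φ₂ ∘ dropFst N₁ N₂) (P z) :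
      DiagonalSpace n₁ n₂ →L[ℝ] EuclideanSpace ℝ (Fin (n₂ + 1)))
      (paramDeriv (diagonalModel n₁ n₂) P z u) =
      paramDeriv (𝓡 (n₂ + 1)) (splitParam Φ₂ y.2.2) (fibreSnd _ _ z) (fibreSnd _ _ u) := by
    intro u
    rw [mfderiv_paramDeriv_comp
      (((Φ₂.contMDiff.comp contMDiff_dropFst) _).mdifferentiableAt (by simp)) hPz, c₂]
    have hd : MDifferentiableAt 𝓘(ℝ, DiagonalSpace n₁ n₂) 𝓘(ℝ, ℝ × EuclideanSpace ℝ (Fin n₂))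
        (fibreSnd (EuclideanSpace ℝ (Fin n₁)) (EuclideanSpace ℝ (Fin n₂))) z :=
      ContinuousLinearMap.differentiableAt _ |>.mdifferentiableAt
    have := mfderiv_paramDeriv_comp
      ((contMDiffAt_splitParam Φ₂ y.2.2 hz'.2).mdifferentiableAt (by simp)) hd u
    rw [← this, paramDeriv, paramDeriv, mfderiv_eq_fderiv]
    rw [ContinuousLinearMap.fderiv]
    rfl
  have et : ∀ u, (mfderiv (diagonalModel n₁ n₂) 𝓘(ℝ, ℝ) Prod.fst (P z) :
      DiagonalSpace n₁ n₂ →L[ℝ] ℝ) (paramDeriv (diagonalModel n₁ n₂) P z u) = u.1 := by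
    intro u
    rw [mfderiv_paramDeriv_comp mdifferentiableAt_fst hPz, ct, paramDeriv, mfderiv_eq_fderiv,
      fderiv_fst]
    rfl
  have b₁ : Φ₁ (dropSnd N₁ N₂ (P z)) = splitParam Φ₁ y.2.1 (fibreFst _ _ z) := congrFun c₁ z
  have b₂ : Φ₂ (dropFst N₁ N₂ (P z)) = splitParam Φ₂ y.2.2 (fibreSnd _ _ z) := congrFun c₂ z
  refine ContinuousLinearMap.ext fun u => ContinuousLinearMap.ext fun v => ?_
  rw [fibreMetric_apply, pullbackForm_apply, pullbackForm_apply, ← e₁, ← e₁,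
    ← e₂, ← e₂, ← b₁, ← b₂, ← et u, ← et v]
  rfl

lemma isMetricOn_diagonalForm {ρ : ℝ} (hρ : 0 < ρ) {f₁ : X₁ → ℝ} {f₂ : X₂ → ℝ}
    {Φ₁ : (ℝ × N₁) ≃ₘ^∞⟮𝓘(ℝ, ℝ).prod (𝓡 n₁), 𝓡 (n₁ + 1)⟯ X₁}
    {Φ₂ : (ℝ × N₂) ≃ₘ^∞⟮𝓘(ℝ, ℝ).prod (𝓡 n₂), 𝓡 (n₂ + 1)⟯ X₂}
    (h₁ : IsGradientSplitting g₁ f₁ Φ₁) (h₂ : IsGradientSplitting g₂ f₂ Φ₂)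
    (hf₁ : ContMDiff (𝓡 (n₁ + 1)) 𝓘(ℝ, ℝ) ∞ f₁) (hf₂ : ContMDiff (𝓡 (n₂ + 1)) 𝓘(ℝ, ℝ) ∞ f₂)
    (y : ℝ × N₁ × N₂) :
    IsMetricOn (pullbackForm (I := diagonalModel n₁ n₂) (diagonalForm ρ g₁ g₂ Φ₁ Φ₂)
      (extChartAt (diagonalModel n₁ n₂) y).symm) (extChartAt (diagonalModel n₁ n₂) y).target := by
  have h := isMetricOn_fibreMetric hρ (h₁.isUnitLapse hf₁ y.2.1) (h₂.isUnitLapse hf₂ y.2.2)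
  rw [← extChartAt_diagonal_target] at h
  have e := fun z hz => pullbackForm_diagonalForm (g₁ := g₁) (g₂ := g₂) ρ Φ₁ Φ₂ y (z := z) hz
  refine ⟨h.isOpen, h.smooth.congr e, fun z hz u v => ?_, fun z hz u hu => ?_⟩
  · rw [e z hz]
    exact h.symm z hz u v
  · rw [e z hz]
    exact h.pos z hz u hu

/-- The Riemannian metric `Φ₁^* g₁ + Φ₂^* g₂ + (ρ - 2) dt²` on `ℝ × N₁ × N₂`. -/
def diagonalMetric {ρ : ℝ} (hρ : 0 < ρ) {f₁ : X₁ → ℝ} {f₂ : X₂ → ℝ}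
    {Φ₁ : (ℝ × N₁) ≃ₘ^∞⟮𝓘(ℝ, ℝ).prod (𝓡 n₁), 𝓡 (n₁ + 1)⟯ X₁}
    {Φ₂ : (ℝ × N₂) ≃ₘ^∞⟮𝓘(ℝ, ℝ).prod (𝓡 n₂), 𝓡 (n₂ + 1)⟯ X₂}
    (h₁ : IsGradientSplitting g₁ f₁ Φ₁) (h₂ : IsGradientSplitting g₂ f₂ Φ₂)
    (hf₁ : ContMDiff (𝓡 (n₁ + 1)) 𝓘(ℝ, ℝ) ∞ f₁) (hf₂ : ContMDiff (𝓡 (n₂ + 1)) 𝓘(ℝ, ℝ) ∞ f₂) :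
    SmoothMetric (diagonalModel n₁ n₂) (ℝ × N₁ × N₂) :=
  SmoothMetric.ofForm (diagonalForm ρ g₁ g₂ Φ₁ Φ₂) fun y =>
    ⟨_, mem_extChartAt_target y, isMetricOn_diagonalForm hρ h₁ h₂ hf₁ hf₂ y⟩

end Diagonal

/-! ### Comparing distances of comparable metrics. -/

section Comparison

variable {E : Type*} [NormedAddCommGroup E] [NormedSpace ℝ E]
  {H : Type*} [TopologicalSpace H] {I : ModelWithCorners ℝ E H}
  {M : Type*} [TopologicalSpace M] [ChartedSpace H M] [IsManifold I ∞ M]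

/-- The norm of the velocity of a curve. -/
def speed (g : SmoothMetric I M) (γ : ℝ → M) (t : ℝ) : ℝ≥0∞ :=
  ENNReal.ofReal (Real.sqrt (g.inner (γ t) (velocity I γ t) (velocity I γ t)))

open scoped Bundle in
lemma rdist_le_lintegral_speed (g : SmoothMetric I M) {γ : ℝ → M}
    (hγ : ContMDiffOn 𝓘(ℝ, ℝ) I 1 γ (Set.Icc 0 1)) :
    rdist g (γ 0) (γ 1) ≤ ∫⁻ t in Set.Ioo (0 : ℝ) 1, speed g γ t := by
  let : Bundle.RiemannianBundle (fun x : M => TangentSpace I x) := ⟨g.toRiemannianMetric⟩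
  refine (Manifold.riemannianEDist_le_pathELength hγ rfl rfl zero_le_one).trans ?_
  rw [Manifold.pathELength_eq_lintegral_mfderiv_Ioo]
  refine MeasureTheory.lintegral_mono fun t => ?_
  change ‖velocity I γ t‖ₑ ≤ _
  rw [← ofReal_norm, norm_eq_sqrt_real_inner]
  exact le_rfl

open scoped Bundle in
lemma exists_lintegral_speed_lt (g : SmoothMetric I M) {x y : M} {r : ℝ≥0∞}
    (hr : rdist g x y < r) : ∃ γ : ℝ → M, γ 0 = x ∧ γ 1 = y ∧
      ContMDiffOn 𝓘(ℝ, ℝ) I 1 γ (Set.Icc 0 1) ∧ ∫⁻ t in Set.Ioo (0 : ℝ) 1, speed g γ t < r := by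
  let : Bundle.RiemannianBundle (fun x : M => TangentSpace I x) := ⟨g.toRiemannianMetric⟩
  obtain ⟨γ, h0, h1, hγ, hlt⟩ := Manifold.exists_lt_of_riemannianEDist_lt hr
  refine ⟨γ, h0, h1, hγ, lt_of_le_of_lt ?_ hlt⟩
  rw [Manifold.pathELength_eq_lintegral_mfderiv_Ioo]
  refine MeasureTheory.lintegral_mono fun t => ?_
  change _ ≤ ‖velocity I γ t‖ₑ
  rw [← ofReal_norm, norm_eq_sqrt_real_inner]
  exact le_rfl

lemma rdist_le_mul_of_le {g h : SmoothMetric I M} {C : ℝ≥0} (hC : C ≠ 0)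
    (hgh : ∀ (x : M) (v : TangentSpace I x), h.inner x v v ≤ C ^ 2 * g.inner x v v) (x y : M) :
    rdist h x y ≤ C * rdist g x y := by
  have hC' : (C : ℝ≥0∞) ≠ 0 := ENNReal.coe_ne_zero.2 hC
  rw [← ENNReal.div_le_iff' hC' ENNReal.coe_ne_top]
  refine le_of_forall_gt_imp_ge_of_dense fun r hr => ?_
  rw [ENNReal.div_le_iff' hC' ENNReal.coe_ne_top]
  obtain ⟨γ, rfl, rfl, hγ, hlt⟩ := exists_lintegral_speed_lt g hr
  refine (rdist_le_lintegral_speed h hγ).trans ?_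
  have hspeed : ∀ t, speed h γ t ≤ C * speed g γ t := by
    intro t
    rw [speed, speed, ← ENNReal.ofReal_coe_nnreal, ← ENNReal.ofReal_mul C.coe_nonneg]
    refine ENNReal.ofReal_le_ofReal ?_
    rw [← Real.sqrt_sq C.coe_nonneg, ← Real.sqrt_mul (sq_nonneg _)]
    exact Real.sqrt_le_sqrt (hgh _ _)
  calc ∫⁻ t in Set.Ioo (0 : ℝ) 1, speed h γ t
      ≤ ∫⁻ t in Set.Ioo (0 : ℝ) 1, C * speed g γ t := MeasureTheory.lintegral_mono hspeed
    _ = C * ∫⁻ t in Set.Ioo (0 : ℝ) 1, speed g γ t :=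
        MeasureTheory.lintegral_const_mul' _ _ ENNReal.coe_ne_top
    _ ≤ C * r := by gcongr

end Comparison

/-! ### The embedding, the Lipschitz equivalence and the choice of `ρ`. -/

section Diagonal

variable {n₁ n₂ : ℕ}
  {X₁ : Type*} [TopologicalSpace X₁] [ChartedSpace (EuclideanSpace ℝ (Fin (n₁ + 1))) X₁]
  [IsManifold (𝓡 (n₁ + 1)) ∞ X₁]
  {X₂ : Type*} [TopologicalSpace X₂] [ChartedSpace (EuclideanSpace ℝ (Fin (n₂ + 1))) X₂]
  [IsManifold (𝓡 (n₂ + 1)) ∞ X₂]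
  {N₁ : Type*} [TopologicalSpace N₁] [ChartedSpace (EuclideanSpace ℝ (Fin n₁)) N₁]
  [IsManifold (𝓡 n₁) ∞ N₁]
  {N₂ : Type*} [TopologicalSpace N₂] [ChartedSpace (EuclideanSpace ℝ (Fin n₂)) N₂]
  [IsManifold (𝓡 n₂) ∞ N₂]
  {g₁ : SmoothMetric (𝓡 (n₁ + 1)) X₁} {g₂ : SmoothMetric (𝓡 (n₂ + 1)) X₂}
  {ρ ρ' : ℝ} {f₁ : X₁ → ℝ} {f₂ : X₂ → ℝ}
  {Φ₁ : (ℝ × N₁) ≃ₘ^∞⟮𝓘(ℝ, ℝ).prod (𝓡 n₁), 𝓡 (n₁ + 1)⟯ X₁}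
  {Φ₂ : (ℝ × N₂) ≃ₘ^∞⟮𝓘(ℝ, ℝ).prod (𝓡 n₂), 𝓡 (n₂ + 1)⟯ X₂}

lemma isEmbedding_diagonalMap : Topology.IsEmbedding (diagonalMap Φ₁ Φ₂) := by
  have hc₁ := Φ₁.continuous
  have hc₂ := Φ₂.continuous
  have hs₁ := Φ₁.symm.continuous
  have hs₂ := Φ₂.symm.continuous
  refine Topology.IsEmbedding.of_leftInverse
    (f := fun x : X₁ × X₂ => ((Φ₁.symm x.1).1, (Φ₁.symm x.1).2, (Φ₂.symm x.2).2)) ?_ ?_ ?_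
  · intro q
    have e₁ : Φ₁.symm (Φ₁ (q.1, q.2.1)) = (q.1, q.2.1) := Φ₁.left_inv _
    have e₂ : Φ₂.symm (Φ₂ (q.1, q.2.2)) = (q.1, q.2.2) := Φ₂.left_inv _
    simp only [diagonalMap, e₁, e₂]
  · fun_prop
  · unfold diagonalMap
    fun_prop

lemma isRiemannianEmbedding_diagonalMap (h₁ : IsGradientSplitting g₁ f₁ Φ₁)
    (h₂ : IsGradientSplitting g₂ f₂ Φ₂)
    (hf₁ : ContMDiff (𝓡 (n₁ + 1)) 𝓘(ℝ, ℝ) ∞ f₁) (hf₂ : ContMDiff (𝓡 (n₂ + 1)) 𝓘(ℝ, ℝ) ∞ f₂) :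
    IsRiemannianEmbedding g₁ g₂ (diagonalMetric two_pos h₁ h₂ hf₁ hf₂) (diagonalMap Φ₁ Φ₂) where
  smooth := (Φ₁.contMDiff.comp contMDiff_dropSnd).prodMk (Φ₂.contMDiff.comp contMDiff_dropFst)
  embedding := isEmbedding_diagonalMap
  isometric y u v := by
    have d₁ := ((Φ₁.contMDiff.comp (contMDiff_dropSnd (n₁ := n₁) (n₂ := n₂) (N₁ := N₁) (N₂ := N₂))) y).mdifferentiableAt
      (by simp)
    have d₂ := ((Φ₂.contMDiff.comp (contMDiff_dropFst (n₁ := n₁) (n₂ := n₂) (N₁ := N₁) (N₂ := N₂))) y).mdifferentiableAt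
      (by simp)
    have e := mfderiv_prodMk d₁ d₂
    refine Eq.trans ?_ (congrArg (fun L : DiagonalSpace n₁ n₂ →L[ℝ]
      EuclideanSpace ℝ (Fin (n₁ + 1)) × EuclideanSpace ℝ (Fin (n₂ + 1)) =>
      prodInner g₁ g₂ (diagonalMap Φ₁ Φ₂ y) (L u) (L v)) e).symm
    change diagonalForm 2 g₁ g₂ Φ₁ Φ₂ y u v = _
    -- At `ρ = 2` the correction `(ρ - 2) dt²` vanishes and the form is the pullback of the product
    -- metric.
    rw [diagonalForm, sub_self, zero_smul, add_zero]
    rfl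

lemma diagonalMetric_inner (hρ : 0 < ρ) (h₁ : IsGradientSplitting g₁ f₁ Φ₁)
    (h₂ : IsGradientSplitting g₂ f₂ Φ₂)
    (hf₁ : ContMDiff (𝓡 (n₁ + 1)) 𝓘(ℝ, ℝ) ∞ f₁) (hf₂ : ContMDiff (𝓡 (n₂ + 1)) 𝓘(ℝ, ℝ) ∞ f₂)
    (y : ℝ × N₁ × N₂) :
    formAt (diagonalMetric hρ h₁ h₂ hf₁ hf₂).inner y =
      fibreMetric ρ (pullbackForm g₁.inner (splitParam Φ₁ y.2.1))
        (pullbackForm g₂.inner (splitParam Φ₂ y.2.2)) (extChartAt (diagonalModel n₁ n₂) y y) := by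
  rw [← pullbackForm_diagonalForm ρ Φ₁ Φ₂ y (mem_extChartAt_target y)]
  exact (pullbackForm_extChartAt_symm_self (diagonalMetric hρ h₁ h₂ hf₁ hf₂).inner y).symm

lemma lipschitzEquivalent_diagonalMetric (hρ : 0 < ρ) (hρ2 : ρ ≤ 2)
    (h₁ : IsGradientSplitting g₁ f₁ Φ₁) (h₂ : IsGradientSplitting g₂ f₂ Φ₂)
    (hf₁ : ContMDiff (𝓡 (n₁ + 1)) 𝓘(ℝ, ℝ) ∞ f₁) (hf₂ : ContMDiff (𝓡 (n₂ + 1)) 𝓘(ℝ, ℝ) ∞ f₂) :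
    LipschitzEquivalent (diagonalMetric two_pos h₁ h₂ hf₁ hf₂)
      (diagonalMetric hρ h₁ h₂ hf₁ hf₂) := by
  have hC : 1 ≤ 2 / ρ := (one_le_div hρ).2 hρ2
  -- The squared norms compare with factor `2 / ρ`, so its square root would suffice for distances;
  -- since `2 / ρ ≥ 1`, the simpler constant `2 / ρ` works too.
  have hC2 : 2 / ρ ≤ (2 / ρ) ^ 2 := by nlinarith
  have hcoe : ((2 / ρ).toNNReal : ℝ) = 2 / ρ := Real.coe_toNNReal _ (by positivity)
  have hC0 : 0 < (2 / ρ).toNNReal := Real.toNNReal_pos.2 (by positivity)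
  have key : ∀ (y : ℝ × N₁ × N₂) (v : DiagonalSpace n₁ n₂),
      0 ≤ formAt (diagonalMetric hρ h₁ h₂ hf₁ hf₂).inner y v v ∧
      formAt (diagonalMetric hρ h₁ h₂ hf₁ hf₂).inner y v v ≤
        formAt (diagonalMetric two_pos h₁ h₂ hf₁ hf₂).inner y v v ∧
      formAt (diagonalMetric two_pos h₁ h₂ hf₁ hf₂).inner y v v ≤
        (2 / ρ) * formAt (diagonalMetric hρ h₁ h₂ hf₁ hf₂).inner y v v := by
    intro y v
    have hy := mem_extChartAt_target (I := diagonalModel n₁ n₂) y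
    rw [extChartAt_diagonal_target] at hy
    have i₁ := (h₁.isUnitLapse hf₁ y.2.1).sq_fst_le hy.1 (fibreFst _ _ v)
    have i₂ := (h₂.isUnitLapse hf₂ y.2.2).sq_fst_le hy.2 (fibreSnd _ _ v)
    rw [diagonalMetric_inner, diagonalMetric_inner, fibreMetric_apply, fibreMetric_apply]
    simp only [fibreFst_apply, fibreSnd_apply] at i₁ i₂ ⊢
    set A := pullbackForm g₁.inner (splitParam (n := n₁) Φ₁ y.2.1) _ _ _
    set B := pullbackForm g₂.inner (splitParam (n := n₂) Φ₂ y.2.2) _ _ _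
    refine ⟨by nlinarith [mul_nonneg hρ.le (sq_nonneg v.1)],
      by nlinarith [mul_nonneg (sub_nonneg.2 hρ2) (sq_nonneg v.1)], ?_⟩
    rw [div_mul_eq_mul_div, le_div_iff₀ hρ]
    -- The inequality amounts to `(2 - ρ) (A + B - 2 dt²) ≥ 0`, and each of `A`, `B` dominates
    -- `dt²`.
    nlinarith [mul_nonneg (sub_nonneg.2 hρ2) (sub_nonneg.2 i₁),
      mul_nonneg (sub_nonneg.2 hρ2) (sub_nonneg.2 i₂)]
  refine ⟨(2 / ρ).toNNReal, hC0, fun x y => ⟨rdist_le_mul_of_le hC0.ne' (fun x v => ?_) x y,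
    rdist_le_mul_of_le hC0.ne' (fun x v => ?_) x y⟩⟩
  · obtain ⟨k0, k1, -⟩ := key x v
    rw [hcoe]
    refine k1.trans (le_mul_of_one_le_left (k0.trans k1) (hC.trans hC2))
  · obtain ⟨k0, -, k2⟩ := key x v
    rw [hcoe]
    exact k2.trans (mul_le_mul_of_nonneg_right hC2 k0)

lemma coordCurvature_congr {E : Type*} [NormedAddCommGroup E] [NormedSpace ℝ E]
    {G G' : E → E →L[ℝ] E →L[ℝ] ℝ} {z : E} (h : G =ᶠ[𝓝 z] G') :
    coordCurvature G z = coordCurvature G' z := by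
  have h1 : coordChristoffel G =ᶠ[𝓝 z] coordChristoffel G' := by
    filter_upwards [h, h.fderiv (𝕜 := ℝ)] with y hy hy'
    rw [coordChristoffel, coordChristoffel, hy, hy']
  funext u v w
  rw [coordCurvature, coordCurvature, h1.fderiv_eq, h1.eq_of_nhds]

lemma curvatureForm_congr {E : Type*} [NormedAddCommGroup E] [NormedSpace ℝ E]
    {G G' : E → E →L[ℝ] E →L[ℝ] ℝ} {z : E} (h : G =ᶠ[𝓝 z] G') (u v : E) :
    curvatureForm G z u v = curvatureForm G' z u v := by
  rw [curvatureForm, curvatureForm, coordCurvature_congr h, h.eq_of_nhds]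

lemma curvatureForm_coordMetric {E : Type*} [NormedAddCommGroup E] [NormedSpace ℝ E]
    [FiniteDimensional ℝ E] {H : Type*} [TopologicalSpace H] {I : ModelWithCorners ℝ E H}
    [I.Boundaryless] {M : Type*} [TopologicalSpace M] [ChartedSpace H M] [IsManifold I ∞ M]
    (g : SmoothMetric I M) (x : M) {u v : E} (huv : LinearIndependent ℝ ![u, v]) :
    0 < gramForm (formAt g.inner x) u v ∧
    curvatureForm (coordMetric g x) (extChartAt I x x) u v =
      sectionalCurvature g x u v * gramForm (formAt g.inner x) u v := by
  have h1 := (isMetricOn_coordMetric g x).gramForm_pos (mem_extChartAt_target x) huv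
  rw [coordMetric_self] at h1
  refine ⟨h1, ?_⟩
  rw [curvatureForm, coordMetric_self, eq_comm]
  refine (div_mul_cancel₀ _ h1.ne').trans ?_
  rw [riemannTensor_eq]
  rfl

/-- The metric on the diagonal with a short `dt²` has pinched negative curvature. -/
theorem exists_hasPinchedNegativeCurvature (h₁ : AdmissiblePair g₁ f₁) (h₂ : AdmissiblePair g₂ f₂)
    (hΦ₁ : IsGradientSplitting g₁ f₁ Φ₁) (hΦ₂ : IsGradientSplitting g₂ f₂ Φ₂) :
    ∃ (ρ : ℝ) (hρ : 0 < ρ), ρ ≤ 2 ∧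
      HasPinchedNegativeCurvature (diagonalMetric hρ hΦ₁ hΦ₂ h₁.smooth h₂.smooth) := by
  obtain ⟨Λ₁, δ₁, a₁, b₁, hδ₁, ha₁, hp₁⟩ := h₁.exists_isPinchedUnitLapse (N := N₁)
  obtain ⟨Λ₂, δ₂, a₂, b₂, hδ₂, ha₂, hp₂⟩ := h₂.exists_isPinchedUnitLapse (N := N₂)
  obtain ⟨Λ, hΛ, hΛ₁, hΛ₂⟩ : ∃ Λ : ℝ, 0 < Λ ∧ Λ₁ ≤ Λ ∧ Λ₂ ≤ Λ :=
    -- The given curvature bounds need not be positive, since they are vacuous when there are no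
    -- tangent planes; the entry `1` ensures positivity.
    ⟨max 1 (max Λ₁ Λ₂), by positivity, by simp, by simp⟩
  obtain ⟨δ, hδ, hδ₁', hδ₂'⟩ : ∃ δ : ℝ, 0 < δ ∧ δ ≤ δ₁ ∧ δ ≤ δ₂ :=
    ⟨min δ₁ δ₂, lt_min hδ₁ hδ₂, min_le_left _ _, min_le_right _ _⟩
  obtain ⟨a, ha, ha₁', ha₂'⟩ : ∃ a : ℝ, 0 < a ∧ a ≤ a₁ ∧ a ≤ a₂ :=
    ⟨min a₁ a₂, lt_min ha₁ ha₂, min_le_left _ _, min_le_right _ _⟩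
  obtain ⟨b, hb₁, hb₂⟩ : ∃ b : ℝ, b₁ ≤ b ∧ b₂ ≤ b :=
    ⟨max b₁ b₂, le_max_left _ _, le_max_right _ _⟩
  have hD : 0 < Λ + 2 * Λ ^ 2 / δ + b ^ 2 + 1 := by positivity
  obtain ⟨ρ, hρ, hρ2, hρc⟩ : ∃ ρ : ℝ, 0 < ρ ∧ ρ ≤ 2 ∧
      ρ * (Λ + 2 * Λ ^ 2 / δ + b ^ 2 + 1) ≤ a ^ 2 := by
    refine ⟨min 2 (a ^ 2 / (Λ + 2 * Λ ^ 2 / δ + b ^ 2 + 1)), by positivity, min_le_left _ _, ?_⟩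
    rw [← le_div_iff₀ hD]
    exact min_le_right _ _
  have hm : 0 < min (δ / 4) 1 := by positivity
  refine ⟨ρ, hρ, hρ2, Real.sqrt (min (δ / 4) 1),
    -- The maximum guarantees that the lower curvature constant is at least the upper one in
    -- absolute value, as required even when there are no tangent planes.
    Real.sqrt (max (Λ / ρ + Λ + b ^ 2 / ρ) (min (δ / 4) 1)), Real.sqrt_pos.2 hm,
    Real.sqrt_le_sqrt (le_max_right _ _), fun y u v huv => ?_⟩
  rw [Real.sq_sqrt hm.le, Real.sq_sqrt (hm.le.trans (le_max_right _ _))]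
  set h := diagonalMetric hρ hΦ₁ hΦ₂ h₁.smooth h₂.smooth with hh
  suffices key : ∀ u v : DiagonalSpace n₁ n₂, LinearIndependent ℝ ![u, v] →
      -max (Λ / ρ + Λ + b ^ 2 / ρ) (min (δ / 4) 1) ≤ sectionalCurvature h y u v ∧
        sectionalCurvature h y u v ≤ -min (δ / 4) 1 from key u v huv
  clear huv u v
  intro u v huv
  have hy := mem_extChartAt_target (I := diagonalModel n₁ n₂) y
  have hy' := hy
  rw [extChartAt_diagonal_target] at hy'
  have hcurv := curvature_bounds_fibreMetric ((hp₁ Φ₁ hΦ₁ y.2.1).mono hΛ₁ hδ₁' ha₁' hb₁)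
    ((hp₂ Φ₂ hΦ₂ y.2.2).mono hΛ₂ hδ₂' ha₂' hb₂) hΛ hδ ha hρ hρ2 hρc hy' u v
  have heq : coordMetric h y =ᶠ[𝓝 (extChartAt (diagonalModel n₁ n₂) y y)]
      fibreMetric ρ (pullbackForm g₁.inner (splitParam Φ₁ y.2.1))
        (pullbackForm g₂.inner (splitParam Φ₂ y.2.2)) := by
    filter_upwards [(isOpen_extChartAt_target y).mem_nhds hy] with z hz
    exact pullbackForm_diagonalForm ρ Φ₁ Φ₂ y hz
  rw [← curvatureForm_congr heq, ← heq.eq_of_nhds, coordMetric_self] at hcurv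
  obtain ⟨hpos, hsec⟩ := curvatureForm_coordMetric h y huv
  rw [hsec] at hcurv
  exact ⟨(neg_le_neg (le_max_left _ _)).trans (le_of_mul_le_mul_right hcurv.1 hpos),
    le_of_mul_le_mul_right hcurv.2 hpos⟩

end Diagonal

end RiemGeom

end

theorem proposition1 {n₁ n₂ : ℕ}
    {X₁ : Type u₁} [TopologicalSpace X₁] [T2Space X₁] [SecondCountableTopology X₁]
    [ChartedSpace (EuclideanSpace ℝ (Fin (n₁ + 1))) X₁] [IsManifold (𝓡 (n₁ + 1)) ∞ X₁]
    {X₂ : Type u₂} [TopologicalSpace X₂] [T2Space X₂] [SecondCountableTopology X₂]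
    [ChartedSpace (EuclideanSpace ℝ (Fin (n₂ + 1))) X₂] [IsManifold (𝓡 (n₂ + 1)) ∞ X₂]
    (g₁ : RiemGeom.SmoothMetric (𝓡 (n₁ + 1)) X₁) (f₁ : X₁ → ℝ)
    (g₂ : RiemGeom.SmoothMetric (𝓡 (n₂ + 1)) X₂) (f₂ : X₂ → ℝ)
    (h₁ : RiemGeom.AdmissiblePair g₁ f₁) (h₂ : RiemGeom.AdmissiblePair g₂ f₂) :
    RiemGeom.HasGradientSplitting g₁ f₁ ∧ RiemGeom.HasGradientSplitting g₂ f₂ ∧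
    ∀ (N₁ : Type v₁) [TopologicalSpace N₁]
      [ChartedSpace (EuclideanSpace ℝ (Fin n₁)) N₁] [IsManifold (𝓡 n₁) ∞ N₁]
      (N₂ : Type v₂) [TopologicalSpace N₂]
      [ChartedSpace (EuclideanSpace ℝ (Fin n₂)) N₂] [IsManifold (𝓡 n₂) ∞ N₂]
      (Φ₁ : (ℝ × N₁) ≃ₘ^∞⟮𝓘(ℝ, ℝ).prod (𝓡 n₁), 𝓡 (n₁ + 1)⟯ X₁)
      (Φ₂ : (ℝ × N₂) ≃ₘ^∞⟮𝓘(ℝ, ℝ).prod (𝓡 n₂), 𝓡 (n₂ + 1)⟯ X₂),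
      RiemGeom.IsGradientSplitting g₁ f₁ Φ₁ → RiemGeom.IsGradientSplitting g₂ f₂ Φ₂ →
      ∃ gY : RiemGeom.SmoothMetric (𝓘(ℝ, ℝ).prod ((𝓡 n₁).prod (𝓡 n₂))) (ℝ × N₁ × N₂),
        RiemGeom.IsRiemannianEmbedding g₁ g₂ gY (RiemGeom.diagonalMap Φ₁ Φ₂) ∧
        ∃ h : RiemGeom.SmoothMetric (𝓘(ℝ, ℝ).prod ((𝓡 n₁).prod (𝓡 n₂))) (ℝ × N₁ × N₂),
          RiemGeom.LipschitzEquivalent gY h ∧ RiemGeom.HasPinchedNegativeCurvature h := by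
  refine ⟨h₁.hasGradientSplitting, h₂.hasGradientSplitting, ?_⟩
  intro N₁ _ _ _ N₂ _ _ _ Φ₁ Φ₂ hΦ₁ hΦ₂
  obtain ⟨ρ, hρ, hρ2, hK⟩ := RiemGeom.exists_hasPinchedNegativeCurvature h₁ h₂ hΦ₁ hΦ₂
  exact ⟨_, RiemGeom.isRiemannianEmbedding_diagonalMap hΦ₁ hΦ₂ h₁.smooth h₂.smooth, _,
    RiemGeom.lipschitzEquivalent_diagonalMetric hρ hρ2 hΦ₁ hΦ₂ h₁.smooth h₂.smooth, hK⟩
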